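/- Let $\Bbbk$ be a field of characteristic zero; graded means $\mathbb Z$-graded, elements are homogeneous, $P(n)$ is the set of partitions $\pi=B_1\sqcup\dots\sqcup B_{|\pi|}$ of $\{1,\dots,n\}$ (blocks ordered by their maxima), $\epsilon(\pi)$ is the Koszul sign of $x_1\otimes\dots\otimes x_n\mapsto x_{B_1}\otimes\dots\otimes x_{B_{|\pi|}}$, $\epsilon(\pi,i)=\epsilon(\pi)(-1)^{|x_{B_1}|+\dots+|x_{B_{i-1}}|}$, and $F(x_B)=F_r(x_{j_1},\dots,x_{j_r})$ for a block $B=\{j_1<\dots<j_r\}$. A correlation algebra is a pointed graded vector space $(V,1_V)$ with degree $0$ maps $M_n:S^nV\to V$, $n\ge1$, such that $M_1=\mathrm{id}$ and $M_{n+1}(v_1,\dots,v_n,1_V)=M_n(v_1,\dots,v_n)$. Its operators $m_2,m_3,\dots$ are defined recursively by $$M_n(v_1,\dots,v_n)=\sum\epsilon(\pi)\,M_{|\pi|}\bigl(v_{B_1},\dots,v_{B_{|\pi|-1}},m(v_{B_{|\pi|}})\bigr),$$ the sum being over $\pi\in P(n)$ with $n-1$ and $n$ in the last block and all other blocks singletons.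 A homotopy probability space is a correlation algebra $(\mathcal C,\underline M)$ with a differential $K$ of degree $1$ ($K^2=0$, $K1_{\mathcal C}=0$, $1_{\mathcal C}\notin\operatorname{Im}K$) and a degree $0$ linear map $\mathfrak c:\mathcal C\to\Bbbk$ with $\mathfrak cK=0$, $\mathfrak c(1_{\mathcal C})=1$ (taken up to pointed cochain homotopy). Its descendant $sL_\infty$-structure $\underline\ell^K$ is defined recursively by $KM_n(x_1,\dots,x_n)=\sum\epsilon(\pi,i)M_{|\pi|}(x_{B_1},\dots,\ell^K(x_{B_i}),\dots,x_{B_{|\pi|}})$, summed over $\pi\in P(n)$ and $i$ with $|B_i|=n-|\pi|+1$. A complete space $\mathcal S$ is a pointed graded vector space with zero $sL_\infty$-structure together with the homotopy type of a unital $sL_\infty$-quasi-isomorphism $\underline\varphi:(\mathcal S,\underline0)\to(\mathcal C,\underline\ell^K)$, that is, degree $0$ maps $\varphi_n:S^n\mathcal S\to\mathcal C$ with $\sum_{\pi\in P(n)}\epsilon(\pi)\ell^K_{|\pi|}(\varphi(s_{B_1}),\dots,\varphi(s_{B_{|\pi|}}))=0$ for all $n\ge 1$, $\varphi_1(1_{\mathcal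 S})=1_{\mathcal C}$, $\varphi_{n}(s_1,\dots,s_{n-1},1_{\mathcal S})=0$ for $n\ge2$, and $\varphi_1$ inducing an isomorphism $\mathcal S\cong H(\mathcal C,K)$. Fix any representatives $\mathfrak c$, $\underline\varphi$, and put $\Pi_n(s_1,\dots,s_n)=\sum_{\pi\in P(n)}\epsilon(\pi)M_{|\pi|}(\varphi(s_{B_1}),\dots,\varphi(s_{B_{|\pi|}}))$. The moments are $\mu_n=\mathfrak c\circ\Pi_n$, and the canonical correlation algebra structure on $\mathcal S$ is $M^{\mathcal S}_n=h\circ\Pi_n$, where $h$ is any homotopy inverse of the cochain map $\varphi_1:(\mathcal S,0)\to(\mathcal C,K)$. Let $\mathcal S^\diamond\subset\mathcal S$ be a finite super-selection sector, i.e. a finite-dimensional graded subspace containing $1_{\mathcal S}$ and closed under all $M^{\mathcal S}_n$. Let $M^\diamond_n$ be the restriction of $M_n^{\mathcal S}$, let $m_n^\diamond$ be the associated operators, and let $\{e_\alpha\}_{\alpha\in J}$ be a homogeneous basis of $\mathcal S^\diamond$ with $e_0=1_{\mathcal S}$. Let $t^\alpha$, $|t^\alpha|=-|e_\alpha|$,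 be the dual super-commuting coordinates, and let $\partial_\alpha$ be the graded derivation of $\Bbbk[\![t]\!]$ with $\partial_\alpha t^\beta=\delta_\alpha{}^\beta$ and $\partial_\alpha(XY)=(\partial_\alpha X)Y+(-1)^{|t^\alpha||X|}X\,\partial_\alpha Y$. With the structure constants $m^\diamond_n(e_{\alpha_1},\dots,e_{\alpha_n})=\sum_\gamma m^\diamond_{\alpha_1\cdots\alpha_n}{}^\gamma e_\gamma$ put $$A^\diamond_{\alpha\beta}{}^\gamma=m^\diamond_{\alpha\beta}{}^\gamma+\sum_{n\ge1}\frac1{n!}\sum_{\rho_1,\dots,\rho_n\in J}t^{\rho_n}\cdots t^{\rho_1}\,m^\diamond_{\rho_1\cdots\rho_n\alpha\beta}{}^\gamma,\qquad Z=1+\sum_{n\ge1}\frac1{n!}\sum_{\rho_1,\dots,\rho_n\in J}t^{\rho_n}\cdots t^{\rho_1}\,\mu_n(e_{\rho_1},\dots,e_{\rho_n}).$$ Then $A^\diamond$ is a formal graded-flat and torsion-free connection tensor with a unit condition, and $Z$, the moment generating function of $\mathcal S^\diamond$, satisfies the associated differential equations: for all $\alpha,\beta,\gamma,\sigma\in J$,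 $$A^\diamond_{0\beta}{}^\gamma=\delta_\beta{}^\gamma,\qquad A^\diamond_{\alpha\beta}{}^\gamma=(-1)^{|e_\alpha||e_\beta|}A^\diamond_{\beta\alpha}{}^\gamma,$$ $$\partial_\alpha A^\diamond_{\beta\gamma}{}^\sigma-(-1)^{|e_\alpha||e_\beta|}\partial_\beta A^\diamond_{\alpha\gamma}{}^\sigma+\sum_{\rho\in J}\Bigl((-1)^{|e_\alpha|(|e_\beta|+|e_\gamma|-|e_\rho|)}A^\diamond_{\beta\gamma}{}^\rho A^\diamond_{\alpha\rho}{}^\sigma-(-1)^{|e_\alpha||e_\beta|}(-1)^{|e_\beta|(|e_\alpha|+|e_\gamma|-|e_\rho|)}A^\diamond_{\alpha\gamma}{}^\rho A^\diamond_{\beta\rho}{}^\sigma\Bigr)=0,$$ $$\Bigl(\partial_\alpha\partial_\beta-\sum_{\gamma\in J}A^\diamond_{\alpha\beta}{}^\gamma\,\partial_\gamma\Bigr)Z=0,\qquad(\partial_0-1)Z=0.$$ -/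

import Mathlib

namespace HomotopyProbability

open Finset

/-! ### Koszul signs and partitions -/

/-- A family of `n`-ary operators. `F n d x` is the value on homogeneous elements `x 0, …, x (n-1)`
whose degrees are `d 0, …, d (n-1)`; the degrees are only used to form Koszul signs. Only arities
`n ≥ 1` are ever used. -/
abbrev Op (V W : Type*) := (n : ℕ) → (Fin n → ℤ) → (Fin n → V) → W

/-- A family of multilinear operators `V^{⊗ n} → W`. -/
abbrev MultiOp (k V W : Type*) [Semiring k] [AddCommMonoid V] [AddCommMonoid W] [Module k V]
    [Module k W] := (n : ℕ) → MultilinearMap k (fun _ : Fin n => V) W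

/-- Multilinear operators need no degree labels. -/
def MultiOp.toOp {k V W : Type*} [Semiring k] [AddCommMonoid V] [AddCommMonoid W] [Module k V]
    [Module k W] (F : MultiOp k V W) : Op V W := fun n _ x => F n x

/-- The Koszul sign `ε(σ)` of `x₁ ⊗ ⋯ ⊗ xₙ ↦ ε(σ) x_{σ(1)} ⊗ ⋯ ⊗ x_{σ(n)}`: a factor
`(-1)^{|x||y|}` for each pair that is put out of order. -/
def permSign {n : ℕ} (d : Fin n → ℤ) (σ : Equiv.Perm (Fin n)) : ℤˣ :=
  ∏ i, ∏ j, if i < j ∧ σ j < σ i then (d (σ i) * d (σ j)).negOnePow else 1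

/-- The Koszul sign `ε(π)` of `x₁ ⊗ ⋯ ⊗ xₙ ↦ ε(π) x_{B₁} ⊗ ⋯ ⊗ x_{B_r}`. Mathlib's
`OrderedFinpartition n` is the set of partitions of `[n]` with blocks ordered by their greatest
element and each block ordered increasingly. -/
noncomputable def partSign {n : ℕ} (c : OrderedFinpartition n) (d : Fin n → ℤ) : ℤˣ :=
  ∏ i, ∏ j, if i < j ∧ c.index j < c.index i then (d i * d j).negOnePow else 1

/-- The degree `|x_B|` of the `i`-th block. -/
def blockDeg {n : ℕ} (c : OrderedFinpartition n) (d : Fin n → ℤ) (i : Fin c.length) : ℤ :=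
  ∑ r, d (c.emb i r)

/-- The sign `ε(π, i) = ε(π) (-1)^{|x_{B₁}| + ⋯ + |x_{B_{i-1}}|}`. -/
noncomputable def partSignAt {n : ℕ} (c : OrderedFinpartition n) (i : Fin c.length)
    (d : Fin n → ℤ) : ℤˣ :=
  partSign c d * (∑ j ∈ univ.filter (· < i), blockDeg c d j).negOnePow

/-- The condition `|B_i| = n - |π| + 1`: all blocks other than `B_i` are singletons. -/
def OnlyBlock {n : ℕ} (c : OrderedFinpartition n) (i : Fin c.length) : Prop :=
  c.partSize i + c.length = n + 1

/-- `F(x_{B_i})`. -/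
def onBlock {V W : Type*} {n : ℕ} (F : Op V W) (c : OrderedFinpartition n) (d : Fin n → ℤ)
    (x : Fin n → V) (i : Fin c.length) : W :=
  F (c.partSize i) (fun r => d (c.emb i r)) (fun r => x (c.emb i r))

/-- The tuple `(x_{B₁}, …, x_{B_{i-1}}, y, x_{B_{i+1}}, …)`, the blocks other than `B_i` being
singletons. -/
def insertBlock {V : Type*} {n : ℕ} (c : OrderedFinpartition n) (i : Fin c.length)
    (x : Fin n → V) (y : V) : Fin c.length → V :=
  Function.update (fun j => x (c.emb j ⟨0, c.partSize_pos j⟩)) i y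

/-- Degrees of the previous tuple when `y` has degree `|x_{B_i}| + p`. -/
def insertDeg {n : ℕ} (c : OrderedFinpartition n) (i : Fin c.length) (d : Fin n → ℤ) (p : ℤ) :
    Fin c.length → ℤ :=
  fun j => blockDeg c d j + if j = i then p else 0

/-- `∑_π ε(π) G(F(x_{B₁}), …, F(x_{B_r}))`, with `F` of degree `0`. -/
noncomputable def composeOp {V V' W : Type*} [AddCommGroup W] (G : Op V' W) (F : Op V V') :
    Op V W :=
  fun n d x => ∑ c : OrderedFinpartition n,
    partSign c d • G c.length (blockDeg c d) (onBlock F c d x)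

open Classical in
/-- `∑_{π, i} ε(π, i) G(x_{B₁}, …, L(x_{B_i}), …, x_{B_r})` over `|B_i| = n - |π| + 1`, with `L`
of degree `1`. -/
noncomputable def insertOp {V W : Type*} [AddCommGroup W] (G : Op V W) (L : Op V V) : Op V W :=
  fun n d x => ∑ c : OrderedFinpartition n, ∑ i : Fin c.length,
    if OnlyBlock c i then
      partSignAt c i d •
        G c.length (insertDeg c i d 1) (insertBlock c i x (onBlock L c d x i))
    else 0

/-- `F n` descends to a linear map `Sⁿ V → W` of degree `p` for all `n ≥ 1`. -/
structure IsGradedSymmetric {k V W : Type*} [Field k] [AddCommGroup V] [Module k V]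
    [AddCommGroup W] [Module k W] (𝒱 : ℤ → Submodule k V) (𝒲 : ℤ → Submodule k W) (p : ℤ)
    (F : MultiOp k V W) : Prop where
  map_mem : ∀ n, 1 ≤ n → ∀ (d : Fin n → ℤ) (x : Fin n → V), (∀ i, x i ∈ 𝒱 (d i)) →
    F n x ∈ 𝒲 ((∑ i, d i) + p)
  symm : ∀ n, 1 ≤ n → ∀ (d : Fin n → ℤ) (x : Fin n → V), (∀ i, x i ∈ 𝒱 (d i)) →
    ∀ σ : Equiv.Perm (Fin n), F n x = permSign d σ • F n (x ∘ σ)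

/-! ### Homotopy probability spaces -/

/-- A `ℤ`-graded vector space with a distinguished element of degree `0`. -/
structure PointedGradedSpace (k V : Type*) [Field k] [AddCommGroup V] [Module k V] where
  gr : ℤ → Submodule k V
  internal : DirectSum.IsInternal gr
  one : V
  one_mem : one ∈ gr 0

/-- A correlation algebra `(V, M)`. -/
structure CorrelationAlgebra (k V : Type*) [Field k] [AddCommGroup V] [Module k V]
    extends PointedGradedSpace k V where
  M : MultiOp k V V
  M_symm : IsGradedSymmetric gr gr 0 M
  M_one : ∀ v : Fin 1 → V, M 1 v = v 0
  M_unit : ∀ n, 1 ≤ n → ∀ v : Fin n → V,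
    M (n + 1) (Fin.snoc (α := fun _ => V) v one) = M n v

/-- A homotopy probability algebra `(C, M, K)`: a correlation algebra which is also a pointed
cochain complex. -/
structure HomotopyProbAlgebra (k C : Type*) [Field k] [AddCommGroup C] [Module k C]
    extends CorrelationAlgebra k C where
  K : C →ₗ[k] C
  K_deg : ∀ i, ∀ x ∈ gr i, K x ∈ gr (i + 1)
  K_sq : ∀ x, K (K x) = 0
  K_unit : K one = 0
  unit_notMem_range : one ∉ LinearMap.range K

/-- A homotopy probability space `C → k`, given by a representative `expect` of the homotopy type of
the expectation: a pointed cochain map of degree `0` to `k` (in degree `0`, zero differential). -/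
structure HomotopyProbSpace (k C : Type*) [Field k] [AddCommGroup C] [Module k C]
    extends HomotopyProbAlgebra k C where
  expect : C →ₗ[k] k
  expect_deg : ∀ i, i ≠ 0 → ∀ x ∈ gr i, expect x = 0
  expect_K : ∀ x, expect (K x) = 0
  expect_unit : expect one = 1

open Classical in
/-- The descendant operators `ℓ₁, ℓ₂, …` of `(M, K)`, defined by the recursion
`K M(x₁, …, xₙ) = ∑_{π, i} ε(π, i) M(x_{B₁}, …, ℓ(x_{B_i}), …, x_{B_r})` over
`|B_i| = n - |π| + 1`, solved for the term `|π| = 1`, which is `ℓₙ(x₁, …, xₙ)` as `M₁ = id`. -/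
noncomputable def descendant {V : Type*} [AddCommGroup V] (M : Op V V) (K : V → V) : Op V V
  | n, d, x => K (M n d x) -
      ∑ c : OrderedFinpartition n, ∑ i : Fin c.length,
        if h : OnlyBlock c i ∧ c.length ≠ 1 then
          partSignAt c i d • M c.length (insertDeg c i d 1)
            (insertBlock c i x (descendant M K (c.partSize i)
              (fun r => d (c.emb i r)) (fun r => x (c.emb i r))))
        else 0
  termination_by n => n
  decreasing_by
    have h1 : c.partSize i + c.length = n + 1 := h.1
    have h2 := h.2
    have h3 := i.isLt
    omega

/-- The operators `ℓ^K` of the descendant unital `sL_∞`-algebra of a homotopy probability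
algebra. -/
noncomputable def HomotopyProbAlgebra.ell {k C : Type*} [Field k] [AddCommGroup C] [Module k C]
    (A : HomotopyProbAlgebra k C) : Op C C :=
  descendant A.M.toOp A.K

/-- `φ` is a unital `sL_∞`-morphism from `(V, ℓ)` to `(W, ℓ')`. -/
structure IsUnitalSLInftyMorphism {k V W : Type*} [Field k] [AddCommGroup V] [Module k V]
    [AddCommGroup W] [Module k W] (A : PointedGradedSpace k V) (ℓ : Op V V)
    (B : PointedGradedSpace k W) (ℓ' : Op W W) (φ : MultiOp k V W) : Prop where
  graded : IsGradedSymmetric A.gr B.gr 0 φ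
  equation : ∀ n, 1 ≤ n → ∀ (d : Fin n → ℤ) (x : Fin n → V), (∀ i, x i ∈ A.gr (d i)) →
    composeOp ℓ' φ.toOp n d x = insertOp φ.toOp ℓ n d x
  map_one : φ 1 (fun _ => A.one) = B.one
  map_unit : ∀ n, 1 ≤ n → ∀ v : Fin n → V,
    φ (n + 1) (Fin.snoc (α := fun _ => V) v A.one) = 0

/-- A complete space of homotopical random variables, given by a representative `φ` of its homotopy
type: a unital `sL_∞`-quasi-isomorphism from a pointed graded space `S` with zero `sL_∞`-structure
to the descendant of `C`. As `S` has zero differential, `quasi_iso` says that `φ₁` is a bijection of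
`S` onto the cohomology of `(C, K)`. -/
structure CompleteSpace {k C : Type*} [Field k] [AddCommGroup C] [Module k C]
    (P : HomotopyProbSpace k C) (S : Type*) [AddCommGroup S] [Module k S]
    extends PointedGradedSpace k S where
  φ : MultiOp k S C
  morphism : IsUnitalSLInftyMorphism toPointedGradedSpace (fun _ _ _ => 0)
    P.toPointedGradedSpace P.ell φ
  quasi_iso : ∀ y, P.K y = 0 → ∃! s, y - φ 1 (fun _ => s) ∈ LinearMap.range P.K

namespace CompleteSpace

variable {k C S : Type*} [Field k] [AddCommGroup C] [Module k C] [AddCommGroup S] [Module k S]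
  {P : HomotopyProbSpace k C}

/-- The correlation densities `Πₙ(s₁, …, sₙ) = ∑_π ε(π) M(φ(s_{B₁}), …, φ(s_{B_r}))`. -/
noncomputable def density (X : CompleteSpace P S) : Op S C :=
  composeOp P.M.toOp X.φ.toOp

/-- The moment morphism `μₙ = 𝔠 ∘ Πₙ`. -/
noncomputable def moment (X : CompleteSpace P S) : Op S k :=
  fun n d x => P.expect (X.density n d x)

/-- A homotopy inverse `h : (C, K) → (S, 0)` of the cochain map `f = φ₁`: `h f = 1` and
`f h = 1 + K β + β K` with `β` of degree `-1`. -/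
structure HomotopyInverse (X : CompleteSpace P S) where
  h : C →ₗ[k] S
  β : C →ₗ[k] C
  h_deg : ∀ i, ∀ y ∈ P.gr i, h y ∈ X.gr i
  β_deg : ∀ i, ∀ y ∈ P.gr i, β y ∈ P.gr (i - 1)
  h_K : ∀ y, h (P.K y) = 0
  h_f : ∀ s, h (X.φ 1 (fun _ => s)) = s
  f_h : ∀ y, X.φ 1 (fun _ => h y) = y + P.K (β y) + β (P.K y)

/-- The canonical correlation algebra operators `Mₙ = h ∘ Πₙ` on a complete space. -/
noncomputable def product (X : CompleteSpace P S) (I : X.HomotopyInverse) : Op S S :=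
  fun n d x => I.h (X.density n d x)

/-- A finite super-selection sector: a finite-dimensional (graded, unital) subalgebra of the
correlation algebra of `X`. -/
structure FiniteSector (X : CompleteSpace P S) (I : X.HomotopyInverse) where
  carrier : Submodule k S
  finite : Module.Finite k carrier
  graded : carrier ≤ ⨆ i, carrier ⊓ X.gr i
  one_mem : X.one ∈ carrier
  product_mem : ∀ n, 1 ≤ n → ∀ (d : Fin n → ℤ) (x : Fin n → S),
    (∀ i, x i ∈ X.gr (d i)) → (∀ i, x i ∈ carrier) → X.product I n d x ∈ carrier

open Classical in
/-- The operators of the correlation algebra of a sector, i.e. the restrictions of those of `X`.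
(On homogeneous elements of degrees `d` the condition always holds.) -/
noncomputable def FiniteSector.product {X : CompleteSpace P S} {I : X.HomotopyInverse}
    (D : X.FiniteSector I) : Op D.carrier D.carrier :=
  fun n d x => if h : X.product I n d (fun i => (x i : S)) ∈ D.carrier then ⟨_, h⟩ else 0

/-- The moment morphism of a sector, i.e. the one of the restricted `sL_∞`-morphism. -/
noncomputable def FiniteSector.moment {X : CompleteSpace P S} {I : X.HomotopyInverse}
    (D : X.FiniteSector I) : Op D.carrier k :=
  fun n d x => X.moment n d (fun i => (x i : S))

end CompleteSpace

open Classical in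
/-- The operators `m₂, m₃, …` attached to `M₁, M₂, …` by the recursion
`M(x₁, …, xₙ) = ∑_π ε(π) M(x_{B₁}, …, x_{B_{r-1}}, m(x_{B_r}))` over the partitions with
`r = |π|`, `|B_r| = n - r + 1` and `n - 1 ∼_π n`, solved for the term `|π| = 1`, which is
`m(x₁, …, xₙ)`. A block containing `n` is automatically the last one. -/
noncomputable def primitive {V : Type*} [AddCommGroup V] (M : Op V V) : Op V V
  | n, d, x => M n d x -
      ∑ c : OrderedFinpartition n, ∑ i : Fin c.length,
        if h : (OnlyBlock c i ∧ ∃ a b, (c.emb i a : ℕ) + 2 = n ∧ (c.emb i b : ℕ) + 1 = n) ∧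
            c.length ≠ 1 then
          partSign c d • M c.length (insertDeg c i d 0)
            (insertBlock c i x (primitive M (c.partSize i)
              (fun r => d (c.emb i r)) (fun r => x (c.emb i r))))
        else 0
  termination_by n => n
  decreasing_by
    have h1 : c.partSize i + c.length = n + 1 := h.1.1
    have h2 := h.2
    have h3 := i.isLt
    omega

/-! ### Formal power series in graded variables -/

section Series

variable {J : Type*} [Fintype J] [LinearOrder J]

/-- Exponents of the monomials in variables `t^α` of degrees `-deg α`: an odd variable occurs at
most once. -/
def Admissible (deg : J → ℤ) (a : J →₀ ℕ) : Prop := ∀ α, Odd (deg α) → a α ≤ 1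

/-- The ring `k⟦t⟧` of formal power series in the super-commuting variables
`t^α t^β = (-1)^{|t^α||t^β|} t^β t^α`, `|t^α| = -deg α`. A series is the family of its coefficients
with respect to the monomials `t^a = ∏ (t^α)^{a α}`, with the factors in increasing order of `α`. -/
def SuperSeries (k : Type*) (deg : J → ℤ) := {a : J →₀ ℕ // Admissible deg a} → k

namespace SuperSeries

variable {k : Type*} [Field k] {deg : J → ℤ}

noncomputable instance : AddCommGroup (SuperSeries k deg) :=
  inferInstanceAs (AddCommGroup ({a : J →₀ ℕ // Admissible deg a} → k))

open Classical in
/-- The coefficient at `t^a`, which is `0` when `t^a = 0`. -/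
noncomputable def coeff (F : SuperSeries k deg) (a : J →₀ ℕ) : k :=
  if h : Admissible deg a then F ⟨a, h⟩ else 0

/-- The sign in `t^a t^b = ± t^{a + b}`: each `t^β` in `t^b` moves to the left past the `t^α` in
`t^a` with `α > β`. -/
def monoSign (deg : J → ℤ) (a b : J →₀ ℕ) : ℤˣ :=
  ∏ α, ∏ β, if β < α then (deg α * a α * (deg β * b β)).negOnePow else 1

noncomputable instance : Mul (SuperSeries k deg) where
  mul F G := fun c => ∑ p ∈ antidiagonal c.1, monoSign deg p.1 p.2 • (coeff F p.1 * coeff G p.2)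

open Classical in
/-- The monomial `t^a` for an admissible exponent. -/
noncomputable def monomial (a : J →₀ ℕ) : SuperSeries k deg := fun c => if c.1 = a then 1 else 0

noncomputable instance : One (SuperSeries k deg) where
  one := monomial 0

/-- The variable `t^α`. -/
noncomputable def t (α : J) : SuperSeries k deg := monomial (Finsupp.single α 1)

/-- The graded derivation `∂_α = ∂/∂t^α` with `∂_α t^β = δ_α^β` and
`∂_α (F G) = (∂_α F) G + (-1)^{|t^α||F|} F (∂_α G)`; on monomials,
`∂_α t^a = (-1)^{|t^α| |∏_{β<α} (t^β)^{a β}|} (a α) t^{a - α}`. -/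
noncomputable def partialD (α : J) (F : SuperSeries k deg) : SuperSeries k deg := fun c =>
  (∏ β, if β < α then (deg α * (deg β * c.1 β)).negOnePow else 1 : ℤˣ) •
    (((c.1 α + 1 : ℕ) : k) * coeff F (c.1 + Finsupp.single α 1))

/-- The series `∑_{n ≥ 0} (1/n!) ∑_{ρ₁, …, ρₙ} t^{ρₙ} ⋯ t^{ρ₁} c(ρ₁, …, ρₙ)`. Only words of length
`n = |a|` contribute to the coefficient at `t^a`. -/
noncomputable def ofTensors (c : (n : ℕ) → (Fin n → J) → k) : SuperSeries k deg := fun a =>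
  ((a.1.degree.factorial : ℕ) : k)⁻¹ * ∑ ρ : Fin a.1.degree → J,
    ((List.ofFn fun i => t (ρ i)).reverse.prod : SuperSeries k deg) a * c a.1.degree ρ

end SuperSeries

end Series

/-! ### Connection and moment generating function of a finite sector -/

namespace CompleteSpace.FiniteSector

variable {k C S : Type*} [Field k] [AddCommGroup C] [Module k C] [AddCommGroup S] [Module k S]
  {P : HomotopyProbSpace k C} {X : CompleteSpace P S} {I : X.HomotopyInverse}
  {J : Type*} [Fintype J] [LinearOrder J]

/-- The structure constants `m_{ρ₁ ⋯ ρₙ}^γ` of the sector with respect to a basis `e` of homogeneous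
elements of degrees `deg`. -/
noncomputable def structureConst (D : X.FiniteSector I) (e : Module.Basis J k D.carrier)
    (deg : J → ℤ) (n : ℕ) (ρ : Fin n → J) (γ : J) : k :=
  e.repr (primitive D.product n (fun i => deg (ρ i)) (fun i => e (ρ i))) γ

/-- `A_{αβ}^γ = m_{αβ}^γ + ∑_{n ≥ 1} (1/n!) ∑_ρ t^{ρₙ} ⋯ t^{ρ₁} m_{ρ₁ ⋯ ρₙ α β}^γ`. -/
noncomputable def connection (D : X.FiniteSector I) (e : Module.Basis J k D.carrier)
    (deg : J → ℤ) (α β γ : J) : SuperSeries k deg :=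
  SuperSeries.ofTensors fun n ρ =>
    D.structureConst e deg (n + 2)
      (Fin.snoc (α := fun _ => J) (Fin.snoc (α := fun _ => J) ρ α) β) γ

/-- The moment generating function
`Z = 1 + ∑_{n ≥ 1} (1/n!) ∑_ρ t^{ρₙ} ⋯ t^{ρ₁} μₙ(e_{ρ₁}, …, e_{ρₙ})`. -/
noncomputable def momentGen (D : X.FiniteSector I) (e : Module.Basis J k D.carrier)
    (deg : J → ℤ) : SuperSeries k deg :=
  1 + SuperSeries.ofTensors fun n ρ =>
    if n = 0 then 0 else D.moment n (fun i => deg (ρ i)) (fun i => e (ρ i))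

end CompleteSpace.FiniteSector

end HomotopyProbability

/-! The connection is pure gauge. Let G_ρ^σ (`frameSeries`) be the ρ-derivative of the generating
series of the e_σ-components of the products M of the sector. The recursion defining the operators m
singles out the block containing the last two letters. Iterated derivatives of a product at the
origin are sums over splittings of a word, by the graded Leibniz rule, so on Taylor coefficients the
recursion says exactly ∂_α G_β^σ = Σ_ρ A_{αβ}^ρ G_ρ^σ (`partialD_frame_eq`). Since M_1 = id, the
matrix G is the identity at t = 0 and can be cancelled on the right (`eq_of_sum_mul_frame`).
Cancellation yields all properties of A: the unit condition comes from ∂_0 G_β = G_β,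
torsion-freeness from ∂_α G_β = ±∂_β G_α, and flatness from the graded commutation of ∂_α and ∂_β on
G_γ.

The equations for Z need the moments to factor through M. As φ_1 h = 1 + Kβ + βK and 𝔠K = 0, one has
𝔠 Π_n = 𝔠 φ_1 M_n once K Π_n = 0 (`K_density`). To see the latter, expand K M by the descendant
recursion and move the block carrying ℓ to the front. Choosing some of the blocks of a partition
amounts to splitting the word and partitioning both halves (`partSum_splitSum`), so the morphism
equation with zero source structure appears as an inner factor. Hence ∂_β Z = Σ_σ c_σ G_β^σ with
constants c_σ = 𝔠(φ_1(e_σ)), and Z inherits the structure equation of G; c_0 = 1 settles the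
constant term of (∂_0 - 1)Z.

To control signs, sums over ordered partitions are rewritten as recursions on words that add one
letter on the left at a time (`sum_partSign_blocks`, `sum_onlyBlock`). Every sign identity is then a
parity check in an induction on the word, and symmetry only has to be checked on adjacent
transpositions. -/

namespace HomotopyProbability

open Finset

/-! ### Sums over partitions and splittings of words -/

section Words

variable {ι : Type*} (deg : ι → ℤ) {W : Type*} [AddCommGroup W]

/-- The degree of a word. -/
def wordDeg (l : List ι) : ℤ := (l.map deg).sum

@[simp] theorem wordDeg_nil : wordDeg deg [] = 0 := rfl

@[simp] theorem wordDeg_cons (x : ι) (l : List ι) :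
    wordDeg deg (x :: l) = deg x + wordDeg deg l := by simp [wordDeg]

@[simp] theorem wordDeg_append (l l' : List ι) :
    wordDeg deg (l ++ l') = wordDeg deg l + wordDeg deg l' := by simp [wordDeg]

theorem wordDeg_map {κ : Type*} (f : κ → ι) (l : List κ) :
    wordDeg deg (l.map f) = wordDeg (deg ∘ f) l := by simp [wordDeg]

/-- The signed sum over all ways of putting the letter `x` at the head of a block. -/
def joinSum (x : ι) : (List (List ι) → W) → List (List ι) → W
  | _, [] => 0
  | G, B :: s => G ((x :: B) :: s) +
      (deg x * wordDeg deg B).negOnePow • joinSum x (fun s' => G (B :: s')) s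

/-- The signed sum over all ways of adding the letter `x` to a list of blocks. -/
def addLetter (x : ι) (G : List (List ι) → W) (s : List (List ι)) : W :=
  G ([x] :: s) + joinSum deg x G s

/-- The signed sum of `G` over all partitions of a word, the blocks being ordered by their last
letters. -/
def partSum : (List (List ι) → W) → List ι → W
  | G, [] => G []
  | G, x :: l => partSum (addLetter deg x G) l

/-- The signed sum of `H` over all splittings of a word into two words, for a function `H` that
moves letters past an additional symbol of degree `p` in between. -/
def splitSum (p : ℤ) : List ι → (List ι → List ι → W) → W
  | [], H => H [] []
  | x :: l, H => splitSum p l fun B B' =>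
      H (x :: B) B' + (deg x * (wordDeg deg B + p)).negOnePow • H B (x :: B')

/-- The signed sum over all ways to choose a nonempty block `B` of a word, which takes the place of
its last letter; `Q` is evaluated at the remaining letters before `B`, at `B` and at the remaining
letters after `B`. -/
def blockSum (p : ℤ) : List ι → (List ι → List ι → List ι → W) → W
  | [], _ => 0
  | x :: l, Q => Q [] [x] l + blockSum p l fun pre B post =>
      (p * deg x).negOnePow • Q (x :: pre) B post +
        (deg x * wordDeg deg pre).negOnePow • Q pre (x :: B) post

theorem negOnePow_congr {a b : ℤ} (h : Even (a - b)) : a.negOnePow = b.negOnePow :=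
  (Int.negOnePow_eq_iff a b).2 h

theorem negOnePow_smul_congr {a b : ℤ} (h : Even (a - b)) (w : W) :
    a.negOnePow • w = b.negOnePow • w := by
  rw [negOnePow_congr h]

/-! #### Linearity -/

theorem joinSum_add (x : ι) (G G' : List (List ι) → W) (s : List (List ι)) :
    joinSum deg x (fun s => G s + G' s) s = joinSum deg x G s + joinSum deg x G' s := by
  induction s generalizing G G' with
  | nil => simp [joinSum]
  | cons B s ih => simp only [joinSum, ih, smul_add]; abel

theorem joinSum_map {W' : Type*} [AddCommGroup W'] (f : W →+ W') (x : ι) (G : List (List ι) → W)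
    (s : List (List ι)) :
    f (joinSum deg x G s) = joinSum deg x (fun s => f (G s)) s := by
  induction s generalizing G with
  | nil => simp [joinSum]
  | cons B s ih => simp only [joinSum, map_add, Units.smul_def, map_zsmul, ih]

theorem joinSum_zero (x : ι) (s : List (List ι)) :
    joinSum deg x (fun _ => (0 : W)) s = 0 := by
  simpa using (joinSum_map deg (0 : W →+ W) x (fun _ => (0 : W)) s).symm

theorem addLetter_map {W' : Type*} [AddCommGroup W'] (f : W →+ W') (x : ι)
    (G : List (List ι) → W) (s : List (List ι)) :
    f (addLetter deg x G s) = addLetter deg x (fun s => f (G s)) s := by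
  simp only [addLetter, map_add, joinSum_map]

theorem addLetter_add (x : ι) (G G' : List (List ι) → W) :
    addLetter deg x (fun s => G s + G' s) =
      fun s => addLetter deg x G s + addLetter deg x G' s := by
  funext s
  simp only [addLetter, joinSum_add]; abel

/-- Whichever block receives x, the total degree grows by `deg x`, so a sign depending only on that
total is the same in all terms. -/
theorem joinSum_smul_deg (f : ℤ → ℤˣ) (x : ι) (G : List (List ι) → W) (s : List (List ι)) :
    joinSum deg x (fun s => f (wordDeg deg s.flatten) • G s) s =
      f (deg x + wordDeg deg s.flatten) • joinSum deg x G s := by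
  induction s generalizing G f with
  | nil => simp [joinSum]
  | cons B s ih =>
    have := ih (fun n => f (wordDeg deg B + n)) (fun s => G (B :: s))
    simp only [joinSum, List.flatten_cons, wordDeg_append, wordDeg_cons, smul_add] at this ⊢
    rw [this, smul_comm, add_left_comm (wordDeg deg B), add_assoc]

theorem joinSum_smul (u : ℤˣ) (x : ι) (G : List (List ι) → W) (s : List (List ι)) :
    joinSum deg x (fun s => u • G s) s = u • joinSum deg x G s :=
  joinSum_smul_deg deg (fun _ => u) x G s

theorem addLetter_smul_deg (f : ℤ → ℤˣ) (x : ι) (G : List (List ι) → W) :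
    addLetter deg x (fun s => f (wordDeg deg s.flatten) • G s) =
      fun s => f (deg x + wordDeg deg s.flatten) • addLetter deg x G s := by
  funext s
  simp [addLetter, joinSum_smul_deg, smul_add]

theorem partSum_add (G G' : List (List ι) → W) (l : List ι) :
    partSum deg (fun s => G s + G' s) l = partSum deg G l + partSum deg G' l := by
  induction l generalizing G G' with
  | nil => rfl
  | cons x l ih => simp only [partSum, addLetter_add, ih]

theorem partSum_smul_deg (f : ℤ → ℤˣ) (G : List (List ι) → W) (l : List ι) :
    partSum deg (fun s => f (wordDeg deg s.flatten) • G s) l =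
      f (wordDeg deg l) • partSum deg G l := by
  induction l generalizing G f with
  | nil => rfl
  | cons x l ih =>
    simp only [partSum, addLetter_smul_deg]
    rw [ih (fun n => f (deg x + n)), wordDeg_cons]

theorem partSum_smul (u : ℤˣ) (G : List (List ι) → W) (l : List ι) :
    partSum deg (fun s => u • G s) l = u • partSum deg G l :=
  partSum_smul_deg deg (fun _ => u) G l

theorem partSum_map {W' : Type*} [AddCommGroup W'] (f : W →+ W') (G : List (List ι) → W)
    (l : List ι) : f (partSum deg G l) = partSum deg (fun s => f (G s)) l := by
  induction l generalizing G with
  | nil => rfl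
  | cons x l ih => simp only [partSum, ih, addLetter_map]

theorem partSum_zero (l : List ι) : partSum deg (fun _ => (0 : W)) l = 0 := by
  simpa using (partSum_map deg (0 : W →+ W) (fun _ => (0 : W)) l).symm

theorem joinSum_partSum (x : ι) (H : List (List ι) → List (List ι) → W) (l : List ι)
    (s : List (List ι)) :
    joinSum deg x (fun s => partSum deg (H s) l) s =
      partSum deg (fun s' => joinSum deg x (fun s => H s s') s) l := by
  induction s generalizing H with
  | nil => simp [joinSum, partSum_zero]
  | cons B s ih => simp only [joinSum, partSum_add, partSum_smul, ih]

theorem addLetter_partSum (x : ι) (H : List (List ι) → List (List ι) → W) (l : List ι) :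
    addLetter deg x (fun s => partSum deg (H s) l) =
      fun s => partSum deg (fun s' => addLetter deg x (fun s => H s s') s) l := by
  funext s
  simp only [addLetter, partSum_add, joinSum_partSum]

theorem splitSum_add (p : ℤ) (l : List ι) (H H' : List ι → List ι → W) :
    splitSum deg p l (fun B B' => H B B' + H' B B') =
      splitSum deg p l H + splitSum deg p l H' := by
  induction l generalizing H H' with
  | nil => rfl
  | cons x l ih =>
    simp only [splitSum, ← ih]
    congr; funext B B'; rw [smul_add, add_add_add_comm]

theorem splitSum_map {W' : Type*} [AddCommGroup W'] (f : W →+ W') (p : ℤ) (l : List ι)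
    (H : List ι → List ι → W) :
    f (splitSum deg p l H) = splitSum deg p l (fun B B' => f (H B B')) := by
  induction l generalizing H with
  | nil => rfl
  | cons x l ih => simp only [splitSum, ih, map_add, Units.smul_def, map_zsmul]

theorem splitSum_smul (u : ℤˣ) (p : ℤ) (l : List ι) (H : List ι → List ι → W) :
    splitSum deg p l (fun B B' => u • H B B') = u • splitSum deg p l H :=
  (splitSum_map deg (DistribSMul.toAddMonoidHom W u) p l H).symm

theorem splitSum_zero (p : ℤ) (l : List ι) :
    splitSum deg p l (fun _ _ => (0 : W)) = 0 := by
  simpa using (splitSum_map deg (0 : W →+ W) p l (fun _ _ => (0 : W))).symm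

theorem splitSum_sum {κ : Type*} (t : Finset κ) (p : ℤ) (l : List ι)
    (H : κ → List ι → List ι → W) :
    splitSum deg p l (fun B B' => ∑ i ∈ t, H i B B') = ∑ i ∈ t, splitSum deg p l (H i) := by
  classical
  induction t using Finset.induction_on with
  | empty => simp [splitSum_zero]
  | insert a t ha ih => simp only [sum_insert ha, splitSum_add, ih]

theorem splitSum_map_word {κ : Type*} (f : κ → ι) (p : ℤ) (l : List κ)
    (H : List ι → List ι → W) :
    splitSum deg p (l.map f) H = splitSum (deg ∘ f) p l fun B B' => H (B.map f) (B'.map f) := by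
  induction l generalizing H with
  | nil => rfl
  | cons x l ih => simp only [List.map_cons, splitSum, ih, wordDeg_map, Function.comp_apply]

theorem blockSum_map_word {κ : Type*} (f : κ → ι) (p : ℤ) (l : List κ)
    (Q : List ι → List ι → List ι → W) :
    blockSum deg p (l.map f) Q =
      blockSum (deg ∘ f) p l fun pre B post => Q (pre.map f) (B.map f) (post.map f) := by
  induction l generalizing Q with
  | nil => rfl
  | cons x l ih => simp only [List.map_cons, blockSum, ih, wordDeg_map, Function.comp_apply,
      List.map_nil]

theorem blockSum_add (p : ℤ) (l : List ι) (Q Q' : List ι → List ι → List ι → W) :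
    blockSum deg p l (fun a b c => Q a b c + Q' a b c) =
      blockSum deg p l Q + blockSum deg p l Q' := by
  induction l generalizing Q Q' with
  | nil => simp [blockSum]
  | cons x l ih =>
    simp only [blockSum, add_add_add_comm (Q _ _ _), ← ih]
    congr; funext a b c; rw [smul_add, smul_add, add_add_add_comm]

/-! #### Symmetry -/

/-- Invariance, up to Koszul signs, under permutations of the blocks and of the letters in a
block. -/
structure SymmOnBlocks (G : List (List ι) → W) : Prop where
  swap_blocks : ∀ s B B' s', G (s ++ B :: B' :: s') =
    (wordDeg deg B * wordDeg deg B').negOnePow • G (s ++ B' :: B :: s')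
  swap_letters : ∀ s b x y b' s', G (s ++ (b ++ x :: y :: b') :: s') =
    (deg x * deg y).negOnePow • G (s ++ (b ++ y :: x :: b') :: s')

variable {deg}

theorem SymmOnBlocks.cons {G : List (List ι) → W} (hG : SymmOnBlocks deg G) (B : List ι) :
    SymmOnBlocks deg fun s => G (B :: s) where
  swap_blocks s := hG.swap_blocks (B :: s)
  swap_letters s := hG.swap_letters (B :: s)

/-- If x joins one of the two exchanged blocks, the exchange sign changes by `deg x` times the
degree of the other block. This is the sign that x gains or loses in passing that other block. -/
theorem SymmOnBlocks.joinSum {G : List (List ι) → W} (hG : SymmOnBlocks deg G) (x : ι) :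
    SymmOnBlocks deg (joinSum deg x G) where
  swap_blocks s B B' s' := by
    induction s generalizing G with
    | nil =>
      have h1 := hG.swap_blocks [] (x :: B) B' s'
      have h2 := hG.swap_blocks [] B (x :: B') s'
      have h3 : HomotopyProbability.joinSum deg x (fun t => G (B :: B' :: t)) s' =
          (wordDeg deg B * wordDeg deg B').negOnePow •
            HomotopyProbability.joinSum deg x (fun t => G (B' :: B :: t)) s' := by
        rw [← joinSum_smul]
        congr; funext t; exact hG.swap_blocks [] B B' t
      simp only [List.nil_append, HomotopyProbability.joinSum, wordDeg_cons] at h1 h2 ⊢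
      rw [h1, h2, h3]
      simp only [smul_add, smul_smul, ← Int.negOnePow_add]
      rw [add_left_comm]
      congr 1
      · apply negOnePow_smul_congr; ring_nf; simp [parity_simps]
      · congr 1
        · apply negOnePow_smul_congr; ring_nf; simp [parity_simps]
        · apply negOnePow_smul_congr; ring_nf; simp [parity_simps]
    | cons A s ih =>
      simp only [List.cons_append, HomotopyProbability.joinSum, ih (hG.cons A), smul_add]
      rw [smul_comm]
      congr 1
      exact hG.swap_blocks ((x :: A) :: s) B B' s'
  swap_letters s b y z b' s' := by
    induction s generalizing G with
    | nil =>
      have h1 := hG.swap_letters [] (x :: b) y z b' s'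
      have h3 : HomotopyProbability.joinSum deg x (fun t => G ((b ++ y :: z :: b') :: t)) s' =
          (deg y * deg z).negOnePow •
            HomotopyProbability.joinSum deg x (fun t => G ((b ++ z :: y :: b') :: t)) s' := by
        rw [← joinSum_smul]
        congr; funext t; exact hG.swap_letters [] b y z b' t
      simp only [List.nil_append, HomotopyProbability.joinSum, wordDeg_cons, wordDeg_append,
        List.cons_append] at h1 ⊢
      rw [h1, h3, smul_add, smul_comm, add_left_comm (deg y)]
    | cons A s ih =>
      simp only [List.cons_append, HomotopyProbability.joinSum, ih (hG.cons A), smul_add]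
      rw [smul_comm]
      congr 1
      exact hG.swap_letters ((x :: A) :: s) b y z b' s'

theorem SymmOnBlocks.add {G G' : List (List ι) → W} (hG : SymmOnBlocks deg G)
    (hG' : SymmOnBlocks deg G') : SymmOnBlocks deg fun s => G s + G' s where
  swap_blocks s B B' s' := by rw [hG.swap_blocks, hG'.swap_blocks, smul_add]
  swap_letters s b y z b' s' := by rw [hG.swap_letters, hG'.swap_letters, smul_add]

theorem SymmOnBlocks.addLetter {G : List (List ι) → W} (hG : SymmOnBlocks deg G) (x : ι) :
    SymmOnBlocks deg (addLetter deg x G) :=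
  (hG.cons [x]).add (hG.joinSum x)

/-- Terms in which x and y join different blocks match in pairs. Only when both join the same block
do they become adjacent letters, and there symmetry in the letters of a block is needed. -/
theorem joinSum_joinSum (x y : ι) (G : List (List ι) → W)
    (hG : SymmOnBlocks deg G) (s : List (List ι)) :
    joinSum deg x (joinSum deg y G) s =
      (deg x * deg y).negOnePow • joinSum deg y (joinSum deg x G) s := by
  induction s generalizing G with
  | nil => simp [joinSum]
  | cons B s ih =>
    have h1 := hG.swap_letters [] [] y x B s
    simp only [List.nil_append] at h1
    simp only [joinSum]
    rw [joinSum_add, joinSum_smul, ih _ (hG.cons B), joinSum_add, joinSum_smul, h1]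
    simp only [smul_add, smul_smul, ← Int.negOnePow_add, wordDeg_cons]
    rw [add_assoc, add_assoc]
    congr 1
    · apply negOnePow_smul_congr; ring_nf; simp [parity_simps]
    rw [add_left_comm]
    congr 1
    · apply negOnePow_smul_congr; ring_nf; simp [parity_simps]
    congr 1
    · apply negOnePow_smul_congr; ring_nf; simp [parity_simps]
    · apply negOnePow_smul_congr; ring_nf; simp [parity_simps]

/-- Beyond `joinSum_joinSum`, new blocks occur: two new singletons are exchanged by block symmetry,
and a new block made of both letters by letter symmetry. The mixed terms match directly. -/
theorem addLetter_addLetter (x y : ι) (G : List (List ι) → W)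
    (hG : SymmOnBlocks deg G) :
    addLetter deg x (addLetter deg y G) =
      fun s => (deg x * deg y).negOnePow • addLetter deg y (addLetter deg x G) s := by
  funext s
  have h1 := hG.swap_letters [] [] y x [] s
  have h2 := hG.swap_blocks [] [y] [x] s
  simp only [List.nil_append, wordDeg_cons, wordDeg_nil, add_zero] at h1 h2
  have h3 : ∀ (x y : ι), joinSum deg x (addLetter deg y G) s =
      joinSum deg x (fun s => G ([y] :: s)) s + joinSum deg x (joinSum deg y G) s :=
    fun x y => joinSum_add deg x _ _ s
  have h4 : ∀ (x y : ι), joinSum deg y G ([x] :: s) = G ([y, x] :: s) +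
      (deg x * deg y).negOnePow • joinSum deg y (fun s => G ([x] :: s)) s := by
    intro x y; simp [joinSum, mul_comm]
  conv_lhs => rw [addLetter, addLetter, h3 x y, h4 x y, h1, h2, joinSum_joinSum x y G hG]
  conv_rhs => rw [addLetter, addLetter, h3 y x, h4 y x]
  simp only [smul_add, smul_smul, ← Int.negOnePow_add]
  rw [mul_comm (deg y), Int.negOnePow_even _ ⟨deg x * deg y, rfl⟩, one_smul]
  abel

/-- The sum over all partitions of a word is symmetric in the letters. -/
theorem SymmOnBlocks.partSum_swap {G : List (List ι) → W} (hG : SymmOnBlocks deg G)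
    (l : List ι) (x y : ι) (l' : List ι) :
    partSum deg G (l ++ x :: y :: l') =
      (deg x * deg y).negOnePow • partSum deg G (l ++ y :: x :: l') := by
  induction l generalizing G with
  | nil =>
    simp only [List.nil_append, partSum]
    rw [addLetter_addLetter _ _ _ hG, partSum_smul, mul_comm]
  | cons a l ih => exact ih (hG.addLetter a)

variable (deg)

/-- Two-variable functions that are symmetric in both words have symmetric sums over
splittings. -/
theorem splitSum_swap (p : ℤ) (H : List ι → List ι → W)
    (h₁ : ∀ b x y b' B', H (b ++ x :: y :: b') B' =
      (deg x * deg y).negOnePow • H (b ++ y :: x :: b') B')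
    (h₂ : ∀ B b x y b', H B (b ++ x :: y :: b') =
      (deg x * deg y).negOnePow • H B (b ++ y :: x :: b'))
    (l : List ι) (x y : ι) (l' : List ι) :
    splitSum deg p (l ++ x :: y :: l') H =
      (deg x * deg y).negOnePow • splitSum deg p (l ++ y :: x :: l') H := by
  induction l generalizing H with
  | nil =>
    simp only [List.nil_append, splitSum, ← splitSum_smul]
    congr; funext B B'
    have e1 := h₁ [] x y B B'
    have e2 := h₂ B [] y x B'
    simp only [List.nil_append] at e1 e2
    rw [e1, e2]
    simp only [smul_add, smul_smul, ← Int.negOnePow_add, wordDeg_cons]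
    simp only [add_assoc]
    congr 1
    rw [add_left_comm]
    congr 1
    · apply negOnePow_smul_congr; ring_nf; simp [parity_simps]
    congr 1
    · apply negOnePow_smul_congr; ring_nf; simp [parity_simps]
    · apply negOnePow_smul_congr; ring_nf; simp [parity_simps]
  | cons a l ih =>
    simp only [List.cons_append, splitSum]
    apply ih
    · intro b x y b' B'
      have := h₁ (a :: b) x y b' B'
      simp only [List.cons_append] at this
      rw [this, h₁ b]
      simp only [smul_add, wordDeg_append, wordDeg_cons]
      rw [smul_comm, add_left_comm (deg x)]
    · intro B b x y b'
      have := h₂ B (a :: b) x y b'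
      simp only [List.cons_append] at this
      rw [this, h₂ (a :: B)]
      simp only [smul_add]
      rw [smul_comm (deg a * _).negOnePow]

/-! #### Relations -/

/-- Exchanges the two parts: B' moves past B and past the symbol of degree p. The Leibniz rule for A
· G lists the letters of A first, whereas the recursion for m lists them last. -/
theorem splitSum_eq_splitSum_zero (p : ℤ) (l : List ι) (H : List ι → List ι → W) :
    splitSum deg p l H = splitSum deg 0 l fun B' B =>
      (wordDeg deg B' * (p + wordDeg deg B)).negOnePow • H B B' := by
  induction l generalizing H with
  | nil => simp [splitSum]
  | cons x l ih =>
    simp only [splitSum, ih]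
    congr; funext B' B
    simp only [smul_add, smul_smul, ← Int.negOnePow_add, wordDeg_cons]
    rw [add_comm]
    congr 1
    · apply negOnePow_smul_congr; ring_nf; simp [parity_simps]
    · apply negOnePow_smul_congr; ring_nf; simp [parity_simps]

theorem splitSum_congr_length (p : ℤ) (l : List ι) (H H' : List ι → List ι → W)
    (h : ∀ B B', B.length + B'.length = l.length → H B B' = H' B B') :
    splitSum deg p l H = splitSum deg p l H' := by
  induction l generalizing H H' with
  | nil => exact h [] [] rfl
  | cons x l ih =>
    apply ih
    intro B B' hl
    rw [h (x :: B) B' (by simp; omega), h B (x :: B') (by simp; omega)]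

/-- The splitting with an empty first part. -/
theorem splitSum_ite_isEmpty (F : List ι → W) (l : List ι) :
    splitSum deg 0 l (fun B B' => if B.isEmpty then F B' else 0) = F l := by
  induction l generalizing F with
  | nil => simp [splitSum]
  | cons y l ih =>
    rw [← ih fun B' => F (y :: B')]
    simp only [splitSum]
    congr; funext B B'
    cases B <;> simp

/-- If `Q` is symmetric, the block can be moved to the front. -/
theorem blockSum_eq_splitSum (l : List ι) (Q : List ι → List ι → List ι → W)
    (Q' : List ι → List ι → W) (h : ∀ pre B post, Q pre B post =
      (wordDeg deg pre * (1 + wordDeg deg B)).negOnePow • Q' B (pre ++ post)) :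
    blockSum deg 1 l Q = splitSum deg 0 l fun B B' => if B.isEmpty then 0 else Q' B B' := by
  induction l generalizing Q Q' with
  | nil => simp [blockSum, splitSum]
  | cons x l ih =>
    simp only [blockSum, splitSum]
    -- The block [x] arises from a splitting of the remaining letters with empty first part, so this
    -- case is separated; it is the head term of `blockSum`.
    have key : (fun B B' : List ι => (if (x :: B).isEmpty then 0 else Q' (x :: B) B') +
        (deg x * (wordDeg deg B + 0)).negOnePow • (if B.isEmpty then 0 else Q' B (x :: B'))) =
        fun B B' => (if B.isEmpty then Q' [x] B' else 0) + if B.isEmpty then 0 else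
          (Q' (x :: B) B' + (deg x * wordDeg deg B).negOnePow • Q' B (x :: B')) := by
      funext B B'
      cases B <;> simp
    rw [key, splitSum_add, splitSum_ite_isEmpty deg (fun B' => Q' [x] B'), h]
    simp only [wordDeg_nil, zero_mul, Int.negOnePow_zero, one_smul, List.nil_append]
    congr 1
    apply ih
    intro pre B post
    rw [h, h]
    simp only [smul_add, smul_smul, ← Int.negOnePow_add, wordDeg_cons, List.cons_append]
    rw [add_comm]
    congr 1
    · apply negOnePow_smul_congr; ring_nf; simp [parity_simps]
    · apply negOnePow_smul_congr; ring_nf; simp [parity_simps]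

/-- If the block is required to contain the last two letters, what remains is a splitting of the
other letters. -/
theorem blockSum_append_pair (l : List ι) (a b : ι) (hl : (l ++ [a, b]).Nodup)
    (Q : List ι → List ι → List ι → W)
    (h : ∀ pre B post, (a ∉ B ∨ b ∉ B) → Q pre B post = 0) :
    blockSum deg 0 (l ++ [a, b]) Q =
      splitSum deg 0 l fun pre B => Q pre (B ++ [a, b]) [] := by
  induction l generalizing Q with
  | nil =>
    have hab : b ≠ a := by rintro rfl; simp at hl
    simp [blockSum, splitSum, h [] [a] [b] (by simp [hab]), h [a] [b] [] (by simp [hab.symm])]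
  | cons x l ih =>
    simp only [List.cons_append, List.nodup_cons] at hl
    have hx : a ≠ x ∧ b ≠ x := by
      constructor <;> rintro rfl <;> simp at hl
    simp only [List.cons_append, blockSum, splitSum]
    rw [h [] [x] _ (by simp [hx]), zero_add, ih hl.2]
    · simp
    · intro pre B post hB
      rw [h _ B _ hB, h _ (x :: B) _ (by simpa [hx] using hB)]
      simp

/-! #### Partitions and splittings -/

/-- The letter joins a block in either part; to reach the second part it passes all letters of the
first, whence the sign with the flattened degree. -/
theorem joinSum_splitSum (x : ι) (H : List (List ι) → List (List ι) → W) (s : List (List ι)) :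
    joinSum deg x (fun s => splitSum (wordDeg deg) 0 s H) s =
      splitSum (wordDeg deg) 0 s fun s₁ s₂ => joinSum deg x (fun s => H s s₂) s₁ +
        (deg x * wordDeg deg s₁.flatten).negOnePow • joinSum deg x (H s₁) s₂ := by
  have hf : ∀ s : List (List ι), wordDeg (wordDeg deg) s = wordDeg deg s.flatten := by
    intro s
    induction s with
    | nil => rfl
    | cons B s ih => simp [ih]
  induction s generalizing H with
  | nil => simp [joinSum, splitSum]
  | cons B s ih =>
    simp only [joinSum, splitSum]
    rw [ih, ← splitSum_smul, ← splitSum_add]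
    congr; funext s₁ s₂
    have e : joinSum deg x (fun s => H (B :: s) s₂ +
        (wordDeg deg B * (wordDeg (wordDeg deg) s + 0)).negOnePow • H s (B :: s₂)) s₁ =
        joinSum deg x (fun s => H (B :: s) s₂) s₁ +
        (wordDeg deg B * (deg x + wordDeg deg s₁.flatten)).negOnePow •
          joinSum deg x (fun s => H s (B :: s₂)) s₁ := by
      rw [joinSum_add, ← joinSum_smul_deg deg (fun n => (wordDeg deg B * n).negOnePow)]
      simp only [hf, add_zero]
    rw [e, joinSum_add, joinSum_smul]
    simp only [hf, add_zero, smul_add, smul_smul, ← Int.negOnePow_add, wordDeg_cons,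
      List.flatten_cons, wordDeg_append]
    have e1 : ((deg x + wordDeg deg B) * wordDeg deg s₁.flatten).negOnePow =
        (wordDeg deg B * wordDeg deg s₁.flatten + deg x * wordDeg deg s₁.flatten).negOnePow := by
      congr 1; ring
    have e2 : (deg x * wordDeg deg B + wordDeg deg B * (deg x + wordDeg deg s₁.flatten)).negOnePow =
        (wordDeg deg B * wordDeg deg s₁.flatten).negOnePow := by
      apply negOnePow_congr; ring_nf; simp [parity_simps]
    have e3 : deg x * wordDeg deg B + (deg x * wordDeg deg s₁.flatten +
        wordDeg deg B * wordDeg deg s₁.flatten) = wordDeg deg B * wordDeg deg s₁.flatten +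
          (deg x * wordDeg deg s₁.flatten + deg x * wordDeg deg B) := by ring
    have e4 : deg x * wordDeg deg B + deg x * wordDeg deg s₁.flatten =
        deg x * (wordDeg deg B + wordDeg deg s₁.flatten) := by ring
    rw [e1, e2, e3, e4]
    abel

theorem wordDeg_wordDeg (s : List (List ι)) :
    wordDeg (wordDeg deg) s = wordDeg deg s.flatten := by
  induction s with
  | nil => rfl
  | cons B s ih => simp [ih]

/-- Splitting the set of blocks of a partition of a word amounts to splitting the word and choosing
partitions of both parts. -/
theorem partSum_splitSum (H : List (List ι) → List (List ι) → W) (l : List ι) :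
    partSum deg (fun s => splitSum (wordDeg deg) 0 s H) l =
      splitSum deg 0 l fun A A' => partSum deg (fun s => partSum deg (H s) A') A := by
  induction l generalizing H with
  | nil => rfl
  | cons x l ih =>
    have e : addLetter deg x (fun s => splitSum (wordDeg deg) 0 s H) =
        fun s => splitSum (wordDeg deg) 0 s fun s₁ s₂ => addLetter deg x (fun s => H s s₂) s₁ +
          (deg x * wordDeg deg s₁.flatten).negOnePow • addLetter deg x (H s₁) s₂ := by
      funext s
      simp only [addLetter, joinSum_splitSum, splitSum, add_zero, wordDeg_wordDeg, smul_add,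
        wordDeg_cons, wordDeg_nil]
      rw [← splitSum_add]
      congr; funext s₁ s₂; abel
    simp only [partSum, splitSum, e, ih, addLetter_partSum, partSum_add, partSum_smul]
    congr; funext A A'
    rw [partSum_smul_deg deg (fun n => (deg x * n).negOnePow), add_zero]

/-! #### Functions that agree on the relevant partitions -/

theorem joinSum_congr (x : ι) (G G' : List (List ι) → W) (s : List (List ι)) (hs : [] ∉ s)
    (h : ∀ t, [] ∉ t → t.length = s.length → t.flatten.length = s.flatten.length + 1 →
      G t = G' t) :
    joinSum deg x G s = joinSum deg x G' s := by
  induction s generalizing G G' with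
  | nil => rfl
  | cons B s ih =>
    simp only [List.mem_cons, not_or] at hs
    simp only [joinSum]
    rw [h ((x :: B) :: s) (by simpa using hs.2) (by simp) (by simp)]
    congr 2
    refine ih _ _ hs.2 fun t ht h1 h2 => h (B :: t) ?_ (by simp [h1]) (by simp at h2 ⊢; omega)
    simpa using ⟨Ne.symm hs.1, ht⟩

/-- Only lists of nonempty blocks occur in a partition sum. This discards the values at empty
blocks, where operators would have the meaningless arity 0. -/
theorem partSum_congr (G G' : List (List ι) → W) (l : List ι)
    (h : ∀ s, [] ∉ s → s.flatten.length = l.length → G s = G' s) :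
    partSum deg G l = partSum deg G' l := by
  induction l generalizing G G' with
  | nil => exact h [] (by simp) rfl
  | cons x l ih =>
    refine ih _ _ fun s hs hl => ?_
    rw [addLetter, addLetter, h ([x] :: s) (by simpa using hs) (by simp at hl ⊢; omega)]
    congr 1
    exact joinSum_congr deg x G G' s hs fun t ht _ h2 => h t ht (by simp at hl h2 ⊢; omega)

/-- A last letter that is only allowed to form a block of its own. -/
theorem partSum_append_singleton (u : ι) (G G' : List (List ι) → W)
    (h₁ : ∀ s b, b ≠ [] → G (s ++ [b ++ [u]]) = 0) (h₂ : ∀ s, G (s ++ [[u]]) = G' s)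
    (l : List ι) : partSum deg G (l ++ [u]) = partSum deg G' l := by
  have key : ∀ (x : ι) (G : List (List ι) → W),
      (∀ s b, b ≠ [] → G (s ++ [b ++ [u]]) = 0) → ∀ (s : List (List ι)) (b : List ι), b ≠ [] →
        joinSum deg x G (s ++ [b ++ [u]]) = 0 := by
    intro x G h s b hb
    induction s generalizing G with
    | nil => simpa [joinSum] using h [] (x :: b) (by simp)
    | cons B s ih =>
      have h1 := h ((x :: B) :: s) b hb
      simp only [List.cons_append] at h1
      simp only [List.cons_append, joinSum, h1, zero_add]
      rw [ih (fun s' => G (B :: s')) fun s b hb => h (B :: s) b hb, smul_zero]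
  -- Joining x to [u] gives [x, u], which G kills; joining any other block leaves [u] last.
  have key' : ∀ (x : ι) (G G' : List (List ι) → W),
      (∀ s b, b ≠ [] → G (s ++ [b ++ [u]]) = 0) → (∀ s, G (s ++ [[u]]) = G' s) →
      ∀ (s : List (List ι)), joinSum deg x G (s ++ [[u]]) = joinSum deg x G' s := by
    intro x G G' h h' s
    induction s generalizing G G' with
    | nil => simpa [joinSum] using h [] [x] (by simp)
    | cons B s ih =>
      have h1 := h' ((x :: B) :: s)
      simp only [List.cons_append] at h1
      simp only [List.cons_append, joinSum, h1]
      rw [ih (fun s' => G (B :: s')) (fun s' => G' (B :: s')) (fun s b hb => h (B :: s) b hb)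
        fun s => h' (B :: s)]
  induction l generalizing G G' with
  | nil => simpa [partSum, addLetter, joinSum] using h₂ []
  | cons x l ih =>
    refine ih _ _ (fun s b hb => ?_) fun s => ?_
    · rw [addLetter, key x G h₁ s b hb, add_zero]
      exact h₁ ([x] :: s) b hb
    · rw [addLetter, addLetter, key' x G G' h₁ h₂]
      congr 1
      exact h₂ ([x] :: s)

/-! #### Choosing a block -/

/-- The sum of `Q` over all choices of a block such that all other blocks are singletons. -/
def blockSel (p : ℤ) : (List ι → List ι → List ι → W) → List (List ι) → W
  | _, [] => 0
  | Q, B :: s => (if ∀ A ∈ s, A.length = 1 then Q [] B s.flatten else 0) +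
      if B.length = 1 then (p * wordDeg deg B).negOnePow •
        blockSel p (fun pre => Q (B ++ pre)) s else 0

theorem blockSel_add (p : ℤ) (Q Q' : List ι → List ι → List ι → W) (s : List (List ι)) :
    blockSel deg p (fun a b c => Q a b c + Q' a b c) s =
      blockSel deg p Q s + blockSel deg p Q' s := by
  induction s generalizing Q Q' with
  | nil => simp [blockSel]
  | cons B s ih =>
    simp only [blockSel, ih, smul_add]
    split_ifs <;> abel

theorem blockSel_smul (p : ℤ) (u : ℤˣ) (Q : List ι → List ι → List ι → W) (s : List (List ι)) :
    blockSel deg p (fun a b c => u • Q a b c) s = u • blockSel deg p Q s := by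
  induction s generalizing Q with
  | nil => simp [blockSel]
  | cons B s ih =>
    simp only [blockSel, ih, smul_add, smul_ite, smul_zero, smul_comm u]

theorem length_le_length_flatten (s : List (List ι)) (hs : [] ∉ s) :
    s.length ≤ s.flatten.length := by
  induction s with
  | nil => simp
  | cons B s ih =>
    simp only [List.mem_cons, not_or] at hs
    have h1 : 0 < B.length := List.length_pos_of_ne_nil (Ne.symm hs.1)
    have h2 := ih hs.2
    simp only [List.length_cons, List.flatten_cons, List.length_append]
    omega

theorem length_flatten_of_singletons (s : List (List ι)) (hs : ∀ A ∈ s, A.length = 1) :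
    s.flatten.length = s.length := by
  induction s with
  | nil => simp
  | cons B s ih =>
    have h2 := ih fun A hA => hs A (by simp [hA])
    have h1 := hs B (by simp)
    simp only [List.length_cons, List.flatten_cons, List.length_append]
    omega

/-- Joining keeps the number of blocks and raises the number of letters. As the blocks were
nonempty, they cannot all be singletons afterwards. -/
theorem joinSum_ite_singletons (x : ι) (F : List ι → W) (s : List (List ι)) (hs : [] ∉ s) :
    joinSum deg x (fun s => if ∀ A ∈ s, A.length = 1 then F s.flatten else 0) s = 0 := by
  rw [joinSum_congr deg x _ (fun _ => 0) s hs]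
  · exact joinSum_zero deg x s
  · intro t ht h1 h2
    rw [if_neg]
    intro h
    have := length_flatten_of_singletons t h
    have := length_le_length_flatten s hs
    omega

theorem partSum_ite_singletons (F : List ι → W) (l : List ι) :
    partSum deg (fun s => if ∀ A ∈ s, A.length = 1 then F s.flatten else 0) l = F l := by
  induction l generalizing F with
  | nil => simp [partSum]
  | cons x l ih =>
    rw [← ih fun l => F (x :: l), partSum]
    apply partSum_congr
    intro s hs _
    rw [addLetter, joinSum_ite_singletons deg x F s hs]
    simp

/-- A nonempty block that receives x is no longer a singleton, so it must be the selected one, and x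
has passed exactly the letters before it. -/
theorem joinSum_blockSel (p : ℤ) (x : ι) (Q : List ι → List ι → List ι → W)
    (s : List (List ι)) (hs : [] ∉ s) :
    joinSum deg x (blockSel deg p Q) s = blockSel deg p (fun pre B post =>
      (deg x * wordDeg deg pre).negOnePow • Q pre (x :: B) post) s := by
  induction s generalizing Q with
  | nil => rfl
  | cons B s ih =>
    simp only [List.mem_cons, not_or] at hs
    have hB : (x :: B).length ≠ 1 := by
      have := List.length_pos_of_ne_nil (Ne.symm hs.1)
      simp only [List.length_cons]; omega
    simp only [joinSum, blockSel, if_neg hB, joinSum_add,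
      joinSum_ite_singletons deg x (Q [] B) s hs.2, zero_add, add_zero, wordDeg_nil, mul_zero,
      Int.negOnePow_zero, one_smul, wordDeg_append, mul_add, Int.negOnePow_add, mul_smul]
    congr 1
    split_ifs
    · rw [joinSum_smul, ih _ hs.2, blockSel_smul, smul_comm]
    · rw [joinSum_zero, smul_zero]

/-- Sums over partitions with a chosen block, all other blocks being singletons. -/
theorem partSum_blockSel (p : ℤ) (Q : List ι → List ι → List ι → W) (l : List ι) :
    partSum deg (blockSel deg p Q) l = blockSum deg p l Q := by
  induction l generalizing Q with
  | nil => rfl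
  | cons x l ih =>
    rw [partSum, blockSum, ← ih, ← partSum_ite_singletons deg (Q [] [x]) l, ← partSum_add]
    apply partSum_congr
    intro s hs _
    rw [addLetter, joinSum_blockSel deg p x Q s hs, blockSel_add, blockSel_smul, ← add_assoc]
    simp [blockSel]

end Words

/-! ### Ordered partitions and words -/

theorem prod_negOnePow {κ : Type*} (s : Finset κ) (f : κ → ℤ) :
    ∏ i ∈ s, (f i).negOnePow = (∑ i ∈ s, f i).negOnePow := by
  classical
  induction s using Finset.induction_on with
  | empty => simp
  | insert a s ha ih => rw [prod_insert ha, sum_insert ha, ih, Int.negOnePow_add]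

theorem prod_ite_negOnePow {κ : Type*} (s : Finset κ) (P : κ → Prop) [DecidablePred P]
    (f : κ → ℤ) : (∏ i ∈ s, if P i then (f i).negOnePow else 1) =
      (∑ i ∈ s, if P i then f i else 0).negOnePow := by
  rw [← prod_negOnePow]
  exact prod_congr rfl fun i _ => by split_ifs <;> simp

section OrderedPartitions

variable {ι : Type*} {n : ℕ}

theorem index_emb (c : OrderedFinpartition n) (i : Fin c.length) (r : Fin (c.partSize i)) :
    c.index (c.emb i r) = i :=
  congrArg Sigma.fst (c.equivSigma.symm_apply_apply ⟨i, r⟩)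

theorem index_eq_of_emb_eq (c : OrderedFinpartition n) {i : Fin c.length}
    {r : Fin (c.partSize i)} {j : Fin n} (h : c.emb i r = j) : c.index j = i := by
  rw [← h, index_emb]

/-- The list of the blocks of the word `y 0, …, y (n-1)`. -/
def blocks (c : OrderedFinpartition n) (y : Fin n → ι) : List (List ι) :=
  List.ofFn fun i => List.ofFn fun r => y (c.emb i r)

theorem blocks_extendLeft (c : OrderedFinpartition n) (y : Fin (n + 1) → ι) :
    blocks c.extendLeft y = [y 0] :: blocks c (fun j => y j.succ) := by
  rw [blocks]
  exact List.ofFn_succ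

theorem blocks_extendMiddle (c : OrderedFinpartition n) (k : Fin c.length)
    (y : Fin (n + 1) → ι) :
    blocks (c.extendMiddle k) y =
      List.ofFn (Function.update (fun i => List.ofFn fun r => y (c.emb i r).succ) k
        (y 0 :: List.ofFn fun r => y (c.emb k r).succ)) := by
  rw [blocks]
  refine congrArg List.ofFn (funext fun (i : Fin c.length) => ?_)
  obtain h | h := eq_or_ne i k
  · subst h
    rw [Function.update_self]
    have e : (c.extendMiddle i).partSize i = c.partSize i + 1 := by
      simp [OrderedFinpartition.extendMiddle]
    rw [List.ofFn_congr e, List.ofFn_succ]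
    simp only [OrderedFinpartition.extendMiddle, dif_pos]
    rfl
  · rw [Function.update_of_ne h]
    have e : (c.extendMiddle k).partSize i = c.partSize i := by
      simp [OrderedFinpartition.extendMiddle, h]
    rw [List.ofFn_congr e]
    simp only [OrderedFinpartition.extendMiddle, dif_neg h]
    rfl

theorem index_extendLeft_zero (c : OrderedFinpartition n) :
    c.extendLeft.index 0 = (0 : Fin (c.length + 1)) :=
  index_eq_of_emb_eq c.extendLeft (i := (0 : Fin (c.length + 1)))
    (r := ⟨0, c.extendLeft.partSize_pos _⟩) rfl

theorem index_extendLeft_succ (c : OrderedFinpartition n) (j : Fin n) :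
    (c.extendLeft.index j.succ : Fin (c.length + 1)) = (c.index j).succ := by
  refine index_eq_of_emb_eq c.extendLeft (i := (c.index j).succ) (r := c.invEmbedding j) ?_
  exact congrArg Fin.succ (c.emb_invEmbedding j)

theorem index_extendMiddle_succ (c : OrderedFinpartition n) (k : Fin c.length) (j : Fin n) :
    (c.extendMiddle k).index j.succ = c.index j := by
  rcases eq_or_ne (c.index j) k with h | h
  · have e : (c.extendMiddle k).partSize (c.index j) = c.partSize (c.index j) + 1 := by
      simp [OrderedFinpartition.extendMiddle, h]
    refine index_eq_of_emb_eq (c.extendMiddle k) (i := c.index j)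
      (r := (c.invEmbedding j).succ.cast e.symm) ?_
    subst h
    simp only [OrderedFinpartition.extendMiddle, dif_pos]
    exact congrArg Fin.succ (c.emb_invEmbedding j)
  · have e : (c.extendMiddle k).partSize (c.index j) = c.partSize (c.index j) := by
      simp [OrderedFinpartition.extendMiddle, h]
    refine index_eq_of_emb_eq (c.extendMiddle k) (i := c.index j)
      (r := (c.invEmbedding j).cast e.symm) ?_
    simp only [OrderedFinpartition.extendMiddle, dif_neg h]
    exact congrArg Fin.succ (c.emb_invEmbedding j)

/-- The letter 0 forms the first block by itself, so it takes part in no inversion. -/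
theorem partSign_extendLeft (c : OrderedFinpartition n) (d : Fin (n + 1) → ℤ) :
    partSign c.extendLeft d = partSign c fun j => d j.succ := by
  unfold partSign
  have h : ∀ j : Fin (n + 1), ¬ c.extendLeft.index j < c.extendLeft.index 0 := fun j hj => by
    have h0 := congrArg Fin.val (index_extendLeft_zero c)
    have h1 : (c.extendLeft.index j).val < (c.extendLeft.index 0).val := hj
    rw [h0] at h1
    exact Nat.not_lt_zero _ h1
  have h' : ∀ i j : Fin n, c.extendLeft.index i.succ < c.extendLeft.index j.succ ↔
      c.index i < c.index j := by
    intro i j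
    have hi := congrArg Fin.val (index_extendLeft_succ c i)
    have hj := congrArg Fin.val (index_extendLeft_succ c j)
    rw [Fin.lt_def, Fin.lt_def, hi, hj, Fin.val_succ, Fin.val_succ, Nat.add_lt_add_iff_right]
  rw [Fin.prod_univ_succ]
  simp only [h, and_false, if_false, prod_const_one, one_mul]
  refine prod_congr rfl fun i _ => ?_
  rw [Fin.prod_univ_succ]
  simp [h']

/-- The new inversions pair the letter 0 with every letter of the blocks before the k-th. -/
theorem partSign_extendMiddle (c : OrderedFinpartition n) (k : Fin c.length)
    (d : Fin (n + 1) → ℤ) :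
    partSign (c.extendMiddle k) d =
      (d 0 * ∑ j, if j < k then blockDeg c (fun j => d j.succ) j else 0).negOnePow *
        partSign c fun j => d j.succ := by
  have h0 : (c.extendMiddle k).index 0 = k := c.index_extendMiddle_zero k
  have h1 : (∑ j, if j < k then blockDeg c (fun j => d j.succ) j else 0) =
      ∑ j : Fin n, if c.index j < k then d j.succ else 0 := by
    rw [← c.sum_sigma_eq_sum fun j => if c.index j < k then d j.succ else 0]
    refine sum_congr rfl fun m _ => ?_
    simp only [index_emb, blockDeg]
    split_ifs <;> simp
  unfold partSign
  rw [h1, mul_sum, ← prod_negOnePow, Fin.prod_univ_succ]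
  congr 1
  · rw [Fin.prod_univ_succ]
    simp only [lt_irrefl, false_and, if_false, one_mul, Fin.succ_pos, true_and, h0,
      index_extendMiddle_succ, mul_ite, mul_zero]
    refine prod_congr rfl fun i _ => ?_
    by_cases h : c.index i < k
    · exact (if_pos h).trans (congrArg Int.negOnePow (if_pos h)).symm
    · exact (if_neg h).trans
        (Int.negOnePow_zero.symm.trans (congrArg Int.negOnePow (if_neg h)).symm)
  · refine prod_congr rfl fun i _ => ?_
    rw [Fin.prod_univ_succ]
    simp only [Fin.not_lt_zero, false_and, if_false, one_mul, Fin.succ_lt_succ_iff,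
      index_extendMiddle_succ]
    rfl

variable (deg : ι → ℤ) {W : Type*} [AddCommGroup W]

theorem wordDeg_ofFn {m : ℕ} (y : Fin m → ι) : wordDeg deg (List.ofFn y) = ∑ r, deg (y r) := by
  simp [wordDeg, List.map_ofFn, List.sum_ofFn]

theorem joinSum_ofFn {r : ℕ} (x : ι) (G : List (List ι) → W) (b : Fin r → List ι) :
    joinSum deg x G (List.ofFn b) = ∑ k,
      (deg x * ∑ j, if j < k then wordDeg deg (b j) else 0).negOnePow •
        G (List.ofFn (Function.update b k (x :: b k))) := by
  induction r generalizing G with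
  | zero => simp [joinSum]
  | succ r ih =>
    rw [List.ofFn_succ, joinSum, ih, Fin.sum_univ_succ, smul_sum]
    congr 1
    · simp [List.ofFn_succ]
    · refine sum_congr rfl fun k _ => ?_
      rw [Fin.sum_univ_succ, smul_smul, ← Int.negOnePow_add,
        List.ofFn_succ (f := Function.update _ _ _)]
      have e0 : Function.update b k.succ (x :: b k.succ) 0 = b 0 :=
        Function.update_of_ne (Fin.succ_ne_zero k).symm _ _
      have e1 : (fun i : Fin r => Function.update b k.succ (x :: b k.succ) i.succ) =
          Function.update (fun i => b i.succ) k (x :: b k.succ) :=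
        Function.update_comp_eq_of_injective' b (Fin.succ_injective r) k _
      simp only [e0, e1, Fin.succ_pos, if_true, Fin.succ_lt_succ_iff, mul_add]

/-- A signed sum over ordered partitions as a sum over partitions of a word. -/
theorem sum_partSign_blocks (G : List (List ι) → W) (y : Fin n → ι) :
    ∑ c : OrderedFinpartition n, partSign c (fun j => deg (y j)) • G (blocks c y) =
      partSum deg G (List.ofFn y) := by
  induction n generalizing G with
  | zero =>
    rw [Fintype.sum_unique]
    have h : (default : OrderedFinpartition 0) = OrderedFinpartition.atomic 0 := rfl
    simp [h, partSign, partSum, blocks, OrderedFinpartition.atomic]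
  | succ n ih =>
    -- A partition of n + 1 letters is a partition of the last n together with the decision to keep
    -- the first letter alone or to put it into one of the blocks; `addLetter` sums over these
    -- decisions.
    rw [List.ofFn_succ, partSum, ← ih, ← (OrderedFinpartition.extendEquiv n).sum_comp,
      Fintype.sum_sigma]
    refine sum_congr rfl fun c _ => ?_
    simp only [Fintype.sum_option, OrderedFinpartition.extendEquiv_apply,
      OrderedFinpartition.extend_none, OrderedFinpartition.extend_some, partSign_extendLeft,
      partSign_extendMiddle, blocks_extendLeft, blocks_extendMiddle, addLetter, smul_add]
    congr 1
    rw [blocks, joinSum_ofFn, smul_sum]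
    refine sum_congr rfl fun k _ => ?_
    rw [mul_comm, mul_smul]
    simp only [wordDeg_ofFn, blockDeg]

theorem blockSel_ofFn {r : ℕ} (p : ℤ) (Q : List ι → List ι → List ι → W) (b : Fin r → List ι) :
    blockSel deg p Q (List.ofFn b) = ∑ i, if ∀ j, j ≠ i → (b j).length = 1 then
      (p * ∑ j, if j < i then wordDeg deg (b j) else 0).negOnePow •
        Q ((List.ofFn b).take i).flatten (b i) ((List.ofFn b).drop (i + 1)).flatten else 0 := by
  induction r generalizing Q with
  | zero => simp [blockSel]
  | succ r ih =>
    rw [List.ofFn_succ, blockSel, ih, Fin.sum_univ_succ]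
    congr 1
    · simp only [List.forall_mem_ofFn_iff, Fin.forall_fin_succ, ne_eq, not_true_eq_false,
        false_imp_iff, Fin.succ_ne_zero, not_false_eq_true, true_imp_iff, true_and]
      simp
    · simp only [Fin.forall_fin_succ, ne_eq, (Fin.succ_ne_zero _).symm, not_false_eq_true,
        true_imp_iff, Fin.succ_inj]
      split_ifs with h
      · rw [smul_sum]
        refine sum_congr rfl fun i _ => ?_
        simp only [h, true_and, smul_ite, smul_zero, smul_smul, ← Int.negOnePow_add]
        rw [Fin.sum_univ_succ]
        simp [mul_add]
      · simp [h]

/-- The block sizes sum to n and each is at least 1; the condition is the equality case of this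
bound for the blocks other than the i-th. -/
theorem onlyBlock_iff (c : OrderedFinpartition n) (i : Fin c.length) :
    OnlyBlock c i ↔ ∀ j, j ≠ i → c.partSize j = 1 := by
  have h1 : ∑ j, c.partSize j = n := by simpa using c.sum_sigma_eq_sum (α := ℕ) fun _ => 1
  rw [← add_sum_erase _ _ (mem_univ i)] at h1
  have h2 : ∑ j ∈ univ.erase i, 1 + 1 = c.length := by
    have := i.isLt
    simp [card_erase_of_mem]; omega
  have h3 := sum_eq_sum_iff_of_le (s := univ.erase i) (f := fun _ => 1) (g := c.partSize)
    fun j _ => c.partSize_pos j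
  simp only [mem_erase, mem_univ, and_true] at h3
  rw [OnlyBlock]
  constructor
  · intro h j hj
    exact (h3.1 (by omega) j hj).symm
  · intro h
    have := h3.2 fun j hj => (h j hj).symm
    omega

/-- The letters before the `i`-th block. -/
def preBlock (c : OrderedFinpartition n) (i : Fin c.length) : List (Fin n) :=
  ((blocks c id).take i).flatten

/-- The letters after the `i`-th block. -/
def postBlock (c : OrderedFinpartition n) (i : Fin c.length) : List (Fin n) :=
  ((blocks c id).drop (i + 1)).flatten

open Classical in
/-- A signed sum over partitions with a chosen block, all other blocks being singletons. -/
theorem sum_onlyBlock (d : Fin n → ℤ) (p : ℤ) (Q : List (Fin n) → List (Fin n) → List (Fin n) → W)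
    (R : (c : OrderedFinpartition n) → Fin c.length → W)
    (h : ∀ c i, OnlyBlock c i → R c i = Q (preBlock c i) (List.ofFn (c.emb i)) (postBlock c i)) :
    (∑ c : OrderedFinpartition n, ∑ i : Fin c.length, if OnlyBlock c i then
      (partSign c d * (p * ∑ j ∈ univ.filter (· < i), blockDeg c d j).negOnePow) • R c i else 0) =
      blockSum d p (List.finRange n) Q := by
  rw [← partSum_blockSel, ← List.ofFn_id, ← sum_partSign_blocks]
  refine sum_congr rfl fun c _ => ?_
  rw [blocks, blockSel_ofFn, smul_sum]
  refine sum_congr rfl fun i _ => ?_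
  simp only [List.length_ofFn, ← onlyBlock_iff]
  split_ifs with hi
  · rw [h c i hi, mul_smul, sum_filter]
    simp only [wordDeg_ofFn]
    rfl
  · simp

theorem ofFn_update_eq {A : Type*} {r : ℕ} (b : Fin r → List A) (f : Fin r → A) (i : Fin r) (a : A)
    (h : ∀ j, j ≠ i → b j = [f j]) :
    List.ofFn (Function.update f i a) =
      ((List.ofFn b).take i).flatten ++ a :: ((List.ofFn b).drop (i + 1)).flatten := by
  induction r with
  | zero => exact i.elim0
  | succ r ih =>
    rw [List.ofFn_succ, List.ofFn_succ (f := b)]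
    refine Fin.cases (fun h => ?_) (fun i h => ?_) i h
    · have : (fun j : Fin r => b j.succ) = fun j => [f j.succ] :=
        funext fun j => h _ (Fin.succ_ne_zero j)
      have e : (List.ofFn fun j : Fin r => [f j.succ]).flatten = List.ofFn fun j => f j.succ := by
        conv_rhs => rw [← List.flatMap_singleton' (List.ofFn fun j => f j.succ),
          List.flatMap_def, List.map_ofFn]
        rfl
      simp [this, e]
    · have := ih (fun j => b j.succ) (fun j => f j.succ) i fun j hj => h _ (by simpa using hj)
      have e : (fun j : Fin r => Function.update f i.succ a j.succ) =
          Function.update (fun j => f j.succ) i a :=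
        Function.update_comp_eq_of_injective' f (Fin.succ_injective r) i a
      rw [e, this, Function.update_of_ne (Fin.succ_ne_zero i).symm,
        Fin.val_succ, List.take_succ_cons, List.drop_succ_cons,
        List.flatten_cons, h 0 (Fin.succ_ne_zero i).symm]
      rfl

end OrderedPartitions

/-! ### Operators evaluated on words of degree-labelled elements -/

section OnWords

variable {V W : Type*} {n : ℕ}

/-- The value of a family of operators at a word of labelled elements. -/
def onWord (F : Op V W) (l : List (ℤ × V)) : W :=
  F l.length (fun i => (l.get i).1) (fun i => (l.get i).2)

theorem onWord_ofFn (F : Op V W) (z : Fin n → ℤ × V) :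
    onWord F (List.ofFn z) = F n (fun i => (z i).1) (fun i => (z i).2) := by
  have : ∀ (l : List (ℤ × V)) (h : l.length = n) (_ : ∀ i, l.get i = z (i.cast h)),
      onWord F l = F n (fun i => (z i).1) (fun i => (z i).2) := by
    rintro l rfl h
    simp only [onWord, h, Fin.cast_refl, id]
  exact this _ (List.length_ofFn) fun i => by simp; rfl

theorem blocks_eq_singleton (c : OrderedFinpartition n) (y : Fin n → V) (j : Fin c.length)
    (h : c.partSize j = 1) :
    (List.ofFn fun r => y (c.emb j r)) = [y (c.emb j ⟨0, c.partSize_pos j⟩)] := by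
  rw [List.ofFn_congr h]
  simp only [List.ofFn_succ, List.ofFn_zero]
  rfl

theorem preBlock_postBlock_length (c : OrderedFinpartition n) (i : Fin c.length)
    (h : OnlyBlock c i) :
    (preBlock c i).length = i ∧ (postBlock c i).length + i + 1 = c.length := by
  rw [onlyBlock_iff] at h
  have hi := i.isLt
  constructor
  · rw [preBlock, length_flatten_of_singletons]
    · simp [blocks]
    · intro A hA
      obtain ⟨j, hj, rfl⟩ := List.mem_iff_getElem.1 hA
      simp only [blocks, List.length_take, List.length_ofFn] at hj
      simpa [blocks] using h ⟨j, by omega⟩ fun e => by simp [← e] at hj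
  · rw [postBlock, length_flatten_of_singletons]
    · simp only [blocks, List.length_drop, List.length_ofFn]; omega
    · intro A hA
      obtain ⟨j, hj, rfl⟩ := List.mem_iff_getElem.1 hA
      simp only [blocks, List.length_drop, List.length_ofFn] at hj
      simpa [blocks] using h ⟨i + 1 + j, by omega⟩ fun e => by
        have := congrArg Fin.val e; simp at this; omega

/-- Removes the dependent indexing: the singleton blocks on both sides concatenate to words, and the
inserted value becomes one letter labelled with its degree. -/
theorem insertBlock_eq (c : OrderedFinpartition n) (i : Fin c.length) (h : OnlyBlock c i)
    (d : Fin n → ℤ) (x : Fin n → V) (q : ℤ) (v : V) (G : Op V W) :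
    G c.length (insertDeg c i d q) (insertBlock c i x v) =
      onWord G ((preBlock c i).map (fun j => (d j, x j)) ++
        (wordDeg d (List.ofFn (c.emb i)) + q, v) ::
          (postBlock c i).map (fun j => (d j, x j))) := by
  rw [onlyBlock_iff] at h
  set y : Fin n → ℤ × V := fun j => (d j, x j)
  set f : Fin c.length → ℤ × V := fun j => y (c.emb j ⟨0, c.partSize_pos j⟩)
  have e := ofFn_update_eq (fun j => List.ofFn fun r => y (c.emb j r)) f i
    (wordDeg d (List.ofFn (c.emb i)) + q, v) fun j hj => blocks_eq_singleton c y j (h j hj)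
  have hb : (blocks c id).map (List.map y) = blocks c y := by
    simp [blocks, List.map_ofFn, Function.comp_def]
  rw [preBlock, postBlock, List.map_flatten, List.map_flatten, List.map_take, List.map_drop, hb,
    blocks, ← e, onWord_ofFn]
  congr 1
  · funext j
    rcases eq_or_ne j i with rfl | hj
    · simp [insertDeg, blockDeg, wordDeg_ofFn]
    · rw [Function.update_of_ne hj, insertDeg, if_neg hj, add_zero, blockDeg,
        ← wordDeg_ofFn d (c.emb j), show List.ofFn (c.emb j) = _ from
          blocks_eq_singleton c id j (h j hj)]
      simp [f, y]
  · funext j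
    rcases eq_or_ne j i with rfl | hj
    · simp [insertBlock]
    · rw [Function.update_of_ne hj, insertBlock, Function.update_of_ne hj]

end OnWords

/-! ### Calculus of super-commuting power series -/

section SuperSeriesCalculus

set_option linter.unusedSectionVars false

variable {J : Type*} [Fintype J] [LinearOrder J] {k : Type*} [Field k] {deg : J → ℤ}

namespace SuperSeries

theorem Admissible.left {a b : J →₀ ℕ} (h : Admissible deg (a + b)) : Admissible deg a :=
  fun α hα => (Nat.le_add_right _ _).trans (h α hα)

theorem Admissible.right {a b : J →₀ ℕ} (h : Admissible deg (a + b)) : Admissible deg b :=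
  fun α hα => (Nat.le_add_left _ _).trans (h α hα)

theorem admissible_zero : Admissible deg (0 : J →₀ ℕ) := fun _ _ => Nat.zero_le _

/-- Series form a vector space. -/
@[reducible] noncomputable def module : Module k (SuperSeries k deg) :=
  inferInstanceAs (Module k ({a : J →₀ ℕ // Admissible deg a} → k))

attribute [local instance] module

theorem coeff_of_admissible (F : SuperSeries k deg) {a : J →₀ ℕ} (h : Admissible deg a) :
    coeff F a = F ⟨a, h⟩ := dif_pos h

theorem coeff_of_not_admissible (F : SuperSeries k deg) {a : J →₀ ℕ} (h : ¬ Admissible deg a) :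
    coeff F a = 0 := dif_neg h

theorem ext_coeff {F G : SuperSeries k deg} (h : ∀ a, Admissible deg a → coeff F a = coeff G a) :
    F = G := by
  funext a
  have := h a.1 a.2
  rwa [coeff_of_admissible F a.2, coeff_of_admissible G a.2] at this

/-- Taking a coefficient, as a linear map. -/
noncomputable def coeffHom (a : J →₀ ℕ) : SuperSeries k deg →ₗ[k] k where
  toFun F := coeff F a
  map_add' F G := by
    by_cases h : Admissible deg a
    · simp only [coeff_of_admissible _ h]; rfl
    · simp [coeff_of_not_admissible _ h]
  map_smul' c F := by
    by_cases h : Admissible deg a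
    · simp only [coeff_of_admissible _ h]; rfl
    · simp [coeff_of_not_admissible _ h]

theorem coeffHom_apply (a : J →₀ ℕ) (F : SuperSeries k deg) : coeffHom a F = coeff F a := rfl

theorem coeff_add (F G : SuperSeries k deg) (a : J →₀ ℕ) :
    coeff (F + G) a = coeff F a + coeff G a := (coeffHom a).map_add F G

theorem coeff_zero (a : J →₀ ℕ) : coeff (0 : SuperSeries k deg) a = 0 := (coeffHom a).map_zero

theorem coeff_smul (c : k) (F : SuperSeries k deg) (a : J →₀ ℕ) :
    coeff (c • F) a = c * coeff F a := (coeffHom a).map_smul c F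

theorem units_smul_eq {W : Type*} [AddCommGroup W] [Module k W] (u : ℤˣ) (w : W) :
    u • w = ((u : ℤ) : k) • w := by
  rw [Units.smul_def, Int.cast_smul_eq_zsmul]

theorem coeff_units_smul (u : ℤˣ) (F : SuperSeries k deg) (a : J →₀ ℕ) :
    coeff (u • F) a = u • coeff F a := by
  rw [units_smul_eq (k := k), coeff_smul, units_smul_eq (k := k), smul_eq_mul]

theorem coeff_sum {κ : Type*} (s : Finset κ) (F : κ → SuperSeries k deg) (a : J →₀ ℕ) :
    coeff (∑ i ∈ s, F i) a = ∑ i ∈ s, coeff (F i) a := map_sum (coeffHom a) F s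

open Classical in
theorem coeff_monomial {b : J →₀ ℕ} (hb : Admissible deg b) (a : J →₀ ℕ) :
    coeff (monomial b : SuperSeries k deg) a = if a = b then 1 else 0 := by
  by_cases h : Admissible deg a
  · rw [coeff_of_admissible _ h]; rfl
  · rw [coeff_of_not_admissible _ h, if_neg]
    rintro rfl; exact h hb

theorem coeff_mul (F G : SuperSeries k deg) {a : J →₀ ℕ} (h : Admissible deg a) :
    coeff (F * G) a = ∑ p ∈ HasAntidiagonal.antidiagonal a,
      monoSign deg p.1 p.2 • (coeff F p.1 * coeff G p.2) := coeff_of_admissible _ h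

/-- The exponent of the sign in `t^a t^b = ± t^{a+b}`. -/
def pairing (deg : J → ℤ) (a b : J →₀ ℕ) : ℤ :=
  ∑ α, ∑ β, if β < α then deg α * a α * (deg β * b β) else 0

theorem monoSign_eq (a b : J →₀ ℕ) : monoSign deg a b = (pairing deg a b).negOnePow := by
  simp only [monoSign, pairing, prod_ite_negOnePow, prod_negOnePow]

/-- Biadditivity of the sign exponent is the cocycle property behind associativity of the product of
series. -/
theorem pairing_add_left (a b c : J →₀ ℕ) :
    pairing deg (a + b) c = pairing deg a c + pairing deg b c := by
  simp only [pairing, ← sum_add_distrib]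
  refine sum_congr rfl fun α _ => sum_congr rfl fun β _ => ?_
  split_ifs
  · simp only [Finsupp.add_apply]; push_cast; ring
  · simp

theorem pairing_add_right (a b c : J →₀ ℕ) :
    pairing deg a (b + c) = pairing deg a b + pairing deg a c := by
  simp only [pairing, ← sum_add_distrib]
  refine sum_congr rfl fun α _ => sum_congr rfl fun β _ => ?_
  split_ifs
  · simp only [Finsupp.add_apply]; push_cast; ring
  · simp

theorem pairing_zero_left (b : J →₀ ℕ) : pairing deg 0 b = 0 := by simp [pairing]

theorem pairing_zero_right (b : J →₀ ℕ) : pairing deg b 0 = 0 := by simp [pairing]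

/-- Series form an associative algebra. -/
@[reducible] noncomputable def nonUnitalRing : NonUnitalRing (SuperSeries k deg) where
  left_distrib F G H := ext_coeff fun a ha => by
    simp only [coeff_add, coeff_mul _ _ ha, mul_add, smul_add, sum_add_distrib]
  right_distrib F G H := ext_coeff fun a ha => by
    simp only [coeff_add, coeff_mul _ _ ha, add_mul, smul_add, sum_add_distrib]
  zero_mul F := ext_coeff fun a ha => by simp [coeff_mul _ _ ha, coeff_zero]
  mul_zero F := ext_coeff fun a ha => by simp [coeff_mul _ _ ha, coeff_zero]
  mul_assoc F G H := ext_coeff fun a ha => by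
    have h1 : coeff (F * G * H) a = ∑ p ∈ HasAntidiagonal.antidiagonal a,
        ∑ q ∈ HasAntidiagonal.antidiagonal p.1,
        (pairing deg q.1 q.2 + pairing deg q.1 p.2 + pairing deg q.2 p.2).negOnePow •
          (coeff F q.1 * coeff G q.2 * coeff H p.2) := by
      rw [coeff_mul _ _ ha]
      refine sum_congr rfl fun p hp => ?_
      rw [HasAntidiagonal.mem_antidiagonal] at hp
      rw [coeff_mul _ _ (Admissible.left (hp ▸ ha)), sum_mul, smul_sum]
      refine sum_congr rfl fun q hq => ?_
      rw [HasAntidiagonal.mem_antidiagonal] at hq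
      rw [smul_mul_assoc, smul_smul, monoSign_eq, monoSign_eq, ← Int.negOnePow_add, ← hq,
        pairing_add_left]
      congr 2; ring
    have h2 : coeff (F * (G * H)) a = ∑ p ∈ HasAntidiagonal.antidiagonal a,
        ∑ q ∈ HasAntidiagonal.antidiagonal p.2,
        (pairing deg p.1 q.1 + pairing deg p.1 q.2 + pairing deg q.1 q.2).negOnePow •
          (coeff F p.1 * coeff G q.1 * coeff H q.2) := by
      rw [coeff_mul _ _ ha]
      refine sum_congr rfl fun p hp => ?_
      rw [HasAntidiagonal.mem_antidiagonal] at hp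
      rw [coeff_mul _ _ (Admissible.right (hp ▸ ha)), mul_sum, smul_sum]
      refine sum_congr rfl fun q hq => ?_
      rw [HasAntidiagonal.mem_antidiagonal] at hq
      rw [mul_smul_comm, smul_smul, monoSign_eq, monoSign_eq, ← Int.negOnePow_add, ← hq,
        pairing_add_right, mul_assoc]
    rw [h1, h2, sum_sigma', sum_sigma']
    refine sum_nbij' (fun x => ⟨(x.2.1, x.2.2 + x.1.2), (x.2.2, x.1.2)⟩)
      (fun x => ⟨(x.1.1 + x.2.1, x.2.2), (x.1.1, x.2.1)⟩) ?_ ?_ ?_ ?_ ?_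
    · rintro ⟨⟨a, b⟩, ⟨c, d⟩⟩ h
      simp only [mem_sigma, HasAntidiagonal.mem_antidiagonal] at h ⊢
      exact ⟨by rw [← h.1, ← h.2, add_assoc], trivial⟩
    · rintro ⟨⟨a, b⟩, ⟨c, d⟩⟩ h
      simp only [mem_sigma, HasAntidiagonal.mem_antidiagonal] at h ⊢
      exact ⟨by rw [← h.1, ← h.2, add_assoc], trivial⟩
    · rintro ⟨⟨a, b⟩, ⟨c, d⟩⟩ h
      simp only [mem_sigma, HasAntidiagonal.mem_antidiagonal] at h
      simp [h.2]
    · rintro ⟨⟨a, b⟩, ⟨c, d⟩⟩ h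
      simp only [mem_sigma, HasAntidiagonal.mem_antidiagonal] at h
      simp [h.2]
    · intro x _; rfl

attribute [local instance] nonUnitalRing

theorem one_mul' (F : SuperSeries k deg) : 1 * F = F := ext_coeff fun a ha => by
  classical
  rw [coeff_mul _ _ ha, sum_eq_single (0, a)]
  · rw [monoSign_eq, pairing_zero_left]
    have : coeff (1 : SuperSeries k deg) 0 = 1 := by
      rw [show (1 : SuperSeries k deg) = monomial 0 from rfl, coeff_monomial admissible_zero]
      simp
    simp [this]
  · rintro ⟨b, c⟩ h hne
    have hb : b ≠ 0 := by
      rintro rfl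
      apply hne
      rw [HasAntidiagonal.mem_antidiagonal] at h
      simpa using h
    rw [show (1 : SuperSeries k deg) = monomial 0 from rfl, coeff_monomial admissible_zero,
      if_neg hb, zero_mul, smul_zero]
  · simp

/-- The derivative `∂_α` as a linear map. -/
noncomputable def derivHom (α : J) : SuperSeries k deg →ₗ[k] SuperSeries k deg where
  toFun := partialD α
  map_add' F G := by
    funext c
    simp only [partialD, coeff_add, mul_add, smul_add]; rfl
  map_smul' r F := by
    funext c
    simp only [partialD, coeff_smul, mul_left_comm _ r]
    exact (mul_smul_comm (_ : ℤˣ) r (_ : k)).symm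

/-- The total degree, up to sign, of the `t^β` with `β < α` in `t^a`. -/
def lowDeg (deg : J → ℤ) (α : J) (a : J →₀ ℕ) : ℤ := ∑ β, if β < α then deg β * a β else 0

/-- The total degree, up to sign, of the `t^β` with `β > α` in `t^a`. -/
def highDeg (deg : J → ℤ) (α : J) (a : J →₀ ℕ) : ℤ := ∑ β, if α < β then deg β * a β else 0

/-- The degree of `t^a`, up to sign. -/
def monoDeg (deg : J → ℤ) (a : J →₀ ℕ) : ℤ := ∑ β, deg β * a β

theorem monoDeg_eq (α : J) (a : J →₀ ℕ) :
    monoDeg deg a = lowDeg deg α a + deg α * a α + highDeg deg α a := by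
  have : deg α * a α = ∑ β, if β = α then deg β * (a β : ℤ) else 0 := by simp
  rw [this, monoDeg, lowDeg, highDeg, ← sum_add_distrib, ← sum_add_distrib]
  refine sum_congr rfl fun β _ => ?_
  rcases lt_trichotomy β α with h | h | h
  · simp [h, h.ne, h.not_gt]
  · simp [h]
  · simp [h, h.ne', h.not_gt]

theorem lowDeg_add (α : J) (a b : J →₀ ℕ) :
    lowDeg deg α (a + b) = lowDeg deg α a + lowDeg deg α b := by
  simp only [lowDeg, ← sum_add_distrib]
  refine sum_congr rfl fun β _ => ?_
  split_ifs
  · simp only [Finsupp.add_apply]; push_cast; ring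
  · simp

theorem monoDeg_add (a b : J →₀ ℕ) : monoDeg deg (a + b) = monoDeg deg a + monoDeg deg b := by
  simp [monoDeg, mul_add, sum_add_distrib]

theorem monoDeg_single (α : J) : monoDeg deg (Finsupp.single α 1) = deg α := by
  classical
  simp [monoDeg, Finsupp.single_apply]

theorem pairing_single_left (α : J) (b : J →₀ ℕ) :
    pairing deg (Finsupp.single α 1) b = deg α * lowDeg deg α b := by
  classical
  rw [pairing, sum_eq_single α, lowDeg, mul_sum]
  · simp
  · intro β _ h; simp [h]
  · simp

theorem pairing_single_right (α : J) (a : J →₀ ℕ) :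
    pairing deg a (Finsupp.single α 1) = highDeg deg α a * deg α := by
  classical
  rw [pairing, highDeg, sum_mul]
  refine sum_congr rfl fun β _ => ?_
  rw [sum_eq_single α]
  · simp
  · intro γ _ h; simp [h]
  · simp

theorem coeff_partialD (α : J) (F : SuperSeries k deg) {c : J →₀ ℕ} (hc : Admissible deg c) :
    coeff (partialD α F) c = (deg α * lowDeg deg α c).negOnePow •
      (((c α + 1 : ℕ) : k) * coeff F (c + Finsupp.single α 1)) := by
  rw [coeff_of_admissible _ hc, partialD, prod_ite_negOnePow, lowDeg, mul_sum]
  simp only [mul_ite, mul_zero]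

/-- All monomials of `F` have the same parity as `p`. -/
def HasParity (F : SuperSeries k deg) (p : ℤ) : Prop :=
  ∀ a, coeff F a ≠ 0 → Even (monoDeg deg a - p)

theorem HasParity.partialD {F : SuperSeries k deg} {p : ℤ} (hF : HasParity F p) (α : J) :
    HasParity (partialD α F) (deg α + p) := by
  intro a ha
  have hadm : Admissible deg a := by
    by_contra h; exact ha (coeff_of_not_admissible _ h)
  rw [coeff_partialD α F hadm] at ha
  have h1 : coeff F (a + Finsupp.single α 1) ≠ 0 := by
    intro h; simp [h] at ha
  have h2 := hF _ h1
  rw [monoDeg_add, monoDeg_single] at h2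
  have : monoDeg deg a - (deg α + p) = monoDeg deg a + deg α - p - 2 * deg α := by ring
  rw [this]
  exact h2.sub (even_two_mul _)

/-- The shift misses only the splittings whose first exponent vanishes at α, and those carry weight
0. -/
theorem sum_antidiagonal_add_single (α : J) (c : J →₀ ℕ) (f : (J →₀ ℕ) × (J →₀ ℕ) → k) :
    ∑ q ∈ HasAntidiagonal.antidiagonal c,
        ((q.1 α + 1 : ℕ) : k) * f (q.1 + Finsupp.single α 1, q.2) =
      ∑ p ∈ HasAntidiagonal.antidiagonal (c + Finsupp.single α (1 : ℕ)), (p.1 α : k) * f p := by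
  classical
  refine sum_of_injOn (fun q => (q.1 + Finsupp.single α 1, q.2)) ?_ ?_ ?_ ?_
  · rintro ⟨a, b⟩ _ ⟨a', b'⟩ _ h
    simpa using h
  · rintro ⟨a, b⟩ h
    simp only [mem_coe, HasAntidiagonal.mem_antidiagonal] at h ⊢
    rw [← h]; abel
  · rintro ⟨a, b⟩ h h'
    suffices a α = 0 by simp [this]
    by_contra ha
    apply h'
    have e : a - Finsupp.single α 1 + Finsupp.single α 1 = a :=
      tsub_add_cancel_of_le (Finsupp.single_le_iff.2 (Nat.one_le_iff_ne_zero.2 ha))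
    refine ⟨(a - Finsupp.single α 1, b), ?_, ?_⟩
    · rw [HasAntidiagonal.mem_antidiagonal] at h
      simp only [mem_coe, HasAntidiagonal.mem_antidiagonal]
      rw [← e, add_right_comm] at h
      exact add_right_cancel h
    · simp [e]
  · intro q _; simp

theorem sum_antidiagonal_add_single' (α : J) (c : J →₀ ℕ) (f : (J →₀ ℕ) × (J →₀ ℕ) → k) :
    ∑ q ∈ HasAntidiagonal.antidiagonal c,
        ((q.2 α + 1 : ℕ) : k) * f (q.1, q.2 + Finsupp.single α 1) =
      ∑ p ∈ HasAntidiagonal.antidiagonal (c + Finsupp.single α (1 : ℕ)), (p.2 α : k) * f p := by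
  have := sum_antidiagonal_add_single α c fun p => f p.swap
  have h1 := Finsupp.sum_antidiagonal_swap c fun a b =>
    ((a α + 1 : ℕ) : k) * f (b, a + Finsupp.single α 1)
  have h2 := Finsupp.sum_antidiagonal_swap (c + Finsupp.single α 1) fun a b => (a α : k) * f (b, a)
  exact h1.symm.trans (this.trans h2)

/-- The graded Leibniz rule. -/
theorem partialD_mul (α : J) {F : SuperSeries k deg} {p : ℤ} (hF : HasParity F p)
    (G : SuperSeries k deg) :
    partialD α (F * G) =
      partialD α F * G + (deg α * p).negOnePow • (F * partialD α G) := by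
  refine ext_coeff fun c hc => ?_
  -- Both terms of the Leibniz rule become sums over splittings of c + α. The second one, g, has the
  -- extra sign of moving ∂_α past the powers of t^α in the first factor.
  let ε : (J →₀ ℕ) × (J →₀ ℕ) → ℤˣ := fun q =>
    (deg α * lowDeg deg α c + pairing deg q.1 q.2).negOnePow
  let f : (J →₀ ℕ) × (J →₀ ℕ) → k := fun q => ε q • (coeff F q.1 * coeff G q.2)
  let g : (J →₀ ℕ) × (J →₀ ℕ) → k := fun q => (deg α * (deg α * q.1 α)).negOnePow • f q
  have e1 : coeff (partialD α F * G) c =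
      ∑ q ∈ HasAntidiagonal.antidiagonal (c + Finsupp.single α (1 : ℕ)), (q.1 α : k) * f q := by
    rw [coeff_mul _ _ hc, ← sum_antidiagonal_add_single]
    refine sum_congr rfl fun q hq => ?_
    rw [HasAntidiagonal.mem_antidiagonal] at hq
    rw [coeff_partialD α F (Admissible.left (hq ▸ hc)), monoSign_eq]
    simp only [f, ε, pairing_add_left, pairing_single_left, ← hq, lowDeg_add]
    rw [smul_mul_assoc, smul_smul, ← Int.negOnePow_add, mul_smul_comm, mul_assoc]
    apply negOnePow_smul_congr
    ring_nf; simp [parity_simps]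
  have e2 : coeff ((deg α * p).negOnePow • (F * partialD α G)) c =
      ∑ q ∈ HasAntidiagonal.antidiagonal (c + Finsupp.single α (1 : ℕ)), (q.2 α : k) * g q := by
    rw [coeff_units_smul, coeff_mul _ _ hc, ← sum_antidiagonal_add_single', smul_sum]
    refine sum_congr rfl fun q hq => ?_
    rw [HasAntidiagonal.mem_antidiagonal] at hq
    rw [coeff_partialD α G (Admissible.right (hq ▸ hc)), monoSign_eq]
    simp only [f, g, ε, pairing_add_right, pairing_single_right, ← hq, lowDeg_add]
    by_cases h0 : coeff F q.1 = 0
    · simp [h0]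
    have h1 := hF _ h0
    rw [monoDeg_eq α] at h1
    simp only [mul_smul_comm, smul_smul, ← Int.negOnePow_add]
    rw [mul_left_comm]
    apply negOnePow_smul_congr
    obtain ⟨m, hm⟩ := h1
    obtain rfl : p = lowDeg deg α q.1 + deg α * (q.1 α : ℤ) + highDeg deg α q.1 - (m + m) := by
      rw [← hm]; ring
    ring_nf
    simp [parity_simps]
  rw [coeff_add, e1, e2, coeff_partialD α _ hc, ← sum_add_distrib]
  by_cases h : Admissible deg (c + Finsupp.single α 1)
  · rw [coeff_mul _ _ h, mul_sum, smul_sum]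
    refine sum_congr rfl fun q hq => ?_
    rw [HasAntidiagonal.mem_antidiagonal] at hq
    have hq' : q.1 α + q.2 α = c α + 1 := by
      simpa using DFunLike.congr_fun hq α
    -- For odd α at most one t^α is present; if it lies in the second factor, the first has none and
    -- the extra sign is trivial.
    have hs : (q.2 α : k) * g q = (q.2 α : k) * f q := by
      by_cases hα : Even (deg α)
      · have : (deg α * (deg α * q.1 α)).negOnePow = 1 := Int.negOnePow_even _ (hα.mul_right _)
        simp only [g, this, one_smul]
      · have h1 := h α (Int.not_even_iff_odd.1 hα)
        rw [Finsupp.add_apply, Finsupp.single_eq_same, ← hq'] at h1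
        rcases Nat.eq_zero_or_pos (q.2 α) with h2 | h2
        · simp [h2]
        · have : q.1 α = 0 := by omega
          simp [g, this]
    rw [hs, ← add_mul, ← Nat.cast_add, hq', monoSign_eq]
    simp only [f, ε]
    rw [mul_smul_comm, mul_smul_comm, smul_smul, Int.negOnePow_add]
  · rw [coeff_of_not_admissible _ h, mul_zero, smul_zero]
    symm
    refine sum_eq_zero fun q hq => ?_
    rw [HasAntidiagonal.mem_antidiagonal] at hq
    have hq' : q.1 α + q.2 α = c α + 1 := by
      simpa using DFunLike.congr_fun hq α
    by_cases h1 : Admissible deg q.1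
    · by_cases h2 : Admissible deg q.2
      · have h3 : Odd (deg α) ∧ c α = 1 := by
          by_contra h3
          apply h
          intro β hβ
          have h4 := hc β hβ
          rcases eq_or_ne β α with rfl | hne
          · have : c β ≠ 1 := fun h => h3 ⟨hβ, h⟩
            simp; omega
          · simpa [Finsupp.single_apply, hne.symm] using h4
        have h5 := h1 α h3.1
        have h6 := h2 α h3.1
        have h7 : q.1 α = 1 ∧ q.2 α = 1 := by omega
        have h8 : (deg α * (deg α * 1)).negOnePow = -1 :=
          Int.negOnePow_odd _ (by simpa using h3.1.mul h3.1)
        simp [g, h7.1, h7.2] at h8 ⊢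
        simp [h8]
      · simp [g, f, coeff_of_not_admissible G h2]
    · simp [g, f, coeff_of_not_admissible F h1]

end SuperSeries

end SuperSeriesCalculus

/-! ### Series given by symmetric tensors -/

section SuperSeriesTensors

set_option linter.unusedSectionVars false

variable {J : Type*} [Fintype J] [LinearOrder J] {k : Type*} [Field k] {deg : J → ℤ}

attribute [local instance] SuperSeries.module SuperSeries.nonUnitalRing

/-- Symmetry of a function of words up to Koszul signs. -/
def GradedSymm {ι W : Type*} [AddCommGroup W] (deg : ι → ℤ) (f : List ι → W) : Prop :=
  ∀ l x y l', f (l ++ x :: y :: l') = (deg x * deg y).negOnePow • f (l ++ y :: x :: l')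

theorem GradedSymm.append {ι W : Type*} [AddCommGroup W] {deg : ι → ℤ} {f : List ι → W}
    (hf : GradedSymm deg f) (l₀ : List ι) : GradedSymm deg fun l => f (l ++ l₀) := by
  intro l x y l'
  simpa using hf l x y (l' ++ l₀)

namespace SuperSeries

theorem partialD_add (α : J) (F G : SuperSeries k deg) :
    partialD α (F + G) = partialD α F + partialD α G := (derivHom α).map_add F G

theorem partialD_smul (α : J) (c : k) (F : SuperSeries k deg) :
    partialD α (c • F) = c • partialD α F := (derivHom α).map_smul c F

theorem partialD_sum {κ : Type*} (α : J) (s : Finset κ) (F : κ → SuperSeries k deg) :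
    partialD α (∑ i ∈ s, F i) = ∑ i ∈ s, partialD α (F i) := map_sum (derivHom α) F s

theorem coeff_one_zero : coeff (1 : SuperSeries k deg) 0 = 1 := by
  rw [show (1 : SuperSeries k deg) = monomial 0 from rfl, coeff_monomial admissible_zero]
  simp

theorem coeff_one_of_ne {a : J →₀ ℕ} (h : a ≠ 0) : coeff (1 : SuperSeries k deg) a = 0 := by
  rw [show (1 : SuperSeries k deg) = monomial 0 from rfl, coeff_monomial admissible_zero]
  simp [h]

theorem partialD_one (α : J) : partialD α (1 : SuperSeries k deg) = 0 :=
  ext_coeff fun a ha => by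
    rw [coeff_partialD α _ ha, coeff_one_of_ne, mul_zero, smul_zero, coeff_zero]
    intro h
    simpa using DFunLike.congr_fun h α

theorem admissible_single (α : J) : Admissible deg (Finsupp.single α 1 : J →₀ ℕ) := by
  classical
  intro β _
  rw [Finsupp.single_apply]
  split_ifs <;> simp

theorem hasParity_t (α : J) : HasParity (t α : SuperSeries k deg) (deg α) := by
  intro a ha
  rw [t, coeff_monomial (admissible_single α)] at ha
  have : a = Finsupp.single α 1 := by
    by_contra h; simp [h] at ha
  rw [this, monoDeg_single, sub_self]
  exact Even.zero

theorem partialD_t (α β : J) :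
    partialD α (t β : SuperSeries k deg) = if β = α then 1 else 0 :=
  ext_coeff fun a ha => by
    classical
    rw [coeff_partialD α _ ha, t, coeff_monomial (admissible_single β)]
    by_cases h : β = α
    · subst h
      rw [if_pos rfl]
      by_cases h0 : a = 0
      · subst h0
        simp [coeff_one_zero, lowDeg]
      · rw [coeff_one_of_ne h0, if_neg, mul_zero, smul_zero]
        intro h
        exact h0 (add_eq_right.1 h)
    · rw [if_neg h, coeff_zero, if_neg, mul_zero, smul_zero]
      intro e
      have := DFunLike.congr_fun e α
      simp [h] at this

theorem partialD_t_mul (α β : J) (F : SuperSeries k deg) :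
    partialD α (t β * F) =
      (if β = α then F else 0) + (deg α * deg β).negOnePow • (t β * partialD α F) := by
  rw [partialD_mul α (hasParity_t β), partialD_t]
  split_ifs
  · rw [one_mul']
  · rw [zero_mul]

/-- The sum `∑_{x₁, …, xₙ} t^{xₙ} ⋯ t^{x₁} f(x₁, …, xₙ)`. -/
noncomputable def wordSeries : (n : ℕ) → (List J → k) → SuperSeries k deg
  | 0, f => f [] • 1
  | n + 1, f => ∑ x, t x * wordSeries n fun l => f (l ++ [x])

theorem mul_smul_right (c : k) (F G : SuperSeries k deg) : F * (c • G) = c • (F * G) :=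
  ext_coeff fun a ha => by
    rw [coeff_smul, coeff_mul _ _ ha, coeff_mul _ _ ha, mul_sum]
    refine sum_congr rfl fun p _ => ?_
    rw [coeff_smul, mul_left_comm, mul_smul_comm]

theorem mul_smul_left (c : k) (F G : SuperSeries k deg) : (c • F) * G = c • (F * G) :=
  ext_coeff fun a ha => by
    rw [coeff_smul, coeff_mul _ _ ha, coeff_mul _ _ ha, mul_sum]
    refine sum_congr rfl fun p _ => ?_
    rw [coeff_smul, mul_assoc, mul_smul_comm]

theorem mul_units_smul (u : ℤˣ) (F G : SuperSeries k deg) : F * (u • G) = u • (F * G) := by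
  rw [units_smul_eq (k := k), mul_smul_right, units_smul_eq (k := k)]

theorem units_smul_mul (u : ℤˣ) (F G : SuperSeries k deg) : (u • F) * G = u • (F * G) := by
  rw [units_smul_eq (k := k), mul_smul_left, units_smul_eq (k := k)]

theorem wordSeries_smul (n : ℕ) (c : k) (f : List J → k) :
    (wordSeries n (fun l => c * f l) : SuperSeries k deg) = c • wordSeries n f := by
  induction n generalizing f with
  | zero => rw [wordSeries, wordSeries, mul_smul]
  | succ n ih => simp only [wordSeries, ih, mul_smul_right, smul_sum]

theorem wordSeries_units_smul (n : ℕ) (u : ℤˣ) (f : List J → k) :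
    (wordSeries n (fun l => u • f l) : SuperSeries k deg) = u • wordSeries n f := by
  rw [units_smul_eq (k := k), ← wordSeries_smul]
  simp only [units_smul_eq (k := k), smul_eq_mul]

theorem wordSeries_eq_sum (n : ℕ) (f : List J → k) :
    (wordSeries n f : SuperSeries k deg) = ∑ ρ : Fin n → J,
      f (List.ofFn ρ) • ((List.ofFn fun i => t (ρ i)).reverse.prod : SuperSeries k deg) := by
  induction n generalizing f with
  | zero => simp [wordSeries]
  | succ n ih =>
    rw [← (Fin.snocEquiv fun _ => J).sum_comp, Fintype.sum_prod_type, wordSeries]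
    refine sum_congr rfl fun x _ => ?_
    rw [ih, mul_sum]
    refine sum_congr rfl fun ρ _ => ?_
    have e1 : List.ofFn (Fin.snocEquiv (fun _ : Fin (n + 1) => J) (x, ρ)) = List.ofFn ρ ++ [x] := by
      rw [List.ofFn_succ']
      simp [Fin.snocEquiv, List.concat_eq_append]
    have e2 : (List.ofFn fun i => t (Fin.snocEquiv (fun _ : Fin (n + 1) => J) (x, ρ) i) :
        List (SuperSeries k deg)) = (List.ofFn fun i => t (ρ i)) ++ [t x] := by
      rw [List.ofFn_succ']
      simp [Fin.snocEquiv, List.concat_eq_append]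
    rw [e1, e2, List.reverse_append, mul_smul_right]
    rfl

/-- Each of the n + 1 positions contributes equally: the sign of moving ∂_α past variables is undone
by moving α to the end of the word through the symmetry of f. -/
theorem partialD_wordSeries (α : J) (n : ℕ) (f : List J → k) (hf : GradedSymm deg f) :
    partialD α (wordSeries (n + 1) f : SuperSeries k deg) =
      ((n + 1 : ℕ) : k) • wordSeries n fun l => f (l ++ [α]) := by
  induction n generalizing f with
  | zero =>
    simp only [zero_add, wordSeries, partialD_sum]
    simp [partialD_t_mul, partialD_smul, partialD_one]
  | succ n ih =>
    rw [wordSeries, partialD_sum]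
    simp only [partialD_t_mul, sum_add_distrib, sum_ite_eq', mem_univ, if_true]
    have e : ∀ x, (deg α * deg x).negOnePow • (t x * partialD α (wordSeries (n + 1)
        fun l => f (l ++ [x]) : SuperSeries k deg)) =
        ((n + 1 : ℕ) : k) • (t x * wordSeries n fun l => f (l ++ [x] ++ [α])) := by
      intro x
      rw [ih _ (hf.append [x]), mul_smul_right, units_smul_eq (k := k), smul_comm,
        ← units_smul_eq (k := k), ← mul_units_smul, ← wordSeries_units_smul]
      congr 3; funext l
      have := hf l α x []
      simp only [List.append_assoc, List.singleton_append]
      rw [this, smul_smul, ← Int.negOnePow_add, Int.negOnePow_even _ ⟨_, rfl⟩, one_smul]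
    simp only [e, ← smul_sum]
    rw [Nat.cast_succ (n + 1), add_smul, one_smul, add_comm]
    rfl

theorem coeff_ofTensors (f : List J → k) {a : J →₀ ℕ} (ha : Admissible deg a) :
    coeff (ofTensors (fun _ ρ => f (List.ofFn ρ)) : SuperSeries k deg) a =
      ((a.degree.factorial : ℕ) : k)⁻¹ * coeff (wordSeries a.degree f : SuperSeries k deg) a := by
  rw [coeff_of_admissible _ ha, ofTensors, wordSeries_eq_sum, coeff_sum]
  congr 1
  refine sum_congr rfl fun ρ _ => ?_
  rw [coeff_smul, coeff_of_admissible _ ha, mul_comm]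

variable [CharZero k]

/-- The factor n + 1 from `partialD_wordSeries` cancels against the factorials, which uses
characteristic zero. -/
theorem partialD_ofTensors (α : J) (f : List J → k) (hf : GradedSymm deg f) :
    partialD α (ofTensors (fun _ ρ => f (List.ofFn ρ)) : SuperSeries k deg) =
      ofTensors fun _ ρ => f (List.ofFn ρ ++ [α]) :=
  ext_coeff fun a ha => by
    rw [coeff_ofTensors (fun l => f (l ++ [α])) ha]
    have e := congrArg (fun F => coeff F a) (partialD_wordSeries α a.degree f hf)
    simp only [coeff_smul, coeff_partialD α _ ha] at e
    rw [coeff_partialD α _ ha]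
    have hd : (a + Finsupp.single α 1).degree = a.degree + 1 := by simp
    by_cases h : Admissible deg (a + Finsupp.single α 1)
    · rw [coeff_ofTensors f h, hd, Nat.factorial_succ, mul_left_comm, ← mul_smul_comm, e,
        ← mul_assoc]
      congr 1
      have h1 : ((a.degree.factorial : ℕ) : k) ≠ 0 := by exact_mod_cast Nat.factorial_ne_zero _
      have h2 : ((a.degree + 1 : ℕ) : k) ≠ 0 := Nat.cast_ne_zero.2 (Nat.succ_ne_zero _)
      rw [Nat.cast_mul]
      field_simp
    -- The exponent a + α is not admissible, so the left side is 0. The right side vanishes because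
    -- its multiple by n + 1 does.
    · rw [coeff_of_not_admissible _ h, mul_zero, smul_zero] at e ⊢
      have h2 : ((a.degree + 1 : ℕ) : k) ≠ 0 := Nat.cast_ne_zero.2 (Nat.succ_ne_zero _)
      rw [(mul_eq_zero.1 e.symm).resolve_left h2, mul_zero]

/-- The iterated derivative `∂_{x₁} ⋯ ∂_{xₙ} F` for the word `x₁, …, xₙ`. -/
noncomputable def iterD (l : List J) (F : SuperSeries k deg) : SuperSeries k deg :=
  l.foldr partialD F

/-- The value of an iterated derivative at the origin. -/
noncomputable def derivAt (l : List J) (F : SuperSeries k deg) : k := coeff (iterD l F) 0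

theorem iterD_append_singleton (l : List J) (x : J) (F : SuperSeries k deg) :
    iterD (l ++ [x]) F = iterD l (partialD x F) := by simp [iterD]

/-- `derivAt` as a linear map. -/
noncomputable def derivAtHom (l : List J) : SuperSeries k deg →ₗ[k] k :=
  (coeffHom 0).comp (l.foldr (fun x f => (derivHom x).comp f) LinearMap.id)

theorem derivAtHom_apply (l : List J) (F : SuperSeries k deg) :
    derivAtHom l F = derivAt l F := by
  rw [derivAtHom, LinearMap.comp_apply, coeffHom_apply, derivAt, iterD]
  congr 1
  induction l with
  | nil => rfl
  | cons x l ih => simp only [List.foldr_cons, LinearMap.comp_apply, ih]; rfl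

/-- Together with `ext_derivAt`, this turns identities between series into identities between
functions of words. -/
theorem derivAt_ofTensors (l : List J) (f : List J → k) (hf : GradedSymm deg f) :
    derivAt l (ofTensors (fun _ ρ => f (List.ofFn ρ)) : SuperSeries k deg) = f l := by
  induction l using List.reverseRecOn generalizing f with
  | nil =>
    rw [derivAt, iterD, List.foldr_nil, coeff_ofTensors f admissible_zero]
    simp [wordSeries, coeff_smul, coeff_one_zero]
  | append_singleton l x ih =>
    rw [derivAt, iterD_append_singleton, partialD_ofTensors x f hf]
    exact ih (fun l => f (l ++ [x])) (hf.append [x])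

theorem HasParity.iterD {F : SuperSeries k deg} {p : ℤ} (hF : HasParity F p) (l : List J) :
    HasParity (iterD l F) (wordDeg deg l + p) := by
  induction l with
  | nil => rw [wordDeg_nil, zero_add]; exact hF
  | cons x l ih => rw [wordDeg_cons, add_assoc]; exact ih.partialD x

/-- Each derivative either hits F, or passes the already differentiated F, of parity `wordDeg deg B
+ p`, and hits G. This is the recursion of `splitSum`. -/
theorem iterD_mul {F : SuperSeries k deg} {p : ℤ} (hF : HasParity F p) (G : SuperSeries k deg)
    (l : List J) :
    iterD l (F * G) = splitSum deg p l fun B B' => iterD B F * iterD B' G := by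
  induction l with
  | nil => rfl
  | cons x l ih =>
    change partialD x (iterD l (F * G)) = _
    rw [ih, splitSum]
    refine (splitSum_map deg (derivHom x).toAddMonoidHom p l _).trans ?_
    congr; funext B B'
    exact partialD_mul x (hF.iterD B) _

theorem coeff_mul_zero (F G : SuperSeries k deg) : coeff (F * G) 0 = coeff F 0 * coeff G 0 := by
  rw [coeff_mul _ _ admissible_zero]
  simp [monoSign_eq, pairing_zero_left]

theorem derivAt_mul {F : SuperSeries k deg} {p : ℤ} (hF : HasParity F p) (G : SuperSeries k deg)
    (l : List J) :
    derivAt l (F * G) = splitSum deg p l fun B B' => derivAt B F * derivAt B' G := by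
  rw [derivAt, iterD_mul hF]
  refine (splitSum_map deg (coeffHom 0 : SuperSeries k deg →ₗ[k] k).toAddMonoidHom p l _).trans ?_
  congr; funext B B'
  exact coeff_mul_zero _ _

/-- Coefficients are iterated derivatives, up to nonzero factors. -/
theorem exists_derivAt_eq {a : J →₀ ℕ} (ha : Admissible deg a) :
    ∃ (l : List J) (u : k), u ≠ 0 ∧ wordDeg deg l = monoDeg deg a ∧
      ∀ F : SuperSeries k deg, derivAt l F = u * coeff F a := by
  induction hn : a.degree generalizing a with
  | zero =>
    obtain rfl := (Finsupp.degree_eq_zero_iff a).1 hn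
    exact ⟨[], 1, one_ne_zero, by simp [monoDeg], fun F => (one_mul _).symm⟩
  | succ n ih =>
    have h0 : a ≠ 0 := by rintro rfl; simp at hn
    obtain ⟨α, hα⟩ := Finsupp.ne_iff.1 h0
    have e : a - Finsupp.single α 1 + Finsupp.single α 1 = a :=
      tsub_add_cancel_of_le (Finsupp.single_le_iff.2 (Nat.one_le_iff_ne_zero.2 hα))
    set b := a - Finsupp.single α 1
    have hb : Admissible deg b := Admissible.left (e.symm ▸ ha)
    obtain ⟨l, u, hu, hl, h⟩ := ih hb (by
      have := congrArg Finsupp.degree e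
      simp at this
      omega)
    -- The innermost derivative ∂_α shifts the exponent from b to a = b + α and contributes ±(b α +
    -- 1), nonzero in characteristic zero.
    refine ⟨l ++ [α], u * ((((deg α * lowDeg deg α b).negOnePow : ℤˣ) : ℤ) : k) *
      ((b α + 1 : ℕ) : k),
      ?_, ?_, ?_⟩
    · have h1 : ((b α + 1 : ℕ) : k) ≠ 0 := Nat.cast_ne_zero.2 (Nat.succ_ne_zero _)
      have h2 : ((((deg α * lowDeg deg α b).negOnePow : ℤˣ) : ℤ) : k) ≠ 0 := by
        rcases Int.units_eq_one_or (deg α * lowDeg deg α b).negOnePow with h | h <;> simp [h]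
      exact mul_ne_zero (mul_ne_zero hu h2) h1
    · rw [← e, monoDeg_add, monoDeg_single, wordDeg_append, hl]; simp
    · intro F
      rw [derivAt, iterD_append_singleton]
      refine (h _).trans ?_
      rw [coeff_partialD α F hb, units_smul_eq (k := k), e, smul_eq_mul]
      ring

theorem ext_derivAt {F G : SuperSeries k deg} (h : ∀ l, derivAt l F = derivAt l G) : F = G :=
  ext_coeff fun a ha => by
    obtain ⟨l, u, hu, -, hl⟩ := exists_derivAt_eq (k := k) ha
    have := h l
    rw [hl, hl] at this
    exact mul_left_cancel₀ hu this

/-- A coefficient is, up to a nonzero factor, a value of f at a word with the degree of the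
monomial. -/
theorem hasParity_ofTensors (f : List J → k) (hf : GradedSymm deg f) (p : ℤ)
    (h : ∀ l, f l ≠ 0 → Even (wordDeg deg l - p)) :
    HasParity (ofTensors (fun _ ρ => f (List.ofFn ρ)) : SuperSeries k deg) p := by
  intro a ha
  have hadm : Admissible deg a := by
    by_contra h; exact ha (coeff_of_not_admissible _ h)
  obtain ⟨l, u, hu, hl, h'⟩ := exists_derivAt_eq (k := k) hadm
  rw [← hl]
  apply h
  rw [← derivAt_ofTensors l f hf, h']
  exact mul_ne_zero hu ha

theorem derivAt_sum {κ : Type*} (l : List J) (s : Finset κ) (F : κ → SuperSeries k deg) :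
    derivAt l (∑ i ∈ s, F i) = ∑ i ∈ s, derivAt l (F i) := by
  simp only [← derivAtHom_apply, map_sum]

/-- A linear system whose matrix is the identity at the origin has only the trivial solution. -/
theorem eq_zero_of_sum_mul_eq_zero (G : J → J → SuperSeries k deg)
    (hG : ∀ ρ σ, coeff (G ρ σ) 0 = if ρ = σ then 1 else 0) (R : J → SuperSeries k deg)
    (h : ∀ σ, ∑ ρ, R ρ * G ρ σ = 0) (σ : J) : R σ = 0 := by
  refine ext_coeff fun a ha => ?_
  rw [coeff_zero]
  induction hn : a.degree using Nat.strong_induction_on generalizing a σ with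
  | _ n ih =>
    subst hn
    have e := congrArg (fun F => coeff F a) (h σ)
    simp only [coeff_sum, coeff_mul _ _ ha, coeff_zero] at e
    -- By induction R has no coefficients of lower total degree, so only the constant term of G
    -- contributes.
    have e' : ∀ ρ, ∑ p ∈ HasAntidiagonal.antidiagonal a, monoSign deg p.1 p.2 •
        (coeff (R ρ) p.1 * coeff (G ρ σ) p.2) = if ρ = σ then coeff (R σ) a else 0 := by
      intro ρ
      rw [sum_eq_single (a, 0)]
      · rw [monoSign_eq, pairing_zero_right, hG]
        split_ifs with h
        · simp [h]
        · simp
      · rintro ⟨b, c⟩ hbc hne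
        rw [HasAntidiagonal.mem_antidiagonal] at hbc
        have hc : c ≠ 0 := by
          rintro rfl
          apply hne
          simpa using hbc
        have hlt : b.degree < a.degree := by
          rw [← hbc, map_add]
          simp only
          have : c.degree ≠ 0 := fun h => hc ((Finsupp.degree_eq_zero_iff c).1 h)
          omega
        simp only
        rw [ih b.degree hlt ρ b (Admissible.left (hbc ▸ ha)) rfl, zero_mul, smul_zero]
      · simp
    simpa [e'] using e

end SuperSeries

end SuperSeriesTensors

/-! ### Flat connections from correlation algebras -/

section Flatness

variable {J : Type*} [Fintype J] [LinearOrder J] {k : Type*} [Field k] {deg : J → ℤ} {o : J}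

attribute [local instance] SuperSeries.module SuperSeries.nonUnitalRing

/-- Structure constants `M` of a correlation algebra with respect to a homogeneous basis whose
element of index `o` is the unit, and the structure constants `m` of the associated operators. -/
structure IsCorrelationConstants (deg : J → ℤ) (o : J) (M m : List J → J → k) : Prop where
  deg_unit : deg o = 0
  symm : ∀ σ, GradedSymm deg fun l => M l σ
  single : ∀ α σ, M [α] σ = if α = σ then 1 else 0
  unit : ∀ l, l ≠ [] → ∀ σ, M (l ++ [o]) σ = M l σ
  degree : ∀ l α β ρ, m (l ++ [α, β]) ρ ≠ 0 → wordDeg deg l + deg α + deg β = deg ρ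
  recursion : ∀ l α β σ, M (l ++ [α, β]) σ = splitSum deg 0 l fun pre B =>
    ∑ ρ, m (B ++ [α, β]) ρ * M (pre ++ [ρ]) σ

namespace IsCorrelationConstants

open SuperSeries

variable {M m : List J → J → k} (h : IsCorrelationConstants deg o M m)
include h

/-- The recursion, solved for the term with empty `pre`, writes m as M minus terms with strictly
shorter blocks. Truncating m by length makes the induction hypothesis a symmetry statement about all
words, as `splitSum_swap` requires. -/
theorem symm_primitive (α β γ : J) : GradedSymm deg fun l => m (l ++ [α, β]) γ := by
  have key : ∀ (n : ℕ) (γ : J),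
      GradedSymm deg fun l => if l.length < n then m (l ++ [α, β]) γ else 0 := by
    intro n
    induction n with
    | zero => intro γ l x y l'; simp
    | succ n ih =>
      intro σ
      let H : List J → List J → k := fun pre B =>
        ∑ ρ, (if B.length < n then m (B ++ [α, β]) ρ else 0) * M (pre ++ [ρ]) σ
      have hH : GradedSymm deg fun l => splitSum deg 0 l H := by
        intro l x y l'
        refine splitSum_swap deg 0 H ?_ ?_ l x y l'
        · intro b x y b' B
          simp only [H, smul_sum]
          refine sum_congr rfl fun ρ _ => ?_
          have e := (h.symm σ).append [ρ] b x y b'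
          beta_reduce at e
          rw [e, mul_smul_comm]
        · intro pre b x y b'
          simp only [H, smul_sum]
          refine sum_congr rfl fun ρ _ => ?_
          have e := ih ρ b x y b'
          beta_reduce at e
          rw [e, smul_mul_assoc]
      have e : ∀ l, l.length = n →
          m (l ++ [α, β]) σ = M (l ++ [α, β]) σ - splitSum deg 0 l H := by
        intro l hl
        rw [eq_sub_iff_add_eq, h.recursion,
          ← splitSum_ite_isEmpty deg (fun l => m (l ++ [α, β]) σ), ← splitSum_add]
        refine splitSum_congr_length deg 0 l _ _ fun pre B hB => ?_
        cases pre with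
        | nil =>
          -- An empty first part leaves the full-length value of m, which the truncation removes
          -- from H.
          have : ¬ B.length < n := by simp at hB; omega
          simp [H, this, h.single]
        | cons x pre =>
          have : B.length < n := by simp at hB; omega
          simp [H, this]
      intro l x y l'
      have hl : (l ++ x :: y :: l').length = (l ++ y :: x :: l').length := by simp
      rcases lt_trichotomy (l ++ x :: y :: l').length n with hn | hn | hn
      · have := ih σ l x y l'
        simp only [hl] at this hn ⊢
        rwa [if_pos (hn.trans (Nat.lt_succ_self n)), if_pos (hn.trans (Nat.lt_succ_self n)),
          ← if_pos (c := (l ++ y :: x :: l').length < n) (t := m (l ++ x :: y :: l' ++ [α, β]) σ)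
            (e := 0) hn,
          ← if_pos (c := (l ++ y :: x :: l').length < n) (t := m (l ++ y :: x :: l' ++ [α, β]) σ)
            (e := 0) hn]
      · have hn' := hl.symm.trans hn
        simp only [hn, hn', Nat.lt_succ_self, if_true]
        have e₁ := hH l x y l'
        have e₂ := (h.symm σ).append [α, β] l x y l'
        beta_reduce at e₁ e₂
        rw [e _ hn, e _ hn', smul_sub, e₁, e₂]
      · have hn' : n < (l ++ y :: x :: l').length := hl ▸ hn
        have h1 : ¬ (l ++ x :: y :: l').length < n + 1 := by omega
        have h2 : ¬ (l ++ y :: x :: l').length < n + 1 := by omega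
        simp only [h1, h2, if_false, smul_zero]
  intro l x y l'
  have := key ((l ++ x :: y :: l').length + 1) γ l x y l'
  simpa using this

end IsCorrelationConstants

/-- The connection with the given structure constants. -/
noncomputable def connectionSeries (deg : J → ℤ) (m : List J → J → k) (α β γ : J) :
    SuperSeries k deg :=
  SuperSeries.ofTensors fun _ ρ => m (List.ofFn ρ ++ [α, β]) γ

/-- The first derivatives of the generating functions of the given structure constants. -/
noncomputable def frameSeries (deg : J → ℤ) (M : List J → J → k) (ρ σ : J) : SuperSeries k deg :=
  SuperSeries.ofTensors fun _ w => M (List.ofFn w ++ [ρ]) σ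

namespace SuperSeries

variable [CharZero k]

theorem derivAt_smul (l : List J) (c : k) (F : SuperSeries k deg) :
    derivAt l (c • F) = c * derivAt l F := by
  simp only [← derivAtHom_apply, map_smul, smul_eq_mul]

theorem derivAt_add (l : List J) (F G : SuperSeries k deg) :
    derivAt l (F + G) = derivAt l F + derivAt l G := by
  simp only [← derivAtHom_apply, map_add]

theorem derivAt_units_smul (l : List J) (u : ℤˣ) (F : SuperSeries k deg) :
    derivAt l (u • F) = u • derivAt l F := by
  rw [units_smul_eq (k := k), derivAt_smul, units_smul_eq (k := k), smul_eq_mul]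

theorem derivAt_one (l : List J) :
    derivAt l (1 : SuperSeries k deg) = if l = [] then 1 else 0 := by
  induction l using List.reverseRecOn with
  | nil => exact coeff_one_zero
  | append_singleton l x _ =>
    rw [derivAt, iterD_append_singleton, partialD_one]
    change derivAt l 0 = _
    rw [← derivAtHom_apply, map_zero, if_neg (by simp)]

/-- Each derivative appends a letter, so commutation amounts to exchanging the last two letters of
the word. -/
theorem partialD_partialD_ofTensors (α β : J) (f : List J → k) (hf : GradedSymm deg f) :
    partialD α (partialD β (ofTensors (fun _ ρ => f (List.ofFn ρ)) : SuperSeries k deg)) =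
      (deg α * deg β).negOnePow •
        partialD β (partialD α (ofTensors fun _ ρ => f (List.ofFn ρ))) := by
  rw [partialD_ofTensors β f hf, partialD_ofTensors α f hf,
    partialD_ofTensors α (fun l => f (l ++ [β])) (hf.append [β]),
    partialD_ofTensors β (fun l => f (l ++ [α])) (hf.append [α])]
  refine ext_derivAt fun l => ?_
  rw [derivAt_units_smul,
    derivAt_ofTensors l (fun l => f (l ++ [α] ++ [β])) ((hf.append [β]).append [α]),
    derivAt_ofTensors l (fun l => f (l ++ [β] ++ [α])) ((hf.append [α]).append [β])]
  simpa using hf l α β []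

end SuperSeries

namespace IsCorrelationConstants

open SuperSeries

variable [CharZero k] {M m : List J → J → k} (h : IsCorrelationConstants deg o M m)
include h

theorem derivAt_frame (ρ σ : J) (l : List J) :
    derivAt l (frameSeries deg M ρ σ) = M (l ++ [ρ]) σ :=
  derivAt_ofTensors l (fun l => M (l ++ [ρ]) σ) ((h.symm σ).append [ρ])

theorem partialD_frame (α β σ : J) : partialD α (frameSeries deg M β σ) =
    ofTensors fun _ w => M (List.ofFn w ++ [α] ++ [β]) σ :=
  partialD_ofTensors α (fun l => M (l ++ [β]) σ) ((h.symm σ).append [β])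

theorem derivAt_partialD_frame (α β σ : J) (l : List J) :
    derivAt l (partialD α (frameSeries deg M β σ)) = M (l ++ [α, β]) σ := by
  rw [h.partialD_frame,
    derivAt_ofTensors l (fun l => M (l ++ [α] ++ [β]) σ) (((h.symm σ).append [β]).append [α])]
  simp

theorem coeff_frame (ρ σ : J) :
    coeff (frameSeries deg M ρ σ) 0 = if ρ = σ then 1 else 0 := by
  rw [← h.single]
  exact h.derivAt_frame ρ σ []

theorem hasParity_connection (α β ρ : J) :
    HasParity (connectionSeries deg m α β ρ) (deg α + deg β - deg ρ) := by
  refine hasParity_ofTensors (fun l => m (l ++ [α, β]) ρ) (h.symm_primitive α β ρ) _ fun l hl => ?_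
  rw [← h.degree l α β ρ hl]
  ring_nf
  simp

/-- The structure equation: the second derivatives of the generating functions. -/
theorem partialD_frame_eq (α β σ : J) : partialD α (frameSeries deg M β σ) =
    ∑ ρ, connectionSeries deg m α β ρ * frameSeries deg M ρ σ := by
  refine ext_derivAt fun l => ?_
  rw [h.derivAt_partialD_frame, derivAt_sum, h.recursion, splitSum_sum]
  refine sum_congr rfl fun ρ _ => ?_
  -- Bringing the letters of A behind those of the frame costs the sign exponent |B'|(p + |B|) with
  -- p = |α| + |β| - |ρ|. Where m does not vanish, p + |B| = 0, so no sign remains and the recursion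
  -- is recovered.
  rw [derivAt_mul (h.hasParity_connection α β ρ),
    splitSum_eq_splitSum_zero deg (deg α + deg β - deg ρ)]
  congr; funext B' B
  have e : derivAt B (connectionSeries deg m α β ρ) = m (B ++ [α, β]) ρ :=
    derivAt_ofTensors B (fun l => m (l ++ [α, β]) ρ) (h.symm_primitive α β ρ)
  rw [e, h.derivAt_frame]
  by_cases h0 : m (B ++ [α, β]) ρ = 0
  · simp [h0]
  · rw [← h.degree B α β ρ h0]
    ring_nf
    simp

/-- The frame is the identity matrix at the origin, hence right-cancellable; identities for the
connection are all proved after multiplication by it. -/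
theorem eq_of_sum_mul_frame {F G : J → SuperSeries k deg}
    (hFG : ∀ σ, ∑ ρ, F ρ * frameSeries deg M ρ σ = ∑ ρ, G ρ * frameSeries deg M ρ σ) (σ : J) :
    F σ = G σ := by
  rw [← sub_eq_zero]
  refine eq_zero_of_sum_mul_eq_zero (frameSeries deg M) h.coeff_frame (fun ρ => F ρ - G ρ)
    (fun σ => ?_) σ
  simp only [sub_mul, sum_sub_distrib, hFG, sub_self]

/-- After multiplication by the frame this is ∂_o G_β = G_β: the unit, of degree 0, moves to the end
of the word and is dropped. -/
theorem connection_unit (β γ : J) :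
    connectionSeries deg m o β γ = if β = γ then 1 else 0 := by
  refine h.eq_of_sum_mul_frame (F := fun γ => connectionSeries deg m o β γ)
    (G := fun γ => if β = γ then 1 else 0) (fun σ => ?_) γ
  rw [← h.partialD_frame_eq]
  simp only [ite_mul, one_mul', zero_mul, sum_ite_eq, mem_univ, if_true]
  refine ext_derivAt fun l => ?_
  rw [h.derivAt_partialD_frame, h.derivAt_frame]
  have e := h.symm σ l o β []
  simp only [h.deg_unit, zero_mul, Int.negOnePow_zero, one_smul] at e
  have e' := h.unit (l ++ [β]) (by simp) σ
  simp only [List.append_assoc, List.singleton_append] at e'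
  rw [e, e']

/-- After multiplication by the frame this is the symmetry of M in its last two letters. -/
theorem connection_symm (α β γ : J) : connectionSeries deg m α β γ =
    (deg α * deg β).negOnePow • connectionSeries deg m β α γ := by
  refine h.eq_of_sum_mul_frame (F := fun γ => connectionSeries deg m α β γ)
    (G := fun γ => (deg α * deg β).negOnePow • connectionSeries deg m β α γ) (fun σ => ?_) γ
  simp only [units_smul_mul, ← smul_sum]
  rw [← h.partialD_frame_eq, ← h.partialD_frame_eq]
  refine ext_derivAt fun l => ?_
  rw [derivAt_units_smul, h.derivAt_partialD_frame, h.derivAt_partialD_frame]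
  exact h.symm σ l α β []

/-- Differentiate the structure equation and substitute it once more. The coefficient of the frame
is one of the two halves of the curvature. -/
theorem partialD_partialD_frame (α β γ σ : J) :
    partialD α (partialD β (frameSeries deg M γ σ)) =
      ∑ τ, (partialD α (connectionSeries deg m β γ τ) +
        ∑ ρ, (deg α * (deg β + deg γ - deg ρ)).negOnePow •
          (connectionSeries deg m β γ ρ * connectionSeries deg m α ρ τ)) *
            frameSeries deg M τ σ := by
  rw [h.partialD_frame_eq β γ, partialD_sum]
  simp only [partialD_mul α (h.hasParity_connection β γ _), h.partialD_frame_eq α, add_mul,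
    sum_add_distrib, sum_mul, mul_sum, units_smul_mul, mul_assoc, smul_sum]
  congr 1
  exact sum_comm

/-- The connection is flat. -/
theorem connection_flat (α β γ σ : J) :
    partialD α (connectionSeries deg m β γ σ) -
      (deg α * deg β).negOnePow • partialD β (connectionSeries deg m α γ σ) +
      ∑ ρ, ((deg α * (deg β + deg γ - deg ρ)).negOnePow •
          (connectionSeries deg m β γ ρ * connectionSeries deg m α ρ σ) -
        (deg α * deg β).negOnePow • (deg β * (deg α + deg γ - deg ρ)).negOnePow •
          (connectionSeries deg m α γ ρ * connectionSeries deg m β ρ σ)) = 0 := by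
  -- The two halves of the curvature agree up to the commutation sign because ∂_α and ∂_β commute,
  -- in the graded sense, on the frame.
  have key := h.eq_of_sum_mul_frame
    (F := fun τ => partialD α (connectionSeries deg m β γ τ) +
        ∑ ρ, (deg α * (deg β + deg γ - deg ρ)).negOnePow •
          (connectionSeries deg m β γ ρ * connectionSeries deg m α ρ τ))
    (G := fun τ => (deg α * deg β).negOnePow • (partialD β (connectionSeries deg m α γ τ) +
        ∑ ρ, (deg β * (deg α + deg γ - deg ρ)).negOnePow •
          (connectionSeries deg m α γ ρ * connectionSeries deg m β ρ τ)))
    (fun σ => by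
      rw [← h.partialD_partialD_frame]
      simp only [units_smul_mul, ← smul_sum]
      rw [← h.partialD_partialD_frame]
      exact partialD_partialD_ofTensors α β (fun l => M (l ++ [γ]) σ) ((h.symm σ).append [γ])) σ
  beta_reduce at key
  rw [sum_sub_distrib, ← smul_sum, sub_add_sub_comm, key, smul_add, sub_self]

/-- The generating function of moments that factor through the correlation algebra satisfies the
differential equations of the connection. -/
theorem generating_function (c : J → k) (hc : c o = 1) (μ : List J → k)
    (hμ : ∀ l, l ≠ [] → μ l = ∑ σ, c σ * M l σ) :
    let Z : SuperSeries k deg :=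
      1 + ofTensors fun _ ρ => if List.ofFn ρ = [] then 0 else μ (List.ofFn ρ)
    (∀ α β, partialD α (partialD β Z) - ∑ γ, connectionSeries deg m α β γ * partialD γ Z = 0) ∧
      partialD o Z - Z = 0 := by
  intro Z
  let f : List J → k := fun l => if l = [] then 0 else μ l
  have hf : GradedSymm deg f := by
    intro l x y l'
    have e : ∀ x y, f (l ++ x :: y :: l') = ∑ σ, c σ * M (l ++ x :: y :: l') σ := by
      intro x y
      simp [f, hμ]
    rw [e, e, smul_sum]
    refine sum_congr rfl fun σ _ => ?_
    have := h.symm σ l x y l'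
    beta_reduce at this
    rw [this, mul_smul_comm]
  have hZ : ∀ β, partialD β Z = ofTensors fun _ ρ => f (List.ofFn ρ ++ [β]) := by
    intro β
    rw [partialD_add, partialD_one, zero_add]
    exact partialD_ofTensors β f hf
  -- The gradient of Z is a combination of frame entries with constant coefficients, so it obeys the
  -- same linear system.
  have hZ' : ∀ β, partialD β Z = ∑ σ, c σ • frameSeries deg M β σ := by
    intro β
    rw [hZ]
    refine ext_derivAt fun l => ?_
    rw [derivAt_ofTensors l (fun l => f (l ++ [β])) (hf.append [β]), derivAt_sum]
    simp [f, hμ, derivAt_smul, h.derivAt_frame]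
  constructor
  · intro α β
    simp only [hZ', partialD_sum, partialD_smul, h.partialD_frame_eq α β, mul_sum,
      mul_smul_right, smul_sum]
    rw [sum_comm, sub_self]
  · rw [sub_eq_zero, hZ]
    refine ext_derivAt fun l => ?_
    rw [derivAt_ofTensors l (fun l => f (l ++ [o])) (hf.append [o]), derivAt_add, derivAt_one]
    have e : derivAt l (ofTensors (fun _ ρ => if List.ofFn ρ = [] then 0 else μ (List.ofFn ρ)) :
        SuperSeries k deg) = f l := derivAt_ofTensors l f hf
    rw [e]
    -- At the origin the summand 1 of Z is matched by c_o = 1; at nonempty words the unit axiom of M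
    -- suffices.
    by_cases hl : l = []
    · subst hl
      simp [f, hμ, h.single, hc]
    · simp [f, hμ, hl, h.unit l hl]

end IsCorrelationConstants

end Flatness

/-! ### Operators on words of homogeneous elements -/

section HomogeneousWords

set_option linter.unusedSectionVars false

variable {k V W : Type*} [Field k] [AddCommGroup V] [Module k V] [AddCommGroup W] [Module k W]

/-- Homogeneous elements labelled by a degree. -/
abbrev Homog (gr : ℤ → Submodule k V) := {a : ℤ × V // a.2 ∈ gr a.1}

/-- The degree of a labelled homogeneous element. -/
def Homog.deg {gr : ℤ → Submodule k V} (a : Homog gr) : ℤ := a.1.1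

/-- The value of a family of operators at a word of homogeneous elements. -/
def evalWord {gr : ℤ → Submodule k V} (F : Op V W) (l : List (Homog gr)) : W :=
  onWord F (l.map Subtype.val)

variable {gr : ℤ → Submodule k V}

theorem evalWord_ofFn (F : Op V W) {n : ℕ} (z : Fin n → Homog gr) :
    evalWord F (List.ofFn z) = F n (fun i => (z i).deg) (fun i => (z i).1.2) := by
  rw [evalWord, List.map_ofFn, onWord_ofFn]
  rfl

variable (k) in
/-- Operators that are linear in each argument when the degrees are fixed. -/
def SlotLinear (F : Op V W) : Prop := ∀ n d (x : Fin n → V) j, ∃ f : V →ₗ[k] W,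
  ∀ z, F n d (Function.update x j z) = f z

theorem MultiOp.slotLinear (F : MultiOp k V W) : SlotLinear k F.toOp :=
  fun n _ x j => ⟨(F n).toLinearMap x j, fun _ => rfl⟩

theorem SlotLinear.onWord {F : Op V W} (hF : SlotLinear k F) (l : List (ℤ × V)) (a : ℤ)
    (l' : List (ℤ × V)) : ∃ f : V →ₗ[k] W, ∀ v, onWord F (l ++ (a, v) :: l') = f v := by
  set L := l ++ (a, 0) :: l' with hL
  have hl : l.length < L.length := by simp [hL]
  obtain ⟨f, hf⟩ := hF L.length (fun i => (L.get i).1) (fun i => (L.get i).2) ⟨l.length, hl⟩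
  refine ⟨f, fun v => ?_⟩
  rw [← hf, ← onWord_ofFn F fun i => ((L.get i).1,
    Function.update (fun i => (L.get i).2) ⟨l.length, hl⟩ v i)]
  congr 1
  refine List.ext_getElem (by simp [hL, Nat.add_assoc]) fun i h₁ h₂ => ?_
  have hi : i < L.length := by simpa using h₂
  rw [List.getElem_ofFn]
  change _ = (L[i].1,
    Function.update (fun i : Fin L.length => (L.get i).2) ⟨l.length, hl⟩ v ⟨i, hi⟩)
  simp only [List.get_eq_getElem, Function.update_apply, Fin.ext_iff, hL,
    List.getElem_append, List.getElem_cons]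
  split_ifs <;> first | rfl | omega

/-- An adjacent transposition has exactly one inversion, so only one factor of the double product is
nontrivial. -/
theorem permSign_swap {n : ℕ} (d : Fin n → ℤ) (i : ℕ) (hi : i + 1 < n) :
    permSign d (Equiv.swap ⟨i, by omega⟩ ⟨i + 1, hi⟩) =
      (d ⟨i, by omega⟩ * d ⟨i + 1, hi⟩).negOnePow := by
  have key : ∀ a b : Fin n, (a < b ∧ Equiv.swap (⟨i, by omega⟩ : Fin n) ⟨i + 1, hi⟩ b <
      Equiv.swap (⟨i, by omega⟩ : Fin n) ⟨i + 1, hi⟩ a) ↔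
        a = ⟨i, by omega⟩ ∧ b = ⟨i + 1, hi⟩ := by
    intro a b
    simp only [Equiv.swap_apply_def, Fin.ext_iff, Fin.lt_def]
    split_ifs <;> (try dsimp only) <;> omega
  unfold permSign
  rw [prod_eq_single ⟨i, by omega⟩, prod_eq_single ⟨i + 1, hi⟩]
  · rw [if_pos ((key _ _).2 ⟨rfl, rfl⟩), Equiv.swap_apply_left, Equiv.swap_apply_right, mul_comm]
  · intro b _ hb
    rw [if_neg fun h => hb ((key _ _).1 h).2]
  · simp
  · intro a _ ha
    exact prod_eq_one fun b _ => if_neg fun h => ha ((key _ _).1 h).1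
  · simp

theorem IsGradedSymmetric.gradedSymm {gr' : ℤ → Submodule k W} {p : ℤ} {F : MultiOp k V W}
    (hF : IsGradedSymmetric gr gr' p F) :
    GradedSymm Homog.deg fun l : List (Homog gr) => evalWord F.toOp l := by
  intro l x y l'
  set L := l ++ x :: y :: l' with hL
  have hl : l.length + 1 < L.length := by simp [hL]
  have e : l ++ y :: x :: l' = List.ofFn
      (L.get ∘ Equiv.swap ⟨l.length, by omega⟩ ⟨l.length + 1, hl⟩) := by
    refine List.ext_getElem (by simp [hL, Nat.add_assoc]) fun i h₁ h₂ => ?_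
    simp only [List.getElem_ofFn, Function.comp_apply, List.get_eq_getElem,
      Equiv.swap_apply_def, Fin.ext_iff]
    split_ifs with h h'
    · subst h; simp [hL]
    · subst h'; simp [hL]
    · simp only [hL, List.getElem_append, List.getElem_cons]
      split_ifs <;> first | rfl | omega
  have h0 := hF.symm L.length (by omega) (fun i => (L.get i).deg) (fun i => (L.get i).1.2)
    (fun i => (L.get i).2) (Equiv.swap ⟨l.length, by omega⟩ ⟨l.length + 1, hl⟩)
  rw [permSign_swap] at h0
  beta_reduce
  rw [e, evalWord_ofFn]
  conv_lhs => rw [← List.ofFn_get L, evalWord_ofFn]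
  refine h0.trans ?_
  congr 2
  simp [hL]

theorem GradedSymm.move {ι : Type*} {deg : ι → ℤ} {f : List ι → W} (hf : GradedSymm deg f)
    (l : List ι) (x : ι) (l' : List ι) :
    f (l ++ x :: l') = (wordDeg deg l * deg x).negOnePow • f (x :: (l ++ l')) := by
  induction l using List.reverseRecOn generalizing l' with
  | nil => simp
  | append_singleton l y ih =>
    have e := hf l y x l'
    rw [List.append_assoc, List.singleton_append, e, ih, smul_smul, ← Int.negOnePow_add]
    simp only [List.append_assoc, List.singleton_append, wordDeg_append, wordDeg_cons,
      wordDeg_nil]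
    ring_nf

end HomogeneousWords

/-! ### From recursions over ordered partitions to sums over blocks -/

section InsertionRecursion

variable {V : Type*} [AddCommGroup V]

theorem blockSum_ite_nil {ι : Type*} (deg : ι → ℤ) (p : ℤ) (F : List ι → V) (l : List ι)
    (hl : l ≠ []) : blockSum deg p l (fun pre B post =>
      if pre.length + post.length = 0 then F B else 0) = F l := by
  induction l generalizing F with
  | nil => exact absurd rfl hl
  | cons x l ih =>
    rw [blockSum]
    rcases eq_or_ne l [] with rfl | h
    · simp [blockSum]
    · have := ih (fun B => F (x :: B)) h
      simp_all

open Classical in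
/-- A recursion solved for the term of the indiscrete partition, as a sum over blocks. -/
theorem eq_blockSum_of_recursion (M L : Op V V) (hM : ∀ d x, M 1 d x = x 0) {n : ℕ} (hn : 1 ≤ n)
    (d : Fin n → ℤ) (x : Fin n → V) (p q : ℤ) (P : List (Fin n) → Prop)
    (hP : P (List.finRange n)) (w : V)
    (h : L n d x = w - ∑ c : OrderedFinpartition n, ∑ i : Fin c.length,
      if (OnlyBlock c i ∧ P (List.ofFn (c.emb i))) ∧ c.length ≠ 1 then
        (partSign c d * (p * ∑ j ∈ univ.filter (· < i), blockDeg c d j).negOnePow) •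
          M c.length (insertDeg c i d q) (insertBlock c i x (onBlock L c d x i)) else 0) :
    w = blockSum d p (List.finRange n) fun pre B post => if P B then
      onWord M (pre.map (fun j => (d j, x j)) ++
        (wordDeg d B + q, onWord L (B.map fun j => (d j, x j))) ::
          post.map (fun j => (d j, x j))) else 0 := by
  set y : Fin n → ℤ × V := fun j => (d j, x j)
  set Q : List (Fin n) → List (Fin n) → List (Fin n) → V := fun pre B post => if P B then
      onWord M (pre.map y ++ (wordDeg d B + q, onWord L (B.map y)) :: post.map y) else 0 with hQ
  -- The indiscrete partition is the term with no letters before or after the block; M_1 = id strips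
  -- the outer operator from it.
  have hL : L n d x = blockSum d p (List.finRange n)
      (fun pre B post => if pre.length + post.length = 0 then Q pre B post else 0) := by
    have e : (fun pre B post => if pre.length + post.length = 0 then Q pre B post else 0) =
        fun pre B post => if pre.length + post.length = 0 then Q [] B [] else 0 := by
      funext pre B post
      split_ifs with h0
      · rw [List.length_eq_zero_iff.1 (by omega : pre.length = 0),
          List.length_eq_zero_iff.1 (by omega : post.length = 0)]
      · rfl
    rw [e, blockSum_ite_nil d p (fun B => Q [] B []) _ (by
      rw [ne_eq, ← List.length_eq_zero_iff, List.length_finRange]; omega)]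
    simp only [hQ, hP, if_true]
    refine Eq.trans ?_ (hM _ _).symm
    have := onWord_ofFn L y
    rw [← Function.comp_id y, ← List.map_ofFn, List.ofFn_id] at this
    exact this.symm
  have hR := sum_onlyBlock d p
    (fun pre B post => if pre.length + post.length = 0 then 0 else Q pre B post)
    (fun c i => if P (List.ofFn (c.emb i)) ∧ c.length ≠ 1 then
      M c.length (insertDeg c i d q) (insertBlock c i x (onBlock L c d x i)) else 0)
    (fun c i hi => by
      have hlen := preBlock_postBlock_length c i hi
      have hc : c.length = 1 ↔ (preBlock c i).length + (postBlock c i).length = 0 := by omega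
      rw [insertBlock_eq c i hi d x q _ M]
      simp only [ne_eq, hc, hQ]
      have e : onBlock L c d x i = onWord L ((List.ofFn (c.emb i)).map y) := by
        rw [List.map_ofFn, onWord_ofFn]; rfl
      rw [e]
      by_cases h1 : (preBlock c i).length + (postBlock c i).length = 0 <;>
        by_cases h2 : P (List.ofFn (c.emb i)) <;>
          simp only [h1, h2, not_true_eq_false, not_false_eq_true, and_true, and_false, if_true,
            if_false, ite_self]
      rfl)
  have hw : w = L n d x + _ := (sub_eq_iff_eq_add.1 h.symm)
  rw [hw]
  trans L n d x + blockSum d p (List.finRange n)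
    (fun pre B post => if pre.length + post.length = 0 then 0 else Q pre B post)
  · rw [← hR]
    congr 1
    refine sum_congr rfl fun c _ => sum_congr rfl fun i _ => ?_
    by_cases h1 : OnlyBlock c i <;> by_cases h2 : P (List.ofFn (c.emb i)) <;>
      by_cases h3 : c.length = 1 <;> simp [h1, h2, h3]
  · rw [hL, ← blockSum_add]
    congr 1
    funext pre B post
    split_ifs <;> simp

theorem mul_negOnePow_zero {n : ℕ} (c : OrderedFinpartition n) (d : Fin n → ℤ) (s : ℤ) :
    partSign c d * (0 * s).negOnePow = partSign c d := by simp

end InsertionRecursion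

/-! ### Descendants and primitive operators on words -/

section Recursions

variable {V : Type*} [AddCommGroup V]

theorem ofFn_snoc_snoc {A : Type*} {n : ℕ} (z : Fin n → A) (a b : A) :
    List.ofFn (Fin.snoc (α := fun _ => A) (Fin.snoc (α := fun _ => A) z a) b) =
      List.ofFn z ++ [a, b] := by
  rw [List.ofFn_succ', List.ofFn_succ']
  simp only [Fin.snoc_castSucc, Fin.snoc_last, List.concat_eq_append, List.append_assoc,
    List.singleton_append]

/-- The descendant operators have degree 1, which enters both as the sign for passing preceding
letters and as the shift of the inserted degree. The test for emptiness is harmless, since blocks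
are nonempty. -/
theorem map_onWord_eq_blockSum (M : Op V V) (hM : ∀ d x, M 1 d x = x 0) (K : V → V)
    (l : List (ℤ × V)) (hl : l ≠ []) : K (onWord M l) =
      blockSum Prod.fst 1 l fun pre B post => if B.isEmpty then 0 else
        onWord M (pre ++ (wordDeg Prod.fst B + 1, onWord (descendant M K) B) :: post) := by
  classical
  have hn : 1 ≤ l.length := List.length_pos_iff.2 hl
  have key := eq_blockSum_of_recursion M (descendant M K) hM hn (fun i => (l.get i).1)
    (fun i => (l.get i).2) 1 1 (· ≠ []) (by
      rw [ne_eq, ← List.length_eq_zero_iff, List.length_finRange]; omega)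
    (K (onWord M l)) (by
      rw [descendant]
      congr 1
      refine sum_congr rfl fun c _ => sum_congr rfl fun i _ => ?_
      have h : List.ofFn (c.emb i) ≠ [] := by
        rw [ne_eq, ← List.length_eq_zero_iff, List.length_ofFn]
        exact (c.partSize_pos i).ne'
      simp only [h, ne_eq, not_false_eq_true, and_true, one_mul]
      by_cases h1 : OnlyBlock c i ∧ ¬ c.length = 1
      · rw [dif_pos h1, if_pos h1]; rfl
      · rw [dif_neg h1, if_neg h1])
  rw [key]
  conv_rhs => rw [← List.map_get_finRange l, blockSum_map_word]
  congr 1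
  funext pre B post
  cases B with
  | nil => simp
  | cons j B =>
    simp only [ne_eq, reduceCtorEq, not_false_eq_true, if_true, List.map_cons, List.isEmpty_cons,
      wordDeg_map, Bool.false_eq_true, if_false, wordDeg_cons]
    rfl

/-- The distinguished block contains the last letter, so it comes last and nothing follows it.
Choosing the rest of it is a splitting of l; the operators have degree 0, so no further sign occurs.
-/
theorem onWord_append_pair (M : Op V V) (hM : ∀ d x, M 1 d x = x 0) (l : List (ℤ × V))
    (a b : ℤ × V) : onWord M (l ++ [a, b]) =
      splitSum Prod.fst 0 l fun pre B => onWord M (pre ++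
        [(wordDeg Prod.fst (B ++ [a, b]), onWord (primitive M) (B ++ [a, b]))]) := by
  classical
  set z : Fin (l.length + 2) → ℤ × V :=
    Fin.snoc (α := fun _ => ℤ × V) (Fin.snoc (α := fun _ => ℤ × V) l.get a) b with hz
  have hofFn : List.ofFn z = l ++ [a, b] := by rw [hz, ofFn_snoc_snoc, List.ofFn_get]
  set p : Fin (l.length + 2) := (Fin.last l.length).castSucc
  set q : Fin (l.length + 2) := Fin.last (l.length + 1)
  have key := eq_blockSum_of_recursion M (primitive M) hM (by omega : 1 ≤ l.length + 2)
    (fun i => (z i).1) (fun i => (z i).2) 0 0 (fun B => p ∈ B ∧ q ∈ B)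
    (by simp) (M _ (fun i => (z i).1) (fun i => (z i).2)) (by
      rw [primitive]
      congr 1
      refine sum_congr rfl fun c _ => sum_congr rfl fun i _ => ?_
      have h : (∃ a b, (c.emb i a : ℕ) + 2 = l.length + 2 ∧ (c.emb i b : ℕ) + 1 = l.length + 2) ↔
          p ∈ List.ofFn (c.emb i) ∧ q ∈ List.ofFn (c.emb i) := by
        simp only [List.mem_ofFn', Set.mem_range, Fin.ext_iff, p, q, Fin.val_castSucc, Fin.val_last]
        constructor
        · rintro ⟨a, b, h1, h2⟩
          exact ⟨⟨a, by omega⟩, ⟨b, by omega⟩⟩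
        · rintro ⟨⟨a, h1⟩, ⟨b, h2⟩⟩
          exact ⟨a, b, by omega, by omega⟩
      simp only [h, mul_negOnePow_zero]
      by_cases h1 : (OnlyBlock c i ∧ p ∈ List.ofFn (c.emb i) ∧ q ∈ List.ofFn (c.emb i)) ∧
          c.length ≠ 1
      · rw [dif_pos h1, if_pos h1]; rfl
      · rw [dif_neg h1, if_neg h1])
  have hfin : List.finRange (l.length + 2) =
      (List.finRange l.length).map (fun j => j.castSucc.castSucc) ++ [p, q] := by
    simp [List.finRange_succ_last, p, q]
  have hzl : ∀ j : Fin l.length, z j.castSucc.castSucc = l.get j := by simp [hz]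
  have hza : z p = a := by simp [hz, p]
  have hzb : z q = b := by simp [hz, q]
  rw [← hofFn, onWord_ofFn, key, hfin, blockSum_append_pair _ _ _ _ (by
    rw [← hfin]; exact List.nodup_finRange _) _ (by
    intro pre B post h
    rw [if_neg (by tauto)]), splitSum_map_word]
  conv_rhs => rw [← List.map_get_finRange l, splitSum_map_word]
  have e : ((fun i => (z i).1) ∘ fun j : Fin l.length => j.castSucc.castSucc) =
      Prod.fst ∘ l.get := by
    funext j; simp [hzl]
  have em : ∀ B : List (Fin l.length), List.map (fun j => ((z j).1, (z j).2))
      (B.map fun j => j.castSucc.castSucc) = B.map l.get := by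
    intro B
    simp [List.map_map, Function.comp_def, hzl]
  rw [e]
  congr 1
  funext pre B
  have hmem : p ∈ B.map (fun j => j.castSucc.castSucc) ++ [p, q] ∧
    q ∈ B.map (fun j => j.castSucc.castSucc) ++ [p, q] := by simp
  rw [if_pos hmem, em, List.map_append, em]
  simp only [add_zero, wordDeg_append, wordDeg_map, List.map_cons, List.map_nil, hza, hzb,
    wordDeg_cons, wordDeg_nil]
  congr

end Recursions

/-! ### Degrees of the recursively defined operators -/

section Homogeneity

variable {k V : Type*} [Field k] [AddCommGroup V] [Module k V] {gr : ℤ → Submodule k V}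

/-- Operators of degree `p`. -/
def IsHomogeneousOp {W : Type*} [AddCommGroup W] [Module k W] (gr : ℤ → Submodule k V)
    (gr' : ℤ → Submodule k W) (p : ℤ) (F : Op V W) : Prop :=
  ∀ n, 1 ≤ n → ∀ (d : Fin n → ℤ) (x : Fin n → V), (∀ i, x i ∈ gr (d i)) →
    F n d x ∈ gr' ((∑ i, d i) + p)

theorem insertBlock_mem {M : Op V V} (hM : IsHomogeneousOp gr gr 0 M) {n : ℕ}
    (c : OrderedFinpartition n) (i : Fin c.length) (hi : OnlyBlock c i) (d : Fin n → ℤ)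
    (x : Fin n → V) (hx : ∀ j, x j ∈ gr (d j)) (q : ℤ) (v : V)
    (hv : v ∈ gr ((∑ r, d (c.emb i r)) + q)) :
    M c.length (insertDeg c i d q) (insertBlock c i x v) ∈ gr ((∑ j, d j) + q) := by
  have h := hM c.length (Nat.one_le_of_lt i.isLt) (insertDeg c i d q) (insertBlock c i x v) ?_
  · have e : ∑ j, insertDeg c i d q j = (∑ j, d j) + q := by
      simp only [insertDeg, sum_add_distrib, sum_ite_eq', mem_univ, if_true, blockDeg]
      rw [c.sum_sigma_eq_sum]
    rwa [e, add_zero] at h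
  · intro j
    rcases eq_or_ne j i with rfl | hj
    · simpa [insertBlock, insertDeg, blockDeg] using hv
    · rw [insertBlock, Function.update_of_ne hj, insertDeg, if_neg hj, add_zero, blockDeg,
        ← wordDeg_ofFn d (c.emb j), show List.ofFn (c.emb j) = _ from
          blocks_eq_singleton c id j ((onlyBlock_iff c i).1 hi j hj)]
      simpa using hx _

theorem descendant_mem {M : Op V V} (hM : IsHomogeneousOp gr gr 0 M) {K : V → V}
    (hK : ∀ i, ∀ x ∈ gr i, K x ∈ gr (i + 1)) : IsHomogeneousOp gr gr 1 (descendant M K) := by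
  intro n
  induction n using Nat.strong_induction_on with
  | _ n ih =>
    intro hn d x hx
    rw [descendant]
    refine sub_mem (by simpa using hK _ _ (hM n hn d x hx))
      (sum_mem fun c _ => sum_mem fun i _ => ?_)
    split_ifs with h
    · have h1 : c.partSize i + c.length = n + 1 := h.1
      have h2 := h.2
      have h3 := i.isLt
      exact Submodule.smul_of_tower_mem _ _ (insertBlock_mem hM c i h.1 d x hx 1 _
        (ih _ (by omega) (c.partSize_pos i) _ _ fun r => hx _))
    · exact zero_mem _

theorem primitive_mem {M : Op V V} (hM : IsHomogeneousOp gr gr 0 M) :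
    IsHomogeneousOp gr gr 0 (primitive M) := by
  intro n
  induction n using Nat.strong_induction_on with
  | _ n ih =>
    intro hn d x hx
    rw [primitive]
    refine sub_mem (hM n hn d x hx) (sum_mem fun c _ => sum_mem fun i _ => ?_)
    split_ifs with h
    · have h1 : c.partSize i + c.length = n + 1 := h.1.1
      have h2 := h.2
      have h3 := i.isLt
      exact Submodule.smul_of_tower_mem _ _ (insertBlock_mem hM c i h.1.1 d x hx 0 _
        (ih _ (by omega) (c.partSize_pos i) _ _ fun r => hx _))
    · exact zero_mem _

theorem IsHomogeneousOp.evalWord_mem {W : Type*} [AddCommGroup W] [Module k W]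
    {gr' : ℤ → Submodule k W} {p : ℤ} {F : Op V W} (hF : IsHomogeneousOp gr gr' p F)
    (l : List (Homog gr)) (hl : l ≠ []) : evalWord F l ∈ gr' (wordDeg Homog.deg l + p) := by
  rw [← List.ofFn_get l, evalWord_ofFn, wordDeg_ofFn]
  exact hF _ (List.length_pos_iff.2 hl) _ _ fun i => (l.get i).2

theorem IsGradedSymmetric.isHomogeneousOp {W : Type*} [AddCommGroup W] [Module k W]
    {gr' : ℤ → Submodule k W} {p : ℤ} {F : MultiOp k V W} (hF : IsGradedSymmetric gr gr' p F) :
    IsHomogeneousOp gr gr' p F.toOp := hF.map_mem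

end Homogeneity

/-! ### Correlation densities -/

section WordImages

variable {k V W V' : Type*} [Field k] [AddCommGroup V] [Module k V] [AddCommGroup W] [Module k W]
  [AddCommGroup V'] [Module k V'] {gr : ℤ → Submodule k V} {gr' : ℤ → Submodule k V'}

/-- The value of operators of degree `p` at a word, as a homogeneous element. -/
noncomputable def wordImage {p : ℤ} {F : Op V V'} (hF : IsHomogeneousOp gr gr' p F)
    (B : List (Homog gr)) : Homog gr' :=
  open Classical in
  -- The value 0 labelled by p keeps the degree formula uniform at the empty word and makes terms
  -- with an empty block vanish by multilinearity.
  if h : B = [] then ⟨(p, 0), zero_mem _⟩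
  else ⟨(wordDeg Homog.deg B + p, evalWord F B), hF.evalWord_mem B h⟩

theorem deg_wordImage {p : ℤ} {F : Op V V'} (hF : IsHomogeneousOp gr gr' p F)
    (B : List (Homog gr)) : (wordImage hF B).deg = wordDeg Homog.deg B + p := by
  unfold wordImage Homog.deg
  split_ifs with h
  · simp [h]
  · rfl

theorem deg_comp_wordImage {F : Op V V'} (hF : IsHomogeneousOp gr gr' 0 F) :
    Homog.deg ∘ wordImage hF = wordDeg Homog.deg := by
  funext B
  simp [deg_wordImage]

theorem wordImage_of_ne_nil {p : ℤ} {F : Op V V'} (hF : IsHomogeneousOp gr gr' p F)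
    {B : List (Homog gr)} (h : B ≠ []) : (wordImage hF B).1.2 = evalWord F B := by
  rw [wordImage, dif_neg h]

theorem wordImage_nil {p : ℤ} {F : Op V V'} (hF : IsHomogeneousOp gr gr' p F) :
    (wordImage hF []).1.2 = 0 := by
  rw [wordImage, dif_pos rfl]

theorem evalWord_composeOp (G : Op V' W) {F : Op V V'} (hF : IsHomogeneousOp gr gr' 0 F)
    (l : List (Homog gr)) : evalWord (composeOp G F) l =
      partSum Homog.deg (fun s => evalWord G (s.map (wordImage hF))) l := by
  conv_lhs => rw [← List.ofFn_get l, evalWord_ofFn]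
  conv_rhs => rw [← List.ofFn_get l]
  rw [← sum_partSign_blocks, composeOp]
  refine sum_congr rfl fun c _ => ?_
  rw [blocks, List.map_ofFn, evalWord_ofFn]
  congr 2
  · funext i
    simp only [Function.comp_apply, deg_wordImage, wordDeg_ofFn, add_zero]
    rfl
  · funext i
    have h : (List.ofFn fun r => l.get (c.emb i r)) ≠ [] := by
      rw [ne_eq, ← List.length_eq_zero_iff, List.length_ofFn]
      exact (c.partSize_pos i).ne'
    rw [Function.comp_apply, wordImage_of_ne_nil hF h, evalWord_ofFn]
    rfl

theorem onWord_toOp (F : MultiOp k V W) (l : List (ℤ × V)) :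
    onWord F.toOp l = onWord F.toOp (l.map fun x => (0, x.2)) := by
  conv_rhs => rw [← List.ofFn_get l, List.map_ofFn, onWord_ofFn]
  rfl

/-- Multilinear operators ignore degree labels, so a single linear map serves all labels in the
slot. -/
theorem MultiOp.evalWord_slot (F : MultiOp k V W) (l l' : List (Homog gr)) :
    ∃ f : V →ₗ[k] W, ∀ x : Homog gr, evalWord F.toOp (l ++ x :: l') = f x.1.2 := by
  obtain ⟨f, hf⟩ := F.slotLinear.onWord ((l.map Subtype.val).map fun x => (0, x.2)) 0
    ((l'.map Subtype.val).map fun x => (0, x.2))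
  refine ⟨f, fun x => ?_⟩
  rw [← hf, evalWord, onWord_toOp, List.map_append, List.map_append]
  rfl

/-- Exchanging blocks is symmetry of G, because F has degree 0 and preserves block degrees;
exchanging letters is symmetry of F, pushed through one linear slot of G. -/
theorem symmOnBlocks_evalWord {G : MultiOp k V' W} {gr'' : ℤ → Submodule k W} {q : ℤ}
    (hG : IsGradedSymmetric gr' gr'' q G) {F : MultiOp k V V'}
    (hF : IsGradedSymmetric gr gr' 0 F) :
    SymmOnBlocks Homog.deg fun s : List (List (Homog gr)) =>
      evalWord G.toOp (s.map (wordImage hF.isHomogeneousOp)) where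
  swap_blocks s B B' s' := by
    have e := hG.gradedSymm (s.map (wordImage hF.isHomogeneousOp))
      (wordImage hF.isHomogeneousOp B) (wordImage hF.isHomogeneousOp B')
      (s'.map (wordImage hF.isHomogeneousOp))
    simpa [deg_wordImage] using e
  swap_letters s b x y b' s' := by
    obtain ⟨f, hf⟩ := G.evalWord_slot (s.map (wordImage hF.isHomogeneousOp))
      (s'.map (wordImage hF.isHomogeneousOp))
    have e := hF.gradedSymm b x y b'
    beta_reduce at e
    simp only [List.map_append, List.map_cons, hf]
    rw [wordImage_of_ne_nil _ (by simp), wordImage_of_ne_nil _ (by simp), e,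
      f.map_smul_of_tower]

theorem evalWord_snoc_eq (F : Op V W) (l : List (Homog gr)) (x : Homog gr) :
    evalWord F (l ++ [x]) = F (l.length + 1)
      (Fin.snoc (α := fun _ => ℤ) (fun i => (l.get i).deg) x.deg)
      (Fin.snoc (α := fun _ => V) (fun i => (l.get i).1.2) x.1.2) := by
  have e : l ++ [x] = List.ofFn (Fin.snoc (α := fun _ => Homog gr) l.get x) := by
    rw [List.ofFn_succ']
    simp
  rw [e, evalWord_ofFn]
  congr 1 <;> funext i <;> refine Fin.lastCases ?_ (fun i => ?_) i <;> simp

end WordImages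

/-! ### The differential of a correlation product -/

namespace HomotopyProbSpace

variable {k C : Type*} [Field k] [AddCommGroup C] [Module k C] (P : HomotopyProbSpace k C)

theorem isHomogeneousOp_ell : IsHomogeneousOp P.gr P.gr 1 P.ell :=
  descendant_mem P.M_symm.isHomogeneousOp P.K_deg

/-- Symmetry of M brings the block carrying ℓ to the front, so the sum over blocks becomes a sum
over splittings. The added term with empty first part is 0 by the convention in `wordImage`. -/
theorem K_evalWord (l : List (Homog P.gr)) (hl : l ≠ []) : P.K (evalWord P.M.toOp l) =
    splitSum Homog.deg 0 l fun B B' =>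
      evalWord P.M.toOp (wordImage P.isHomogeneousOp_ell B :: B') := by
  have hzero : ∀ l' l'', evalWord P.M.toOp (l' ++ wordImage P.isHomogeneousOp_ell [] :: l'') =
      0 := by
    intro l' l''
    obtain ⟨f, hf⟩ := P.M.evalWord_slot (gr := P.gr) l' l''
    rw [hf, wordImage_nil, map_zero]
  have e := map_onWord_eq_blockSum P.M.toOp (fun d x => P.M_one x) P.K (l.map Subtype.val)
    (by simpa using hl)
  rw [blockSum_map_word] at e
  rw [evalWord, e]
  trans blockSum Homog.deg 1 l fun pre B post =>
    evalWord P.M.toOp (pre ++ wordImage P.isHomogeneousOp_ell B :: post)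
  · congr 1
    funext pre B post
    rcases eq_or_ne B [] with rfl | hB
    · rw [hzero]; simp
    · have : (B.map Subtype.val).isEmpty = false := by simpa using hB
      rw [this, evalWord, List.map_append, List.map_cons]
      simp only [wordImage, hB, dif_neg, not_false_eq_true, wordDeg_map]
      rfl
  rw [blockSum_eq_splitSum Homog.deg l _ fun B B' =>
    evalWord P.M.toOp (wordImage P.isHomogeneousOp_ell B :: B')]
  · congr 1
    funext B B'
    cases B with
    | nil => simpa using (hzero [] B').symm
    | cons x B => simp
  · intro pre B post
    have e := P.M_symm.gradedSymm.move pre (wordImage P.isHomogeneousOp_ell B) post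
    beta_reduce at e
    rw [e, deg_wordImage, add_comm]

end HomotopyProbSpace

/-! ### Densities are symmetric, unital and closed -/

namespace CompleteSpace

variable {k C S : Type*} [Field k] [AddCommGroup C] [Module k C] [AddCommGroup S] [Module k S]
  {P : HomotopyProbSpace k C} (X : CompleteSpace P S)

theorem isHomogeneousOp_φ : IsHomogeneousOp X.gr P.gr 0 X.φ.toOp :=
  X.morphism.graded.isHomogeneousOp

theorem evalWord_density (l : List (Homog X.gr)) : evalWord X.density l =
    partSum Homog.deg (fun s => evalWord P.M.toOp (s.map (wordImage X.isHomogeneousOp_φ))) l :=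
  evalWord_composeOp _ _ _

theorem isHomogeneousOp_density : IsHomogeneousOp X.gr P.gr 0 X.density := by
  intro n hn d x hx
  refine sum_mem fun c _ => Submodule.smul_of_tower_mem _ _ ?_
  have hc : 1 ≤ c.length := by
    have := (c.index ⟨0, hn⟩).isLt
    omega
  have h := P.M_symm.map_mem c.length hc (blockDeg c d) (onBlock X.φ.toOp c d x) fun i => by
    have := X.isHomogeneousOp_φ _ (c.partSize_pos i) (fun r => d (c.emb i r))
      (fun r => x (c.emb i r)) fun r => hx _
    rwa [add_zero] at this
  have e : ∑ i, blockDeg c d i = ∑ j, d j := c.sum_sigma_eq_sum d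
  rwa [e] at h

theorem gradedSymm_density :
    GradedSymm Homog.deg fun l : List (Homog X.gr) => evalWord X.density l := by
  intro l x y l'
  simp only [evalWord_density]
  exact (symmOnBlocks_evalWord P.M_symm X.morphism.graded).partSum_swap l x y l'

/-- As φ vanishes on longer words ending in the unit, the unit must be a block of its own; φ_1 sends
it to the unit of C, which M then absorbs. -/
theorem evalWord_density_append_one (l : List (Homog X.gr)) (hl : l ≠ []) (u : Homog X.gr)
    (hu : u.1.2 = X.one) : evalWord X.density (l ++ [u]) = evalWord X.density l := by
  rw [evalWord_density, evalWord_density, partSum_append_singleton Homog.deg u _ _ _ fun s => rfl]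
  · refine partSum_congr _ _ _ _ fun s _ hs' => ?_
    have hs : s ≠ [] := by
      rintro rfl
      simp at hs'
      exact hl (List.length_eq_zero_iff.1 hs'.symm)
    rw [List.map_append, List.map_cons, List.map_nil, evalWord_snoc_eq]
    have e : (wordImage X.isHomogeneousOp_φ [u]).1.2 = P.one := by
      rw [wordImage_of_ne_nil _ (by simp), ← X.morphism.map_one]
      exact congrArg (X.φ 1) (funext fun i => by fin_cases i; exact hu)
    rw [e]
    have hs₁ : 1 ≤ (s.map (wordImage X.isHomogeneousOp_φ)).length := by
      rw [List.length_map]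
      exact List.length_pos_iff.2 hs
    refine (P.M_unit _ hs₁ _).trans ?_
    conv_rhs => rw [← List.ofFn_get (s.map _), evalWord_ofFn]
    rfl
  · intro s b hb
    rw [List.map_append, List.map_cons, List.map_nil]
    obtain ⟨f, hf⟩ := P.M.evalWord_slot (s.map (wordImage X.isHomogeneousOp_φ)) []
    rw [hf, wordImage_of_ne_nil _ (by simp), evalWord_snoc_eq, hu]
    exact (congrArg f (X.morphism.map_unit b.length (List.length_pos_iff.2 hb)
      fun i => (b.get i).1.2)).trans (map_zero f)

/-- This is the morphism equation: the source structure is zero, and φ vanishes when one argument is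
0. -/
theorem partSum_ell (l : List (Homog X.gr)) (hl : l ≠ []) : partSum Homog.deg
    (fun s => evalWord P.ell (s.map (wordImage X.isHomogeneousOp_φ))) l = 0 := by
  rw [← evalWord_composeOp, ← List.ofFn_get l, evalWord_ofFn]
  refine (X.morphism.equation _ (List.length_pos_iff.2 hl) _ _ fun i => (l.get i).2).trans ?_
  refine sum_eq_zero fun c _ => sum_eq_zero fun i _ => ?_
  split_ifs
  · have : X.φ.toOp c.length (insertDeg c i (fun i => (l.get i).deg) 1)
        (insertBlock c i (fun i => (l.get i).1.2) 0) = 0 :=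
      (X.φ c.length).map_coord_zero i (Function.update_self _ _ _)
    exact (congrArg _ this).trans (smul_zero _)
  · rfl

/-- In K Π the blocks are divided into those fed to ℓ and the others. Regrouping by the letters A
used in the first kind gives the morphism equation for A in the first slot of M. -/
theorem K_density (l : List (Homog X.gr)) (hl : l ≠ []) : P.K (evalWord X.density l) = 0 := by
  rw [evalWord_density]
  refine (partSum_map Homog.deg P.K.toAddMonoidHom _ l).trans ?_
  let H : List (List (Homog X.gr)) → List (List (Homog X.gr)) → C := fun s s' =>
    evalWord P.M.toOp (wordImage P.isHomogeneousOp_ell (s.map (wordImage X.isHomogeneousOp_φ)) ::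
      s'.map (wordImage X.isHomogeneousOp_φ))
  rw [partSum_congr Homog.deg _ (fun s => splitSum (wordDeg Homog.deg) 0 s H), partSum_splitSum]
  · have hH : ∀ A A', partSum Homog.deg (fun s => partSum Homog.deg (H s) A') A = 0 := by
      intro A A'
      choose f hf using fun s' : List (List (Homog X.gr)) => P.M.evalWord_slot (gr := P.gr) []
        (s'.map (wordImage X.isHomogeneousOp_φ))
      -- For a fixed second part A', the sum over its partitions is additive in the first slot of M,
      -- so the sum over partitions of A can be taken inside it.
      let Φ : C →+ C :=
        { toFun := fun v => partSum Homog.deg (fun s' => f s' v) A'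
          map_zero' := by simp only [map_zero, partSum_zero]
          map_add' := fun v w => by simp only [map_add, partSum_add] }
      have e : ∀ s, partSum Homog.deg (H s) A' =
          Φ (wordImage P.isHomogeneousOp_ell (s.map (wordImage X.isHomogeneousOp_φ))).1.2 :=
        fun s => congrArg (fun G => partSum Homog.deg G A') (funext fun s' => hf s' _)
      simp only [e]
      rw [← partSum_map]
      rcases eq_or_ne A [] with rfl | hA
      · simp [partSum, wordImage_nil]
      · rw [partSum_congr Homog.deg _ (fun s =>
          evalWord P.ell (s.map (wordImage X.isHomogeneousOp_φ))), X.partSum_ell A hA, map_zero]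
        intro s _ hs
        refine wordImage_of_ne_nil _ ?_
        rintro h
        rw [List.map_eq_nil_iff] at h
        subst h
        simp at hs
        exact hA (List.length_eq_zero_iff.1 hs.symm)
    simp only [hH, splitSum_zero]
  · intro s _ hs
    have hs' : s ≠ [] := by
      rintro rfl
      simp at hs
      exact hl (List.length_eq_zero_iff.1 hs.symm)
    refine (P.K_evalWord _ (by simpa using hs')).trans ?_
    rw [splitSum_map_word, deg_comp_wordImage]

end CompleteSpace

/-! ### The correlation algebra of a finite sector -/

section Multilinearity

variable {k V V' W : Type*} [Field k] [AddCommGroup V] [Module k V] [AddCommGroup V'] [Module k V']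
  [AddCommGroup W] [Module k W]

theorem onBlock_update {A B : Type*} {n : ℕ} (F : Op A B) (c : OrderedFinpartition n)
    (d : Fin n → ℤ) (x : Fin n → A) (j : Fin n) (z : A) :
    onBlock F c d (Function.update x j z) = Function.update (onBlock F c d x) (c.index j)
      (F _ (fun r => d (c.emb (c.index j) r))
        (Function.update (fun r => x (c.emb (c.index j) r)) (c.invEmbedding j) z)) := by
  funext m
  by_cases h : m = c.index j
  · subst h
    rw [onBlock, Function.update_self]
    congr 1
    refine Eq.trans ?_ (Function.update_comp_eq_of_injective x
      (c.emb_strictMono (c.index j)).injective (c.invEmbedding j) z)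
    simp [Function.comp_def]
  · rw [Function.update_of_ne h, onBlock, onBlock]
    congr 1
    funext r
    rw [Function.update_of_ne]
    rintro rfl
    exact h (index_emb c m r).symm

theorem SlotLinear.composeOp (G : MultiOp k V' W) (F : MultiOp k V V') :
    SlotLinear k (composeOp G.toOp F.toOp) := by
  intro n d x j
  refine ⟨∑ c : OrderedFinpartition n, partSign c d •
    ((G c.length).toLinearMap (onBlock F.toOp c d x) (c.index j) ∘ₗ
      (F (c.partSize (c.index j))).toLinearMap (fun r => x (c.emb (c.index j) r))
        (c.invEmbedding j)), fun z => ?_⟩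
  rw [LinearMap.sum_apply]
  refine sum_congr rfl fun c _ => ?_
  rw [onBlock_update]
  rfl

theorem SlotLinear.map {F : Op V V'} (hF : SlotLinear k F) (h : V' →ₗ[k] W) :
    SlotLinear k fun n d x => h (F n d x) := by
  intro n d x j
  obtain ⟨f, hf⟩ := hF n d x j
  exact ⟨h ∘ₗ f, fun z => congrArg h (hf z)⟩

theorem composeOp_one (G : MultiOp k V' V') (hG : ∀ v, G 1 v = v 0) (F : MultiOp k V V')
    (d : Fin 1 → ℤ) (x : Fin 1 → V) : composeOp G.toOp F.toOp 1 d x = F 1 x := by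
  have h := sum_partSign_blocks Prod.fst
    (fun s => onWord G.toOp (s.map fun B => (0, onWord F.toOp B))) fun j => (d j, x j)
  trans partSum Prod.fst (fun s => onWord G.toOp (s.map fun B => (0, onWord F.toOp B)))
    (List.ofFn fun j => (d j, x j))
  · rw [← h]
    refine sum_congr rfl fun c _ => ?_
    rw [blocks, List.map_ofFn, onWord_ofFn]
    refine congrArg _ (congrArg (G c.length) (funext fun i => ?_))
    rw [Function.comp_apply, onWord_ofFn]
    rfl
  · rw [List.ofFn_succ, List.ofFn_zero]
    simp only [partSum, addLetter, joinSum, add_zero, List.map_cons, List.map_nil]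
    refine (hG _).trans ?_
    exact congrArg (F 1) (funext fun i => by fin_cases i; rfl)

end Multilinearity

/-! ### Structure constants of a finite sector -/

namespace CompleteSpace.FiniteSector

variable {k C S : Type*} [Field k] [AddCommGroup C] [Module k C] [AddCommGroup S] [Module k S]
  {P : HomotopyProbSpace k C} {X : CompleteSpace P S} {I : X.HomotopyInverse}
  (D : X.FiniteSector I)

set_option linter.unusedSectionVars false

/-- The grading of a sector. -/
def gr (i : ℤ) : Submodule k D.carrier := (X.gr i).comap D.carrier.subtype

/-- Homogeneous elements of a sector are homogeneous elements of the whole space. -/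
def incl (a : Homog D.gr) : Homog X.gr := ⟨(a.1.1, a.1.2), a.2⟩

theorem coe_product {n : ℕ} (hn : 1 ≤ n) (d : Fin n → ℤ) (x : Fin n → D.carrier)
    (hx : ∀ i, x i ∈ D.gr (d i)) :
    (D.product n d x : S) = X.product I n d fun i => (x i : S) := by
  have h : X.product I n d (fun i => (x i : S)) ∈ D.carrier :=
    D.product_mem n hn d _ hx fun i => (x i).2
  rw [product, dif_pos h]

theorem isHomogeneousOp_product : IsHomogeneousOp D.gr D.gr 0 D.product := by
  intro n hn d x hx
  rw [gr, Submodule.mem_comap, Submodule.subtype_apply, D.coe_product hn d x hx]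
  exact I.h_deg _ _ (X.isHomogeneousOp_density n hn d _ hx)

theorem product_one (d : Fin 1 → ℤ) (x : Fin 1 → D.carrier) : D.product 1 d x = x 0 := by
  have h : X.product I 1 d (fun i => (x i : S)) = x 0 := by
    rw [CompleteSpace.product, density, composeOp_one P.M P.M_one]
    refine Eq.trans ?_ (I.h_f _)
    exact congrArg I.h (congrArg (X.φ 1) (funext fun i => by fin_cases i; rfl))
  rw [product, dif_pos (by rw [h]; exact (x 0).2)]
  exact Subtype.ext h

theorem coe_evalWord_product (l : List (Homog D.gr)) (hl : l ≠ []) :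
    ((evalWord D.product l : D.carrier) : S) = I.h (evalWord X.density (l.map D.incl)) := by
  rw [← List.ofFn_get l, evalWord_ofFn, List.map_ofFn, evalWord_ofFn]
  exact D.coe_product (List.length_pos_iff.2 hl) _ _ fun i => (l.get i).2

theorem slotLinear_product : SlotLinear k (X.product I) :=
  (SlotLinear.composeOp P.M X.φ).map I.h

variable {J : Type*} [Fintype J] [LinearOrder J] (e : Module.Basis J k D.carrier) (deg : J → ℤ)

/-- Project to degree `deg ρ`: if d were different, v would go to 0, while the basis elements of
that degree are fixed, so linear independence would kill the coordinate at ρ. -/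
theorem deg_eq_of_repr_ne_zero (he : ∀ α, (e α : S) ∈ X.gr (deg α)) {v : D.carrier} {d : ℤ}
    (hv : v ∈ D.gr d) {ρ : J} (h : e.repr v ρ ≠ 0) : deg ρ = d := by
  classical
  by_contra hne
  apply h
  let _ := X.internal.chooseDecomposition
  let π : D.carrier →ₗ[k] S := (X.gr (deg ρ)).subtype ∘ₗ
    DirectSum.component k ℤ (fun i => X.gr i) (deg ρ) ∘ₗ
      (DirectSum.decomposeLinearEquiv X.gr).toLinearMap ∘ₗ D.carrier.subtype
  have h1 : π v = 0 := DirectSum.decompose_of_mem_ne X.gr hv (Ne.symm hne)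
  have h2 : ∀ α, π (e α) = if deg α = deg ρ then (e α : S) else 0 := by
    intro α
    split_ifs with hα
    · exact DirectSum.decompose_of_mem_same X.gr (hα ▸ he α)
    · exact DirectSum.decompose_of_mem_ne X.gr (he α) hα
  have h3 : ∑ α, (if deg α = deg ρ then e.repr v α else 0) • e α = 0 := by
    apply Subtype.ext
    rw [← e.sum_repr v, map_sum] at h1
    simp only [map_smul, h2] at h1
    rw [Submodule.coe_sum]
    refine Eq.trans (sum_congr rfl fun α _ => ?_) h1
    split_ifs <;> simp
  have := Fintype.linearIndependent_iff.1 e.linearIndependent _ h3 ρ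
  simpa using this

/-- The unit of S is nonzero, since φ_1 sends it to the unit of C, which is not exact; so its degree
is unambiguous. -/
theorem deg_unit (he : ∀ α, (e α : S) ∈ X.gr (deg α)) (o : J) (ho : (e o : S) = X.one) :
    deg o = 0 := by
  by_contra hne
  have h := (X.internal.submodule_iSupIndep.pairwiseDisjoint hne)
  have h0 : X.one = 0 := Submodule.disjoint_def.1 h _ (ho ▸ he o) X.one_mem
  apply P.unit_notMem_range
  rw [← X.morphism.map_one, h0]
  exact ⟨0, by rw [map_zero, (X.φ 1).map_coord_zero 0 rfl]⟩

variable {deg} (he : ∀ α, (e α : S) ∈ X.gr (deg α))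

/-- Basis elements as labelled homogeneous elements. -/
noncomputable def letter (α : J) : Homog D.gr := ⟨(deg α, e α), he α⟩

/-- The structure constants of the correlation algebra of a sector. -/
noncomputable def productConst (l : List J) (γ : J) : k :=
  e.repr (evalWord D.product (l.map (D.letter e he))) γ

/-- The structure constants of the operators attached to the correlation algebra of a sector. -/
noncomputable def primitiveConst (l : List J) (γ : J) : k :=
  e.repr (evalWord (primitive D.product) (l.map (D.letter e he))) γ

theorem gradedSymm_product :
    GradedSymm Homog.deg fun l : List (Homog D.gr) => evalWord D.product l := by
  intro l x y l'
  apply Subtype.ext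
  have h := X.gradedSymm_density (l.map D.incl) (D.incl x) (D.incl y) (l'.map D.incl)
  beta_reduce at h ⊢
  rw [D.coe_evalWord_product _ (by simp), List.map_append, List.map_cons, List.map_cons, h,
    I.h.map_smul_of_tower, Submodule.coe_smul_of_tower, D.coe_evalWord_product _ (by simp),
    List.map_append, List.map_cons, List.map_cons]
  rfl

theorem primitiveConst_degree (l : List J) (hl : l ≠ []) (ρ : J)
    (h : D.primitiveConst e he l ρ ≠ 0) : deg ρ = wordDeg deg l := by
  have := (primitive_mem D.isHomogeneousOp_product).evalWord_mem (l.map (D.letter e he))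
    (by simpa using hl)
  rw [wordDeg_map, add_zero] at this
  exact D.deg_eq_of_repr_ne_zero e deg he this h

theorem product_primitive (l B : List J) (hB : B ≠ []) :
    onWord D.product (l.map (fun α => (deg α, e α)) ++
      [(wordDeg deg B, evalWord (primitive D.product) (B.map (D.letter e he)))]) =
        ∑ ρ, D.primitiveConst e he B ρ • evalWord D.product ((l ++ [ρ]).map (D.letter e he)) := by
  set p := evalWord (primitive D.product) (B.map (D.letter e he)) with hp
  have hmem : p ∈ D.gr (wordDeg deg B) := by
    have := (primitive_mem D.isHomogeneousOp_product).evalWord_mem (B.map (D.letter e he))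
      (by simpa using hB)
    rwa [wordDeg_map, add_zero] at this
  -- The product of the sector is defined by cases on membership, so linearity in a slot is taken
  -- from the ambient space.
  have key : ∀ (v : D.carrier) (d : ℤ) (hv : v ∈ D.gr d),
      ((onWord D.product (l.map (fun α => (deg α, e α)) ++ [(d, v)]) : D.carrier) : S) =
        onWord (X.product I) (l.map (fun α => (deg α, (e α : S))) ++ [(d, (v : S))]) := by
    intro v d hv
    have h := D.coe_evalWord_product (l.map (D.letter e he) ++ [⟨(d, v), hv⟩]) (by simp)
    simp only [evalWord, List.map_append, List.map_map, List.map_cons, List.map_nil] at h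
    exact h
  apply Subtype.ext
  rw [key p _ hmem]
  obtain ⟨f, hf⟩ := (slotLinear_product (I := I)).onWord (l.map (fun α => (deg α, (e α : S))))
    (wordDeg deg B) []
  rw [hf, ← e.sum_repr p, Submodule.coe_sum, Submodule.coe_sum, map_sum]
  refine sum_congr rfl fun ρ _ => ?_
  rw [Submodule.coe_smul, Submodule.coe_smul, map_smul]
  -- Linearity holds for a fixed label |B|, while e_ρ carries the label `deg ρ`; these agree
  -- whenever the coefficient is nonzero.
  by_cases h : D.primitiveConst e he B ρ = 0
  · have h' : e.repr p ρ = 0 := h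
    rw [h, h', zero_smul, zero_smul]
  · change e.repr p ρ • _ = e.repr p ρ • _
    rw [← hf, ← D.primitiveConst_degree e he B hB ρ h, ← key (e ρ) (deg ρ) (he ρ)]
    simp only [evalWord, List.map_append, List.map_map, List.map_cons, List.map_nil]
    rfl

theorem isCorrelationConstants (o : J) (ho : (e o : S) = X.one) :
    IsCorrelationConstants deg o (D.productConst e he) (D.primitiveConst e he) where
  deg_unit := D.deg_unit e deg he o ho
  symm σ l x y l' := by
    have h := D.gradedSymm_product (l.map (D.letter e he)) (D.letter e he x) (D.letter e he y)
      (l'.map (D.letter e he))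
    beta_reduce at h ⊢
    simp only [productConst, List.map_append, List.map_cons]
    rw [h]
    exact (e.coord σ).map_smul_of_tower (deg x * deg y).negOnePow _
  single α σ := by
    have h : evalWord D.product ([α].map (D.letter e he)) = e α := D.product_one _ _
    rw [productConst, h, e.repr_self, Finsupp.single_apply]
  unit l hl σ := by
    rw [productConst, productConst]
    congr 2
    apply Subtype.ext
    rw [D.coe_evalWord_product _ (by simp), D.coe_evalWord_product _ (by simpa using hl),
      List.map_append, List.map_append, List.map_cons, List.map_cons, List.map_nil, List.map_nil,
      X.evalWord_density_append_one _ (by simpa using hl) _ ho]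
  degree l α β ρ h := by
    rw [D.primitiveConst_degree e he _ (by simp) ρ h]
    simp [add_assoc]
  recursion l α β σ := by
    have h := onWord_append_pair D.product D.product_one (l.map fun α => (deg α, e α))
      (deg α, e α) (deg β, e β)
    rw [splitSum_map_word] at h
    have h' : D.productConst e he (l ++ [α, β]) σ = e.coord σ (onWord D.product
        (l.map (fun α => (deg α, e α)) ++ [(deg α, e α), (deg β, e β)])) := by
      simp only [productConst, evalWord, List.map_append, List.map_map, List.map_cons,
        List.map_nil]
      rfl
    rw [h', h]
    refine (splitSum_map _ (e.coord σ).toAddMonoidHom _ _ _).trans ?_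
    congr 1
    funext pre B
    have h2 := D.product_primitive e he pre (B ++ [α, β]) (by simp)
    have h3 : onWord (primitive D.product)
        (B.map (fun α => (deg α, e α)) ++ [(deg α, e α), (deg β, e β)]) =
          evalWord (primitive D.product) ((B ++ [α, β]).map (D.letter e he)) := by
      simp only [evalWord, List.map_append, List.map_map, List.map_cons, List.map_nil]
      rfl
    have h4 : wordDeg Prod.fst
        (B.map (fun α => (deg α, e α)) ++ [(deg α, e α), (deg β, e β)]) =
          wordDeg deg (B ++ [α, β]) := by
      simp [wordDeg_map, Function.comp_def]
    rw [h3, h4, h2]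
    simp only [LinearMap.toAddMonoidHom_coe, map_sum, map_smul, smul_eq_mul]
    rfl

theorem connection_eq (α β γ : J) :
    D.connection e deg α β γ = connectionSeries deg (D.primitiveConst e he) α β γ := by
  refine congrArg SuperSeries.ofTensors (funext fun n => funext fun ρ => ?_)
  rw [structureConst, primitiveConst, ← ofFn_snoc_snoc, List.map_ofFn, evalWord_ofFn]
  rfl

/-- The density is K-closed, so φ_1 h changes it only by an exact term, which the expectation kills.
Hence the moment depends linearly on the product in the sector. -/
theorem moment_eq (l : List J) (hl : l ≠ []) :
    P.expect (evalWord X.density ((l.map (D.letter e he)).map D.incl)) =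
      ∑ σ, P.expect (X.φ 1 fun _ => (e σ : S)) * D.productConst e he l σ := by
  let f : S →ₗ[k] C := (X.φ 1).toLinearMap 0 0
  have hf : ∀ s, f s = X.φ 1 fun _ => s := fun s =>
    congrArg (X.φ 1) (funext fun i => by fin_cases i; exact Function.update_self _ _ _)
  set Y := evalWord X.density ((l.map (D.letter e he)).map D.incl)
  have hK : P.K Y = 0 := X.K_density _ (by simpa using hl)
  have h1 : P.expect (f (I.h Y)) = P.expect Y := by
    rw [hf, I.f_h, hK, map_zero, add_zero, map_add, P.expect_K, add_zero]
  rw [← h1, ← D.coe_evalWord_product _ (by simpa using hl), ← e.sum_repr (evalWord D.product _),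
    Submodule.coe_sum, map_sum, map_sum]
  refine sum_congr rfl fun σ _ => ?_
  rw [Submodule.coe_smul, map_smul, map_smul, hf, smul_eq_mul, mul_comm]
  rfl

theorem momentGen_eq : D.momentGen e deg = 1 + SuperSeries.ofTensors fun _ ρ =>
    if List.ofFn ρ = [] then 0 else
      P.expect (evalWord X.density (((List.ofFn ρ).map (D.letter e he)).map D.incl)) := by
  refine congrArg (1 + SuperSeries.ofTensors ·) (funext fun n => funext fun ρ => ?_)
  have h : List.ofFn ρ = [] ↔ n = 0 := by rw [← List.length_eq_zero_iff, List.length_ofFn]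
  simp only [h, List.map_ofFn, evalWord_ofFn]
  rfl

end CompleteSpace.FiniteSector

end HomotopyProbability

/-! ### The connection and the moment equations of a finite sector -/

open HomotopyProbability HomotopyProbability.SuperSeries in
theorem mainTheorem12 {k C S J : Type*} [Field k] [CharZero k] [AddCommGroup C] [Module k C]
    [AddCommGroup S] [Module k S] [Fintype J] [LinearOrder J]
    (P : HomotopyProbSpace k C) (X : CompleteSpace P S) (I : X.HomotopyInverse)
    (D : X.FiniteSector I) (e : Module.Basis J k D.carrier) (deg : J → ℤ)
    (he : ∀ α, (e α : S) ∈ X.gr (deg α)) (o : J) (ho : (e o : S) = X.one) :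
    let A : J → J → J → SuperSeries k deg := D.connection e deg
    let Z : SuperSeries k deg := D.momentGen e deg
    (∀ β γ, A o β γ = if β = γ then 1 else 0) ∧
    (∀ α β γ, A α β γ = (deg α * deg β).negOnePow • A β α γ) ∧
    (∀ α β γ σ,
      partialD α (A β γ σ) - (deg α * deg β).negOnePow • partialD β (A α γ σ)
        + ∑ ρ, ((deg α * (deg β + deg γ - deg ρ)).negOnePow • (A β γ ρ * A α ρ σ)
            - (deg α * deg β).negOnePow •
              (deg β * (deg α + deg γ - deg ρ)).negOnePow • (A α γ ρ * A β ρ σ)) = 0) ∧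
    (∀ α β, partialD α (partialD β Z) - ∑ γ, A α β γ * partialD γ Z = 0) ∧
    partialD o Z - Z = 0 := by
  have h := D.isCorrelationConstants e he o ho
  have hA : D.connection e deg = connectionSeries deg (D.primitiveConst e he) :=
    funext fun α => funext fun β => funext fun γ => D.connection_eq e he α β γ
  have hone : P.expect (X.φ 1 fun _ => (e o : S)) = 1 := by
    rw [ho, X.morphism.map_one, P.expect_unit]
  intro A Z
  simp only [A, Z, hA, D.momentGen_eq e he]
  exact ⟨h.connection_unit, h.connection_symm, h.connection_flat,
    h.generating_function (fun σ => P.expect (X.φ 1 fun _ => (e σ : S))) hone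
      (fun l => P.expect (evalWord X.density ((l.map (D.letter e he)).map D.incl)))
      (D.moment_eq e he)⟩
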